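/- Let $k$ be a field of characteristic zero (for instance $k=\mathbb{R}$) and let $\mathfrak{g}$ be a finite-dimensional Lie algebra over $k$. Let $S^+\mathfrak{g}=\bigoplus_{n\ge 1}S^n\mathfrak{g}$, graded by $\deg S^n\mathfrak{g}=1-2n$, and let $\mathcal{L}(S^+\mathfrak{g})$ be the free graded Lie algebra generated by the graded vector space $S^+\mathfrak{g}$; write $\mathcal{I}(u)$ for the generator given by $u\in S^+\mathfrak{g}$. Let $D\mathfrak{g}=\mathfrak{g}\ltimes\mathcal{L}(S^+\mathfrak{g})$ be the semi-direct sum, where $\mathfrak{g}$ is in degree $0$ and $x\in\mathfrak{g}$ acts on $\mathcal{L}(S^+\mathfrak{g})$ by the derivation induced by the adjoint action on $S^+\mathfrak{g}$; write $l(x)\in D\mathfrak{g}$ for the element given by $x\in\mathfrak{g}$. Put $i(x)=\sum_{k\ge1}\mathcal{I}(x^k)$ (a formal sum; identities involving $i(x)$ are read in each power of $x$ separately). 1. There is a unique derivation $d$ of degree $1$ of $D\mathfrak{g}$ such that, for all $x\in\mathfrak{g}$, $dl(x)=0$ and $di(x)=\tfrac12[i(x),i(x)]+l(x)$, that is, $$d\mathcal{I}(x)=l(x),\qquad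 d\mathcal{I}(x^k)=\tfrac12\sum_{s=1}^{k-1}[\mathcal{I}(x^s),\mathcal{I}(x^{k-s})]\quad(k\ge2).$$ It satisfies $d^2=0$, and the complex $(D\mathfrak{g},d)$ is acyclic: $H^n(D\mathfrak{g},d)=0$ for all $n\in\mathbb{Z}$. 2. There is a unique derivation $d$ of degree $1$ of $\mathcal{L}(S^+\mathfrak{g})$ such that $di(x)=\tfrac12[i(x),i(x)]$ for all $x\in\mathfrak{g}$, that is, $d\mathcal{I}(x^k)=\tfrac12\sum_{s=1}^{k-1}[\mathcal{I}(x^s),\mathcal{I}(x^{k-s})]$ for all $k\ge1$. It satisfies $d^2=0$. Its cohomology is $\mathfrak{g}=S^1\mathfrak{g}\subset S^+\mathfrak{g}$, in degree $-1$: $H^n(\mathcal{L}(S^+\mathfrak{g}),d)=0$ for $n\ne-1$, each $\mathcal{I}(x)$ with $x\in\mathfrak{g}$ is a cocycle of degree $-1$, and $x\mapsto[\mathcal{I}(x)]$ is a linear isomorphism $\mathfrak{g}\to H^{-1}(\mathcal{L}(S^+\mathfrak{g}),d)$. -/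

import Mathlib

noncomputable section

namespace CartanDGLA

universe u v w

/-! ### The free graded Lie algebra on a graded vector space -/

section FreeGradedLie

variable (𝕜 : Type u) [Field 𝕜] {ι : Type v} (V : ι → Type w)
  [∀ i, AddCommGroup (V i)] [∀ i, Module 𝕜 (V i)] (deg : ι → ℤ)

/-- Nonassociative polynomials in the homogeneous elements `v ∈ V i` of `⨁ i, V i`. -/
abbrev PreLie := FreeNonUnitalNonAssocAlgebra 𝕜 (Σ i, V i)

variable {V} in
/-- The degree of a nonassociative word, where the letter `v ∈ V i` has degree `deg i`. -/
def wordDegree : FreeMagma (Σ i, V i) → ℤ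
  | .of x => deg x.1
  | .mul a b => wordDegree a + wordDegree b

/-- The nonassociative polynomials which are homogeneous of degree `p`. -/
def PreLie.homogeneous (p : ℤ) : Submodule 𝕜 (PreLie 𝕜 V) :=
  Submodule.span 𝕜 {a | ∃ m, wordDegree deg m = p ∧ a = MonoidAlgebra.single m (1 : 𝕜)}

variable {V} in
/-- The letter `v ∈ V i`. -/
def PreLie.letter (i : ι) (v : V i) : PreLie 𝕜 V :=
  FreeNonUnitalNonAssocAlgebra.of 𝕜 (⟨i, v⟩ : Σ i, V i)

/-- The relations of the free graded Lie algebra: linearity in the generators, graded antisymmetry,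
the graded Jacobi identity, and all consequences of these under multiplication. -/
inductive PreLie.IsRelation : PreLie 𝕜 V → Prop
  | add (i : ι) (v v' : V i) :
      IsRelation (letter 𝕜 i (v + v') - letter 𝕜 i v - letter 𝕜 i v')
  | smul (i : ι) (c : 𝕜) (v : V i) :
      IsRelation (letter 𝕜 i (c • v) - c • letter 𝕜 i v)
  | antisymm (p q : ℤ) (a b : PreLie 𝕜 V) (ha : a ∈ homogeneous 𝕜 V deg p)
      (hb : b ∈ homogeneous 𝕜 V deg q) :
      IsRelation (a * b + (p * q).negOnePow • (b * a))
  | jacobi (p q r : ℤ) (a b c : PreLie 𝕜 V) (ha : a ∈ homogeneous 𝕜 V deg p)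
      (hb : b ∈ homogeneous 𝕜 V deg q) (hc : c ∈ homogeneous 𝕜 V deg r) :
      IsRelation (a * (b * c) - (a * b) * c - (p * q).negOnePow • (b * (a * c)))
  | mul_left (a b : PreLie 𝕜 V) (h : IsRelation b) : IsRelation (a * b)
  | mul_right (a b : PreLie 𝕜 V) (h : IsRelation a) : IsRelation (a * b)

/-- The two-sided ideal generated by the relations of the free graded Lie algebra. -/
def PreLie.ideal : Submodule 𝕜 (PreLie 𝕜 V) :=
  Submodule.span 𝕜 {a | PreLie.IsRelation 𝕜 V deg a}

theorem PreLie.mul_mem_ideal_left (a : PreLie 𝕜 V) {b : PreLie 𝕜 V}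
    (hb : b ∈ PreLie.ideal 𝕜 V deg) : a * b ∈ PreLie.ideal 𝕜 V deg := by
  induction hb using Submodule.span_induction with
  | mem x hx => exact Submodule.subset_span (.mul_left a x hx)
  | zero => simp
  | add x y _ _ hx hy => rw [mul_add]; exact add_mem hx hy
  | smul c x _ hx => rw [mul_smul_comm]; exact Submodule.smul_mem _ _ hx

theorem PreLie.mul_mem_ideal_right {a : PreLie 𝕜 V} (b : PreLie 𝕜 V)
    (ha : a ∈ PreLie.ideal 𝕜 V deg) : a * b ∈ PreLie.ideal 𝕜 V deg := by
  induction ha using Submodule.span_induction with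
  | mem x hx => exact Submodule.subset_span (.mul_right x b hx)
  | zero => simp
  | add x y _ _ hx hy => rw [add_mul]; exact add_mem hx hy
  | smul c x _ hx => rw [smul_mul_assoc]; exact Submodule.smul_mem _ _ hx

/-- The free graded Lie algebra `𝓛(V)` on the graded vector space `⨁ i, V i`, where `V i` is placed
in degree `deg i`: generators are the elements of the `V i`, and the relations are linearity,
graded antisymmetry and the graded Jacobi identity. -/
def FreeGradedLie : Type (max u v w) := PreLie 𝕜 V ⧸ PreLie.ideal 𝕜 V deg

namespace FreeGradedLie

instance : AddCommGroup (FreeGradedLie 𝕜 V deg) :=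
  inferInstanceAs (AddCommGroup (PreLie 𝕜 V ⧸ PreLie.ideal 𝕜 V deg))

instance : Module 𝕜 (FreeGradedLie 𝕜 V deg) :=
  inferInstanceAs (Module 𝕜 (PreLie 𝕜 V ⧸ PreLie.ideal 𝕜 V deg))

/-- The quotient map from nonassociative polynomials. -/
def mk : PreLie 𝕜 V →ₗ[𝕜] FreeGradedLie 𝕜 V deg := (PreLie.ideal 𝕜 V deg).mkQ

/-- The bracket, as a bilinear map. It is induced by the product of nonassociative polynomials. -/
def bracket : FreeGradedLie 𝕜 V deg →ₗ[𝕜] FreeGradedLie 𝕜 V deg →ₗ[𝕜] FreeGradedLie 𝕜 V deg :=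
  (PreLie.ideal 𝕜 V deg).liftQ
    (LinearMap.mk₂ 𝕜
      (fun a => ((PreLie.ideal 𝕜 V deg).mapQ (PreLie.ideal 𝕜 V deg) (LinearMap.mulLeft 𝕜 a)
        (fun _ hb => PreLie.mul_mem_ideal_left 𝕜 V deg a hb)))
      (by
        intro a a' b
        obtain ⟨b, rfl⟩ := Submodule.Quotient.mk_surjective _ b
        exact congrArg (PreLie.ideal 𝕜 V deg).mkQ (add_mul a a' b))
      (by
        intro c a b
        obtain ⟨b, rfl⟩ := Submodule.Quotient.mk_surjective _ b
        exact congrArg (PreLie.ideal 𝕜 V deg).mkQ (smul_mul_assoc c a b))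
      (by intro a b b'; exact map_add _ _ _)
      (by intro c a b; exact map_smul _ _ _))
    (by
      intro a ha
      refine LinearMap.mem_ker.2 (LinearMap.ext fun b => ?_)
      obtain ⟨b, rfl⟩ := Submodule.Quotient.mk_surjective _ b
      exact (Submodule.Quotient.mk_eq_zero _).2 (PreLie.mul_mem_ideal_right 𝕜 V deg b ha))

instance : Bracket (FreeGradedLie 𝕜 V deg) (FreeGradedLie 𝕜 V deg) where
  bracket a b := bracket 𝕜 V deg a b

variable {𝕜 V deg} in
theorem mk_lie_mk (a b : PreLie 𝕜 V) :
    ⁅mk 𝕜 V deg a, mk 𝕜 V deg b⁆ = mk 𝕜 V deg (a * b) := rfl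

/-- The inclusion of the generators `V i`. -/
def of (i : ι) : V i →ₗ[𝕜] FreeGradedLie 𝕜 V deg where
  toFun v := mk 𝕜 V deg (PreLie.letter 𝕜 i v)
  map_add' v v' := by
    rw [← map_add, ← sub_eq_zero, ← map_sub, ← sub_sub]
    exact (Submodule.Quotient.mk_eq_zero _).2 (Submodule.subset_span (.add i v v'))
  map_smul' c v := by
    rw [RingHom.id_apply, ← map_smul, ← sub_eq_zero, ← map_sub]
    exact (Submodule.Quotient.mk_eq_zero _).2 (Submodule.subset_span (.smul i c v))

/-- The component of degree `p` of the free graded Lie algebra. -/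
def component (p : ℤ) : Submodule 𝕜 (FreeGradedLie 𝕜 V deg) :=
  (PreLie.homogeneous 𝕜 V deg p).map (mk 𝕜 V deg)

end FreeGradedLie

/-! A degree zero linear map of the generators extends to a derivation. -/

variable {V}

/-- The derivation of nonassociative polynomials extending `f`, on words. -/
def PreLie.derivationWord (f : ∀ i, V i →ₗ[𝕜] V i) : FreeMagma (Σ i, V i) → PreLie 𝕜 V
  | .of x => PreLie.letter 𝕜 x.1 (f x.1 x.2)
  | .mul a b => derivationWord f a * MonoidAlgebra.single b 1 +
      MonoidAlgebra.single a 1 * derivationWord f b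

/-- The derivation of nonassociative polynomials extending `f`. -/
def PreLie.derivation (f : ∀ i, V i →ₗ[𝕜] V i) : PreLie 𝕜 V →ₗ[𝕜] PreLie 𝕜 V :=
  Finsupp.lift (PreLie 𝕜 V) 𝕜 (FreeMagma (Σ i, V i)) (PreLie.derivationWord 𝕜 f) ∘ₗ
    (MonoidAlgebra.coeffLinearEquiv 𝕜).toLinearMap

theorem PreLie.derivation_single (f : ∀ i, V i →ₗ[𝕜] V i) (m : FreeMagma (Σ i, V i)) (c : 𝕜) :
    PreLie.derivation 𝕜 f (MonoidAlgebra.single m c) = c • PreLie.derivationWord 𝕜 f m := by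
  simp [PreLie.derivation]

theorem PreLie.derivation_letter (f : ∀ i, V i →ₗ[𝕜] V i) (i : ι) (x : V i) :
    PreLie.derivation 𝕜 f (PreLie.letter 𝕜 i x) = PreLie.letter 𝕜 i (f i x) := by
  change PreLie.derivation 𝕜 f (MonoidAlgebra.single (FreeMagma.of ⟨i, x⟩) 1) = _
  rw [PreLie.derivation_single, one_smul]; rfl

theorem PreLie.derivation_mul (f : ∀ i, V i →ₗ[𝕜] V i) (a b : PreLie 𝕜 V) :
    PreLie.derivation 𝕜 f (a * b) = PreLie.derivation 𝕜 f a * b + a * PreLie.derivation 𝕜 f b := by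
  induction a using MonoidAlgebra.induction_linear with
  | zero => simp
  | add a a' ha ha' => simp only [add_mul, map_add, ha, ha']; abel
  | single m c =>
    induction b using MonoidAlgebra.induction_linear with
    | zero => simp
    | add b b' hb hb' => simp only [mul_add, map_add, hb, hb']; abel
    | single n e =>
      have h1 : (MonoidAlgebra.single m c : PreLie 𝕜 V) = c • MonoidAlgebra.single m 1 := by simp
      have h2 : (MonoidAlgebra.single n e : PreLie 𝕜 V) = e • MonoidAlgebra.single n 1 := by simp
      rw [h1, h2]
      simp only [smul_mul_assoc, mul_smul_comm, map_smul, MonoidAlgebra.single_mul_single, mul_one,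
        PreLie.derivation_single, one_smul, ← smul_add]
      rw [show m * n = FreeMagma.mul m n from rfl, PreLie.derivationWord, smul_add, smul_add]

set_option linter.unusedSectionVars false in
theorem PreLie.mul_mem_homogeneous {p q : ℤ} {a b : PreLie 𝕜 V}
    (ha : a ∈ PreLie.homogeneous 𝕜 V deg p) (hb : b ∈ PreLie.homogeneous 𝕜 V deg q) :
    a * b ∈ PreLie.homogeneous 𝕜 V deg (p + q) := by
  induction ha using Submodule.span_induction with
  | zero => simp
  | add x y _ _ hx hy => rw [add_mul]; exact add_mem hx hy
  | smul c x _ hx => rw [smul_mul_assoc]; exact Submodule.smul_mem _ _ hx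
  | mem x hx =>
    obtain ⟨m, hm, rfl⟩ := hx
    induction hb using Submodule.span_induction with
    | zero => simp
    | add x y _ _ hx hy => rw [mul_add]; exact add_mem hx hy
    | smul c x _ hx => rw [mul_smul_comm]; exact Submodule.smul_mem _ _ hx
    | mem y hy =>
      obtain ⟨n, hn, rfl⟩ := hy
      refine Submodule.subset_span ⟨m * n, ?_, by simp⟩
      rw [show m * n = FreeMagma.mul m n from rfl, wordDegree, hm, hn]

theorem PreLie.derivation_mem_homogeneous (f : ∀ i, V i →ₗ[𝕜] V i) {p : ℤ} {a : PreLie 𝕜 V}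
    (ha : a ∈ PreLie.homogeneous 𝕜 V deg p) :
    PreLie.derivation 𝕜 f a ∈ PreLie.homogeneous 𝕜 V deg p := by
  induction ha using Submodule.span_induction with
  | zero => simp
  | add x y _ _ hx hy => rw [map_add]; exact add_mem hx hy
  | smul c x _ hx => rw [map_smul]; exact Submodule.smul_mem _ _ hx
  | mem x hx =>
    obtain ⟨m, hm, rfl⟩ := hx
    rw [PreLie.derivation_single, one_smul]
    induction m using FreeMagma.rec generalizing p with
    | of x => exact Submodule.subset_span ⟨FreeMagma.of ⟨x.1, f x.1 x.2⟩, hm, rfl⟩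
    | mul a b iha ihb =>
      rw [wordDegree] at hm
      subst hm
      exact add_mem
        (PreLie.mul_mem_homogeneous 𝕜 deg (iha rfl) (Submodule.subset_span ⟨b, rfl, rfl⟩))
        (PreLie.mul_mem_homogeneous 𝕜 deg (Submodule.subset_span ⟨a, rfl, rfl⟩) (ihb rfl))

theorem PreLie.derivation_mem_ideal (f : ∀ i, V i →ₗ[𝕜] V i) {a : PreLie 𝕜 V}
    (ha : a ∈ PreLie.ideal 𝕜 V deg) : PreLie.derivation 𝕜 f a ∈ PreLie.ideal 𝕜 V deg := by
  induction ha using Submodule.span_induction with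
  | zero => simp
  | add x y _ _ hx hy => rw [map_add]; exact add_mem hx hy
  | smul c x _ hx => rw [map_smul]; exact Submodule.smul_mem _ _ hx
  | mem x hx =>
    have key : ∀ {y : PreLie 𝕜 V}, PreLie.IsRelation 𝕜 V deg y → y ∈ PreLie.ideal 𝕜 V deg :=
      fun h => Submodule.subset_span h
    induction hx with
    | add i x y =>
      simp only [map_sub, PreLie.derivation_letter, map_add]
      exact key (.add i _ _)
    | smul i c x =>
      simp only [map_sub, PreLie.derivation_letter, map_smul]
      exact key (.smul i c _)
    | antisymm p q a b ha hb =>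
      have ha' := PreLie.derivation_mem_homogeneous 𝕜 deg f ha
      have hb' := PreLie.derivation_mem_homogeneous 𝕜 deg f hb
      convert add_mem (key (.antisymm p q _ _ ha' hb)) (key (.antisymm p q _ _ ha hb')) using 1
      simp only [map_add, Units.smul_def, map_zsmul, PreLie.derivation_mul, smul_add]
      abel
    | jacobi p q r a b c ha hb hc =>
      have ha' := PreLie.derivation_mem_homogeneous 𝕜 deg f ha
      have hb' := PreLie.derivation_mem_homogeneous 𝕜 deg f hb
      have hc' := PreLie.derivation_mem_homogeneous 𝕜 deg f hc
      convert add_mem (add_mem (key (.jacobi p q r _ _ _ ha' hb hc))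
        (key (.jacobi p q r _ _ _ ha hb' hc))) (key (.jacobi p q r _ _ _ ha hb hc')) using 1
      simp only [map_sub, Units.smul_def, map_zsmul, PreLie.derivation_mul, smul_add, mul_add,
        add_mul]
      abel
    | mul_left a b hb ih =>
      rw [PreLie.derivation_mul]
      exact add_mem (PreLie.mul_mem_ideal_left 𝕜 V deg _ (key hb))
        (PreLie.mul_mem_ideal_left 𝕜 V deg _ ih)
    | mul_right a b hb ih =>
      rw [PreLie.derivation_mul]
      exact add_mem (PreLie.mul_mem_ideal_right 𝕜 V deg _ ih)
        (PreLie.mul_mem_ideal_right 𝕜 V deg _ (key hb))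

/-- The derivation of the free graded Lie algebra which extends the degree zero linear map `f` of
the generators. -/
def FreeGradedLie.derivation (f : ∀ i, V i →ₗ[𝕜] V i) :
    FreeGradedLie 𝕜 V deg →ₗ[𝕜] FreeGradedLie 𝕜 V deg :=
  (PreLie.ideal 𝕜 V deg).mapQ (PreLie.ideal 𝕜 V deg) (PreLie.derivation 𝕜 f)
    (fun _ ha => PreLie.derivation_mem_ideal 𝕜 deg f ha)

theorem FreeGradedLie.derivation_of (f : ∀ i, V i →ₗ[𝕜] V i) (i : ι) (x : V i) :
    FreeGradedLie.derivation 𝕜 deg f (FreeGradedLie.of 𝕜 V deg i x) =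
      FreeGradedLie.of 𝕜 V deg i (f i x) := by
  change FreeGradedLie.mk 𝕜 V deg (PreLie.derivation 𝕜 f _) = _
  rw [PreLie.derivation_letter]; rfl

theorem FreeGradedLie.derivation_lie (f : ∀ i, V i →ₗ[𝕜] V i) (a b : FreeGradedLie 𝕜 V deg) :
    FreeGradedLie.derivation 𝕜 deg f ⁅a, b⁆ =
      ⁅FreeGradedLie.derivation 𝕜 deg f a, b⁆ + ⁅a, FreeGradedLie.derivation 𝕜 deg f b⁆ := by
  obtain ⟨a, rfl⟩ := Submodule.Quotient.mk_surjective _ a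
  obtain ⟨b, rfl⟩ := Submodule.Quotient.mk_surjective _ b
  change FreeGradedLie.mk 𝕜 V deg (PreLie.derivation 𝕜 f (a * b)) = _
  rw [PreLie.derivation_mul, map_add]; rfl

end FreeGradedLie

/-! ### Graded derivations and cohomology -/

section Graded

variable {𝕜 : Type u} [Field 𝕜] {M : Type v} [AddCommGroup M] [Module 𝕜 M]

/-- `d` is a derivation of degree one of a bracket on a space with graded components `A n`. -/
structure IsDegreeOneDerivation [Bracket M M] (A : ℤ → Submodule 𝕜 M) (d : M →ₗ[𝕜] M) : Prop where
  map_mem : ∀ n, ∀ a ∈ A n, d a ∈ A (n + 1)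
  leibniz : ∀ n, ∀ a ∈ A n, ∀ b, d ⁅a, b⁆ = ⁅d a, b⁆ + n.negOnePow • ⁅a, d b⁆

/-- The cocycles of degree `n`. -/
def cocycles (A : ℤ → Submodule 𝕜 M) (d : M →ₗ[𝕜] M) (n : ℤ) : Submodule 𝕜 M :=
  A n ⊓ LinearMap.ker d

/-- The coboundaries of degree `n`. -/
def coboundaries (A : ℤ → Submodule 𝕜 M) (d : M →ₗ[𝕜] M) (n : ℤ) : Submodule 𝕜 M :=
  (A (n - 1)).map d

/-- The cohomology in degree `n` of the complex with components `A n` and differential `d`. -/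
abbrev Cohomology (A : ℤ → Submodule 𝕜 M) (d : M →ₗ[𝕜] M) (n : ℤ) : Type v :=
  cocycles A d n ⧸ (coboundaries A d n).submoduleOf (cocycles A d n)

end Graded

/-! ### The graded vector space `S⁺𝔤` with the adjoint action -/

section Sym

variable (𝕜 : Type u) [Field 𝕜] (𝔤 : Type v) [LieRing 𝔤] [LieAlgebra 𝕜 𝔤]

/-- The symmetric power `Sⁿ𝔤`, as the span of the products of `n` elements of `𝔤` in `S𝔤`. -/
def symPow (n : ℕ) : Submodule 𝕜 (SymmetricAlgebra 𝕜 𝔤) :=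
  (LinearMap.range (SymmetricAlgebra.ι 𝕜 𝔤)) ^ n

/-- The power `xⁿ ∈ Sⁿ𝔤`. -/
def symPow.pow (x : 𝔤) (n : ℕ) : symPow 𝕜 𝔤 n :=
  ⟨SymmetricAlgebra.ι 𝕜 𝔤 x ^ n, Submodule.pow_mem_pow _ (LinearMap.mem_range_self _ x) n⟩

variable {𝔤}

/-- The homomorphism `S𝔤 → S𝔤[ε]` with `y ↦ y + ε [x, y]`. -/
def adHom (x : 𝔤) : SymmetricAlgebra 𝕜 𝔤 →ₐ[𝕜] DualNumber (SymmetricAlgebra 𝕜 𝔤) :=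
  SymmetricAlgebra.lift
    { toFun := fun y => (TrivSqZeroExt.inl (SymmetricAlgebra.ι 𝕜 𝔤 y) +
        TrivSqZeroExt.inr (SymmetricAlgebra.ι 𝕜 𝔤 ⁅x, y⁆) : DualNumber (SymmetricAlgebra 𝕜 𝔤))
      map_add' := fun y z => by ext <;> simp
      map_smul' := fun c y => by ext <;> simp }

theorem fst_adHom (x : 𝔤) (a : SymmetricAlgebra 𝕜 𝔤) : (adHom 𝕜 x a).fst = a := by
  induction a using SymmetricAlgebra.induction with
  | algebraMap r => rw [AlgHom.commutes]; rfl
  | ι y => simp [adHom]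
  | mul a b ha hb => simp [ha, hb]
  | add a b ha hb => simp [ha, hb]

/-- The adjoint action of `x ∈ 𝔤` on `S𝔤`: the `ε`-part of `adHom`, that is, the derivation of `S𝔤`
with `y ↦ [x, y]` on generators `y ∈ 𝔤`. -/
def symAd (x : 𝔤) : SymmetricAlgebra 𝕜 𝔤 →ₗ[𝕜] SymmetricAlgebra 𝕜 𝔤 where
  toFun a := (adHom 𝕜 x a).snd
  map_add' a b := by simp
  map_smul' c a := by simp

theorem symAd_ι (x y : 𝔤) :
    symAd 𝕜 x (SymmetricAlgebra.ι 𝕜 𝔤 y) = SymmetricAlgebra.ι 𝕜 𝔤 ⁅x, y⁆ := by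
  simp [symAd, adHom]

theorem symAd_mul (x : 𝔤) (a b : SymmetricAlgebra 𝕜 𝔤) :
    symAd 𝕜 x (a * b) = symAd 𝕜 x a * b + a * symAd 𝕜 x b := by
  simp [symAd, fst_adHom, add_comm, mul_comm]

theorem symAd_mem (x : 𝔤) (n : ℕ) (a : SymmetricAlgebra 𝕜 𝔤) (ha : a ∈ symPow 𝕜 𝔤 n) :
    symAd 𝕜 x a ∈ symPow 𝕜 𝔤 n := by
  refine Submodule.pow_induction_on_left' (LinearMap.range (SymmetricAlgebra.ι 𝕜 𝔤))
    (C := fun n a _ => symAd 𝕜 x a ∈ symPow 𝕜 𝔤 n) (fun r => ?_) ?_ ?_ ha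
  · have : symAd 𝕜 x (algebraMap 𝕜 _ r) = 0 := by
      change (adHom 𝕜 x (algebraMap 𝕜 _ r)).snd = 0
      rw [AlgHom.commutes]; rfl
    rw [this]; exact zero_mem _
  · intro a b i _ _ ha hb
    rw [map_add]; exact add_mem ha hb
  · rintro m ⟨y, rfl⟩ i a ha ih
    rw [symAd_mul, symAd_ι, symPow, pow_succ']
    exact add_mem (Submodule.mul_mem_mul ⟨_, rfl⟩ ha) (Submodule.mul_mem_mul ⟨_, rfl⟩ ih)

/-- The adjoint action of `x ∈ 𝔤` on `Sⁿ𝔤`. -/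
def symPowAd (x : 𝔤) (n : ℕ) : symPow 𝕜 𝔤 n →ₗ[𝕜] symPow 𝕜 𝔤 n :=
  (symAd 𝕜 x).restrict (symAd_mem 𝕜 x n)

variable (𝔤)

/-- The components `Sⁿ𝔤`, `n ≥ 1`, of the graded vector space `S⁺𝔤`. -/
abbrev SPlus (n : ℕ+) : Type (max u v) := symPow 𝕜 𝔤 n

/-- The degree `1 - 2n` of `Sⁿ𝔤` in `S⁺𝔤`. -/
def SPlusDeg (n : ℕ+) : ℤ := 1 - 2 * (n : ℤ)

/-- The free graded Lie algebra `𝓛(S⁺𝔤)`. -/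
abbrev LSPlus : Type (max u v) := FreeGradedLie 𝕜 (SPlus 𝕜 𝔤) SPlusDeg

/-- The component of degree `n` of `𝓛(S⁺𝔤)`. -/
abbrev LSPlus.component (n : ℤ) : Submodule 𝕜 (LSPlus 𝕜 𝔤) :=
  FreeGradedLie.component 𝕜 (SPlus 𝕜 𝔤) SPlusDeg n

variable {𝔤}

/-- The generator `𝓘(xᵏ)` of `𝓛(S⁺𝔤)`. -/
def LSPlus.I (x : 𝔤) (k : ℕ+) : LSPlus 𝕜 𝔤 :=
  FreeGradedLie.of 𝕜 (SPlus 𝕜 𝔤) SPlusDeg k (symPow.pow 𝕜 𝔤 x k)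

/-- The action of `x ∈ 𝔤` on `𝓛(S⁺𝔤)` by the derivation which extends the adjoint action. -/
def LSPlus.act (x : 𝔤) : LSPlus 𝕜 𝔤 →ₗ[𝕜] LSPlus 𝕜 𝔤 :=
  FreeGradedLie.derivation 𝕜 SPlusDeg (fun n : ℕ+ => symPowAd 𝕜 x n)

end Sym

/-! ### The semi-direct sum `D𝔤 = 𝔤 ⋉ 𝓛(S⁺𝔤)` -/

section Dg

variable (𝕜 : Type u) [Field 𝕜] (𝔤 : Type v) [LieRing 𝔤] [LieAlgebra 𝕜 𝔤]

/-- The space `D𝔤 = 𝔤 ⊕ 𝓛(S⁺𝔤)`. -/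
def Dg : Type (max u v) := 𝔤 × LSPlus 𝕜 𝔤

namespace Dg

instance : AddCommGroup (Dg 𝕜 𝔤) := inferInstanceAs (AddCommGroup (𝔤 × LSPlus 𝕜 𝔤))

instance : Module 𝕜 (Dg 𝕜 𝔤) := inferInstanceAs (Module 𝕜 (𝔤 × LSPlus 𝕜 𝔤))

/-- The bracket of the semi-direct sum. There are no signs, as `𝔤` is in degree zero. -/
instance : Bracket (Dg 𝕜 𝔤) (Dg 𝕜 𝔤) where
  bracket a b :=
    (⁅a.1, b.1⁆, ⁅a.2, b.2⁆ + LSPlus.act 𝕜 a.1 b.2 - LSPlus.act 𝕜 b.1 a.2)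

/-- The inclusion `l` of `𝔤`. -/
def l : 𝔤 →ₗ[𝕜] Dg 𝕜 𝔤 := LinearMap.inl 𝕜 𝔤 (LSPlus 𝕜 𝔤)

/-- The inclusion of `𝓛(S⁺𝔤)`. -/
def incl : LSPlus 𝕜 𝔤 →ₗ[𝕜] Dg 𝕜 𝔤 := LinearMap.inr 𝕜 𝔤 (LSPlus 𝕜 𝔤)

/-- The component of degree `n`: it is `𝓛(S⁺𝔤)ⁿ`, to which `𝔤` is added for `n = 0`. -/
def component (n : ℤ) : Submodule 𝕜 (Dg 𝕜 𝔤) :=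
  (if n = 0 then LinearMap.range (l 𝕜 𝔤) else ⊥) ⊔ (LSPlus.component 𝕜 𝔤 n).map (incl 𝕜 𝔤)

variable {𝔤} in
/-- The generator `𝓘(xᵏ)` of `D𝔤`. -/
def I (x : 𝔤) (k : ℕ+) : Dg 𝕜 𝔤 := incl 𝕜 𝔤 (LSPlus.I 𝕜 x k)

end Dg

/-- `d` is the derivation of degree one of `D𝔤` with `d l(x) = 0` and `d i(x) = [i(x), i(x)]/2 + l(x)`
where `i(x) = ∑ₖ 𝓘(xᵏ)`. The components of the last formula are
`d 𝓘(xᵏ) = ½ ∑ [𝓘(xˢ), 𝓘(xᵏ⁻ˢ)]`, the sum being over `0 < s < k`, with `l(x)` added for `k = 1`. -/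
structure IsDgDifferential (d : Dg 𝕜 𝔤 →ₗ[𝕜] Dg 𝕜 𝔤) : Prop where
  derivation : IsDegreeOneDerivation (Dg.component 𝕜 𝔤) d
  map_l : ∀ x, d (Dg.l 𝕜 𝔤 x) = 0
  map_I : ∀ (x : 𝔤) (k : ℕ+), d (Dg.I 𝕜 x k) =
    (1 / 2 : 𝕜) • (∑ s ∈ Finset.Iio k, ⁅Dg.I 𝕜 x s, Dg.I 𝕜 x (k - s)⁆) +
      (if k = 1 then Dg.l 𝕜 𝔤 x else 0)

/-- `d` is the derivation of degree one of `𝓛(S⁺𝔤)` with `d i(x) = [i(x), i(x)]/2`, where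
`i(x) = ∑ₖ 𝓘(xᵏ)`. -/
structure IsLSPlusDifferential (d : LSPlus 𝕜 𝔤 →ₗ[𝕜] LSPlus 𝕜 𝔤) : Prop where
  derivation : IsDegreeOneDerivation (LSPlus.component 𝕜 𝔤) d
  map_I : ∀ (x : 𝔤) (k : ℕ+), d (LSPlus.I 𝕜 x k) =
    (1 / 2 : 𝕜) • (∑ s ∈ Finset.Iio k, ⁅LSPlus.I 𝕜 x s, LSPlus.I 𝕜 x (k - s)⁆)

end Dg

end CartanDGLA

end

/-! A free graded Lie algebra on odd generators sits in the free associative algebra, its enveloping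
algebra, and there the prescribed differential becomes a classical one. Choose a basis of `𝔤` and
scale monomials by multinomial coefficients, so that xᵏ = ∑ t^α m_α over |α| = k, with t the
coordinates of x. Comparing coefficients of t^α, the formula for d i(x) says d 𝓘(m_α) = ½ ∑ [𝓘(m_β),
𝓘(m_γ)] over β + γ = α with β, γ nonzero. In the enveloping algebra this is d α = ∑ β·γ, the cobar
differential of the symmetric coalgebra, whose square vanishes by coassociativity (`Cobar.d_d`).

Every cobar cocycle is cohomologous to a combination of words in letters of weight one
(`Cobar.mem_of_d_eq_zero`). This is the part needed here of the Koszul computation of the cobar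
cohomology. It is proved one variable at a time, with a homotopy that merges the letter eᵢ with its
successor.

The way back is the weighted Dynkin map, which sends a word to its right-nested bracket times the
weight of its last letter. It is a chain map (`LSPlus.dynkin_d`), and on the Lie algebra it is
multiplication by the weight (`LSPlus.dynkin_toCobar`). In characteristic zero, `toCobar` is
therefore injective, so d² = 0 holds on `𝓛(S⁺𝔤)`. Moreover, a Lie cocycle is, up to coboundaries, a
combination of iterated brackets of elements 𝓘(x). Since [𝓘(x), 𝓘(y)] is a coboundary by polarizing
𝓘(z²), only the 𝓘(x) remain (`LSPlus.mem_of_diff_eq_zero`). The projection `LSPlus.proj` to `𝔤`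
kills coboundaries and recovers x from 𝓘(x), so nothing further is lost.

On `D𝔤` the differential is (x, a) ↦ (`proj` a, `twistedDiff` a), where `twistedDiff` is the
previous differential plus a `contraction` that lowers the weight by one. The top-weight part of a
cocycle is thus a cocycle for the untwisted differential. It is exact and can be removed, while `𝔤`
itself is hit by the 𝓘(x) (`LSPlus.exists_twistedDiff_eq`).

Existence of the derivations comes from `oddDerivation`, which realizes a derivation as a matrix
entry of a homomorphism to an endomorphism algebra. Uniqueness comes from polarization: the powers
xᵏ span Sᵏ (`symPow_le_span_pow`). -/

noncomputable section

namespace CartanDGLA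

set_option linter.unusedSectionVars false

universe u v w

/-! ### Koszul signs as scalars -/

/-- The sign `(-1)ⁿ` as a scalar. -/
def koszulSign (𝕜 : Type*) [Field 𝕜] (n : ℤ) : 𝕜 := ((n.negOnePow : ℤ) : 𝕜)

section KoszulSign

variable {𝕜 : Type*} [Field 𝕜] {M : Type*} [AddCommGroup M] [Module 𝕜 M]

theorem negOnePow_smul (n : ℤ) (a : M) : n.negOnePow • a = koszulSign 𝕜 n • a := by
  rw [koszulSign, Int.cast_smul_eq_zsmul, Units.smul_def]

theorem koszulSign_add (m n : ℤ) : koszulSign 𝕜 (m + n) = koszulSign 𝕜 m * koszulSign 𝕜 n := by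
  simp [koszulSign, Int.negOnePow_add]

@[simp] theorem koszulSign_zero : koszulSign 𝕜 0 = 1 := by simp [koszulSign]

@[simp] theorem koszulSign_one : koszulSign 𝕜 1 = -1 := by simp [koszulSign]

theorem koszulSign_odd {n : ℤ} (hn : Odd n) : koszulSign 𝕜 n = -1 := by
  simp [koszulSign, Int.negOnePow_odd n hn]

theorem koszulSign_even {n : ℤ} (hn : Even n) : koszulSign 𝕜 n = 1 := by
  simp [koszulSign, Int.negOnePow_even n hn]

theorem koszulSign_eq (n : ℤ) : koszulSign 𝕜 n = 1 ∨ koszulSign 𝕜 n = -1 :=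
  (Int.even_or_odd n).imp koszulSign_even koszulSign_odd

@[simp] theorem koszulSign_mul_self (n : ℤ) : koszulSign 𝕜 n * koszulSign 𝕜 n = 1 := by
  rcases koszulSign_eq (𝕜 := 𝕜) n with h | h <;> simp [h]

end KoszulSign

/-! ### Basic properties of the free graded Lie algebra -/

section FreeGradedLie

variable (𝕜 : Type u) [Field 𝕜] {ι : Type v} {V : ι → Type w}
  [∀ i, AddCommGroup (V i)] [∀ i, Module 𝕜 (V i)] (deg : ι → ℤ)

/-- The linear map on nonassociative polynomials with prescribed values on words. -/
def PreLie.wordLift {N : Type*} [AddCommGroup N] [Module 𝕜 N] (f : FreeMagma (Σ i, V i) → N) :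
    PreLie 𝕜 V →ₗ[𝕜] N :=
  Finsupp.lift N 𝕜 (FreeMagma (Σ i, V i)) f ∘ₗ (MonoidAlgebra.coeffLinearEquiv 𝕜).toLinearMap

theorem PreLie.wordLift_single {N : Type*} [AddCommGroup N] [Module 𝕜 N]
    (f : FreeMagma (Σ i, V i) → N) (m : FreeMagma (Σ i, V i)) (c : 𝕜) :
    PreLie.wordLift 𝕜 f (MonoidAlgebra.single m c) = c • f m := by
  simp [PreLie.wordLift]

variable {𝕜} in
theorem PreLie.induction_word {P : PreLie 𝕜 V → Prop} (a : PreLie 𝕜 V) (zero : P 0)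
    (add : ∀ a b, P a → P b → P (a + b)) (smul : ∀ (c : 𝕜) a, P a → P (c • a))
    (word : ∀ m, P (MonoidAlgebra.single m 1)) : P a := by
  induction a using MonoidAlgebra.induction_linear with
  | zero => exact zero
  | add a b ha hb => exact add a b ha hb
  | single m c =>
    have h : (MonoidAlgebra.single m c : PreLie 𝕜 V) = c • MonoidAlgebra.single m 1 := by simp
    rw [h]; exact smul c _ (word m)

namespace FreeGradedLie

/-- The element of the free graded Lie algebra given by a nonassociative word. -/
def word (m : FreeMagma (Σ i, V i)) : FreeGradedLie 𝕜 V deg :=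
  mk 𝕜 V deg (MonoidAlgebra.single m 1)

theorem word_of (x : Σ i, V i) : word 𝕜 deg (FreeMagma.of x) = of 𝕜 V deg x.1 x.2 := rfl

theorem word_mul (m n : FreeMagma (Σ i, V i)) :
    word 𝕜 deg (m.mul n) = ⁅word 𝕜 deg m, word 𝕜 deg n⁆ := by
  rw [word, word, word, mk_lie_mk, MonoidAlgebra.single_mul_single, mul_one]; rfl

variable {𝕜 deg}

theorem induction_word {P : FreeGradedLie 𝕜 V deg → Prop} (a : FreeGradedLie 𝕜 V deg) (zero : P 0)
    (add : ∀ a b, P a → P b → P (a + b)) (smul : ∀ (c : 𝕜) a, P a → P (c • a))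
    (word : ∀ m, P (word 𝕜 deg m)) : P a := by
  obtain ⟨a, rfl⟩ := Submodule.Quotient.mk_surjective _ a
  induction a using PreLie.induction_word with
  | zero => exact zero
  | add a b ha hb => exact add _ _ ha hb
  | smul c a ha => exact smul c _ ha
  | word m => exact word m

@[simp] theorem bracket_apply (a b : FreeGradedLie 𝕜 V deg) : bracket 𝕜 V deg a b = ⁅a, b⁆ := rfl

@[simp] theorem add_lie (a b c : FreeGradedLie 𝕜 V deg) : ⁅a + b, c⁆ = ⁅a, c⁆ + ⁅b, c⁆ :=
  (bracket 𝕜 V deg).map_add₂ a b c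

@[simp] theorem lie_add (a b c : FreeGradedLie 𝕜 V deg) : ⁅a, b + c⁆ = ⁅a, b⁆ + ⁅a, c⁆ :=
  (bracket 𝕜 V deg a).map_add b c

@[simp] theorem sub_lie (a b c : FreeGradedLie 𝕜 V deg) : ⁅a - b, c⁆ = ⁅a, c⁆ - ⁅b, c⁆ :=
  (bracket 𝕜 V deg).map_sub₂ a b c

@[simp] theorem lie_sub (a b c : FreeGradedLie 𝕜 V deg) : ⁅a, b - c⁆ = ⁅a, b⁆ - ⁅a, c⁆ :=
  (bracket 𝕜 V deg a).map_sub b c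

@[simp] theorem zero_lie (a : FreeGradedLie 𝕜 V deg) : ⁅(0 : FreeGradedLie 𝕜 V deg), a⁆ = 0 :=
  (bracket 𝕜 V deg).map_zero₂ a

@[simp] theorem lie_zero (a : FreeGradedLie 𝕜 V deg) : ⁅a, (0 : FreeGradedLie 𝕜 V deg)⁆ = 0 :=
  (bracket 𝕜 V deg a).map_zero

@[simp] theorem smul_lie (c : 𝕜) (a b : FreeGradedLie 𝕜 V deg) : ⁅c • a, b⁆ = c • ⁅a, b⁆ :=
  (bracket 𝕜 V deg).map_smul₂ c a b

@[simp] theorem lie_smul (c : 𝕜) (a b : FreeGradedLie 𝕜 V deg) : ⁅a, c • b⁆ = c • ⁅a, b⁆ :=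
  (bracket 𝕜 V deg a).map_smul c b

theorem sum_lie {α : Type*} (s : Finset α) (f : α → FreeGradedLie 𝕜 V deg)
    (b : FreeGradedLie 𝕜 V deg) : ⁅∑ i ∈ s, f i, b⁆ = ∑ i ∈ s, ⁅f i, b⁆ :=
  (bracket 𝕜 V deg).map_sum₂ s f b

theorem lie_sum {α : Type*} (s : Finset α) (f : α → FreeGradedLie 𝕜 V deg)
    (b : FreeGradedLie 𝕜 V deg) : ⁅b, ∑ i ∈ s, f i⁆ = ∑ i ∈ s, ⁅b, f i⁆ :=
  map_sum (bracket 𝕜 V deg b) f s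

theorem component_eq_span (p : ℤ) : component 𝕜 V deg p =
    Submodule.span 𝕜 {a | ∃ m, wordDegree deg m = p ∧ a = word 𝕜 deg m} := by
  rw [component, PreLie.homogeneous, Submodule.map_span]
  congr 1
  ext a
  constructor
  · rintro ⟨_, ⟨m, hm, rfl⟩, rfl⟩
    exact ⟨m, hm, rfl⟩
  · rintro ⟨m, hm, rfl⟩
    exact ⟨_, ⟨m, hm, rfl⟩, rfl⟩

theorem word_mem_component (m : FreeMagma (Σ i, V i)) :
    word 𝕜 deg m ∈ component 𝕜 V deg (wordDegree deg m) := by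
  rw [component_eq_span]
  exact Submodule.subset_span ⟨m, rfl, rfl⟩

theorem component_induction {p : ℤ} {P : ∀ a, a ∈ component 𝕜 V deg p → Prop}
    (zero : P 0 (zero_mem _))
    (add : ∀ a b ha hb, P a ha → P b hb → P (a + b) (add_mem ha hb))
    (smul : ∀ (c : 𝕜) a ha, P a ha → P (c • a) (Submodule.smul_mem _ c ha))
    (word : ∀ m (hm : wordDegree deg m = p), P (word 𝕜 deg m) (hm ▸ word_mem_component m))
    {a : FreeGradedLie 𝕜 V deg} (ha : a ∈ component 𝕜 V deg p) : P a ha := by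
  have ha' := ha
  rw [component_eq_span] at ha'
  revert ha
  induction ha' using Submodule.span_induction with
  | zero => exact fun _ => zero
  | add a b ha hb iha ihb =>
    rw [← component_eq_span] at ha hb
    exact fun _ => add a b ha hb (iha ha) (ihb hb)
  | smul c a ha ih =>
    rw [← component_eq_span] at ha
    exact fun _ => smul c a ha (ih ha)
  | mem a ha => obtain ⟨m, hm, rfl⟩ := ha; exact fun _ => word m hm

theorem of_mem_component (i : ι) (v : V i) : of 𝕜 V deg i v ∈ component 𝕜 V deg (deg i) :=
  word_mem_component (FreeMagma.of (⟨i, v⟩ : Σ i, V i))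

theorem lie_mem_component {p q : ℤ} {a b : FreeGradedLie 𝕜 V deg}
    (ha : a ∈ component 𝕜 V deg p) (hb : b ∈ component 𝕜 V deg q) :
    ⁅a, b⁆ ∈ component 𝕜 V deg (p + q) := by
  obtain ⟨a, ha, rfl⟩ := ha
  obtain ⟨b, hb, rfl⟩ := hb
  exact ⟨a * b, PreLie.mul_mem_homogeneous 𝕜 deg ha hb, rfl⟩

theorem iSup_component : ⨆ p, component 𝕜 V deg p = ⊤ := by
  refine eq_top_iff.2 fun a _ => ?_
  induction a using induction_word with
  | zero => exact zero_mem _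
  | add a b ha hb => exact add_mem (ha trivial) (hb trivial)
  | smul c a ha => exact Submodule.smul_mem _ c (ha trivial)
  | word m => exact Submodule.mem_iSup_of_mem _ (word_mem_component m)

/-- A subspace which contains the generators and is closed under the bracket is everything. -/
theorem mem_of_lie_closed (N : Submodule 𝕜 (FreeGradedLie 𝕜 V deg))
    (hof : ∀ i v, of 𝕜 V deg i v ∈ N)
    (hlie : ∀ p, ∀ a ∈ component 𝕜 V deg p, ∀ q, ∀ b ∈ component 𝕜 V deg q,
      a ∈ N → b ∈ N → ⁅a, b⁆ ∈ N) (a : FreeGradedLie 𝕜 V deg) : a ∈ N := by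
  induction a using induction_word with
  | zero => exact zero_mem _
  | add a b ha hb => exact add_mem ha hb
  | smul c a ha => exact Submodule.smul_mem _ c ha
  | word m =>
    induction m using FreeMagma.rec with
    | of x => exact hof x.1 x.2
    | mul m n hm hn =>
      rw [word_mul]
      exact hlie _ _ (word_mem_component m) _ _ (word_mem_component n) hm hn

theorem lie_antisymm {p q : ℤ} {a b : FreeGradedLie 𝕜 V deg}
    (ha : a ∈ component 𝕜 V deg p) (hb : b ∈ component 𝕜 V deg q) :
    ⁅a, b⁆ = -(koszulSign 𝕜 (p * q) • ⁅b, a⁆) := by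
  obtain ⟨a, ha, rfl⟩ := ha
  obtain ⟨b, hb, rfl⟩ := hb
  rw [← add_eq_zero_iff_eq_neg, mk_lie_mk, mk_lie_mk, ← map_smul, ← map_add, ← negOnePow_smul]
  exact (Submodule.Quotient.mk_eq_zero _).2 (Submodule.subset_span (.antisymm p q a b ha hb))

theorem lie_jacobi {p q : ℤ} {a b : FreeGradedLie 𝕜 V deg}
    (ha : a ∈ component 𝕜 V deg p) (hb : b ∈ component 𝕜 V deg q) (c : FreeGradedLie 𝕜 V deg) :
    ⁅a, ⁅b, c⁆⁆ = ⁅⁅a, b⁆, c⁆ + koszulSign 𝕜 (p * q) • ⁅b, ⁅a, c⁆⁆ := by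
  have hc : c ∈ ⨆ r, component 𝕜 V deg r := by rw [iSup_component]; trivial
  induction hc using Submodule.iSup_induction' with
  | zero => simp
  | add c c' _ _ hc hc' => simp only [lie_add, hc, hc', smul_add]; abel
  | mem r c hc =>
    obtain ⟨a, ha, rfl⟩ := ha
    obtain ⟨b, hb, rfl⟩ := hb
    obtain ⟨c, hc, rfl⟩ := hc
    simp only [mk_lie_mk]
    rw [← sub_eq_iff_eq_add', ← sub_eq_zero, ← map_sub, ← map_smul, ← map_sub, ← negOnePow_smul]
    exact (Submodule.Quotient.mk_eq_zero _).2
      (Submodule.subset_span (.jacobi p q r a b c ha hb hc))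

end FreeGradedLie

/-! ### Maps to associative algebras -/

section Lift

variable {R : Type*} [Ring R] [Algebra 𝕜 R] (f : ∀ i, V i →ₗ[𝕜] R)

/-- The value on words of the extension of `f` to a homomorphism for graded commutators. -/
def PreLie.commWord : FreeMagma (Σ i, V i) → R
  | .of x => f x.1 x.2
  | .mul a b => commWord a * commWord b -
      koszulSign 𝕜 (wordDegree deg a * wordDegree deg b) • (commWord b * commWord a)

/-- The extension of `f` to nonassociative polynomials, compatible with graded commutators. -/
def PreLie.comm : PreLie 𝕜 V →ₗ[𝕜] R := PreLie.wordLift 𝕜 (PreLie.commWord 𝕜 deg f)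

theorem PreLie.comm_letter (i : ι) (v : V i) :
    PreLie.comm 𝕜 deg f (PreLie.letter 𝕜 i v) = f i v := by
  change PreLie.comm 𝕜 deg f (MonoidAlgebra.single (FreeMagma.of ⟨i, v⟩) 1) = _
  rw [PreLie.comm, PreLie.wordLift_single, one_smul]; rfl

/-- The sign involution of nonassociative polynomials. -/
def PreLie.twist : PreLie 𝕜 V →ₗ[𝕜] PreLie 𝕜 V :=
  PreLie.wordLift 𝕜 fun m => koszulSign 𝕜 (wordDegree deg m) • MonoidAlgebra.single m 1

theorem PreLie.twist_word (m : FreeMagma (Σ i, V i)) :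
    PreLie.twist 𝕜 deg (MonoidAlgebra.single m 1) =
      koszulSign 𝕜 (wordDegree deg m) • MonoidAlgebra.single m (1 : 𝕜) := by
  rw [PreLie.twist, PreLie.wordLift_single, one_smul]

theorem PreLie.twist_twist (a : PreLie 𝕜 V) :
    PreLie.twist 𝕜 deg (PreLie.twist 𝕜 deg a) = a := by
  induction a using PreLie.induction_word with
  | zero => simp
  | add a a' ha ha' => rw [map_add, map_add, ha, ha']
  | smul c a ha => rw [map_smul, map_smul, ha]
  | word m => rw [PreLie.twist_word, map_smul, PreLie.twist_word, smul_smul, koszulSign_mul_self,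
      one_smul]

theorem PreLie.twist_mul (a b : PreLie 𝕜 V) :
    PreLie.twist 𝕜 deg (a * b) = PreLie.twist 𝕜 deg a * PreLie.twist 𝕜 deg b := by
  induction a using PreLie.induction_word with
  | zero => simp
  | add a a' ha ha' => simp only [add_mul, map_add, ha, ha']
  | smul c a ha => simp only [smul_mul_assoc, map_smul, ha]
  | word m =>
    induction b using PreLie.induction_word with
    | zero => simp
    | add a a' ha ha' => simp only [mul_add, map_add, ha, ha']
    | smul c a ha => simp only [mul_smul_comm, map_smul, ha]
    | word n =>
      simp only [MonoidAlgebra.single_mul_single, PreLie.twist_word, mul_one, smul_mul_assoc,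
        mul_smul_comm, smul_smul, ← koszulSign_add]
      rw [add_comm]; rfl

variable {𝕜 deg} in
theorem PreLie.twist_of_mem {p : ℤ} {a : PreLie 𝕜 V} (ha : a ∈ PreLie.homogeneous 𝕜 V deg p) :
    PreLie.twist 𝕜 deg a = koszulSign 𝕜 p • a := by
  induction ha using Submodule.span_induction with
  | zero => simp
  | add a b _ _ ha hb => simp only [map_add, ha, hb, smul_add]
  | smul c a _ ha => simp only [map_smul, ha]; exact smul_comm _ _ _
  | mem a ha => obtain ⟨m, rfl, rfl⟩ := ha; exact PreLie.twist_word 𝕜 deg m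

/-- `a` twisted by the sign `(-1)^(p |a|)`. -/
def PreLie.twistPow (p : ℤ) : PreLie 𝕜 V →ₗ[𝕜] PreLie 𝕜 V :=
  if Even p then LinearMap.id else PreLie.twist 𝕜 deg

variable {𝕜 deg} in
theorem PreLie.twistPow_of_mem (q : ℤ) {p : ℤ} {a : PreLie 𝕜 V}
    (ha : a ∈ PreLie.homogeneous 𝕜 V deg p) :
    PreLie.twistPow 𝕜 deg q a = koszulSign 𝕜 (q * p) • a := by
  rw [PreLie.twistPow]
  split_ifs with h
  · rw [koszulSign_even (h.mul_right p)]; simp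
  · rw [PreLie.twist_of_mem ha]
    rw [Int.not_even_iff_odd] at h
    congr 1
    rcases Int.even_or_odd p with h' | h'
    · rw [koszulSign_even h', koszulSign_even (h'.mul_left q)]
    · rw [koszulSign_odd h', koszulSign_odd (h.mul h')]

/-- The Koszul sign of a pair depends only on parities, so for one fixed word it is absorbed into a
twist of the other factor. That factor need not be homogeneous, which matters because the relations
are closed under arbitrary products. -/
theorem PreLie.comm_word_mul (m : FreeMagma (Σ i, V i)) (b : PreLie 𝕜 V) :
    PreLie.comm 𝕜 deg f (MonoidAlgebra.single m 1 * b) =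
      PreLie.comm 𝕜 deg f (MonoidAlgebra.single m 1) * PreLie.comm 𝕜 deg f b -
      PreLie.comm 𝕜 deg f (PreLie.twistPow 𝕜 deg (wordDegree deg m) b) *
        PreLie.comm 𝕜 deg f (MonoidAlgebra.single m 1) := by
  induction b using PreLie.induction_word with
  | zero => simp
  | add a a' ha ha' => simp only [mul_add, map_add, ha, ha', add_mul]; abel
  | smul c a ha => simp only [mul_smul_comm, smul_mul_assoc, map_smul, ha, smul_sub]
  | word n =>
    rw [PreLie.twistPow_of_mem _ (Submodule.subset_span ⟨n, rfl, rfl⟩), map_smul,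
      MonoidAlgebra.single_mul_single, PreLie.comm, PreLie.wordLift_single, PreLie.wordLift_single,
      PreLie.wordLift_single]
    simp only [mul_one, one_smul, smul_mul_assoc]
    rfl

theorem PreLie.comm_mul_word (m : FreeMagma (Σ i, V i)) (b : PreLie 𝕜 V) :
    PreLie.comm 𝕜 deg f (b * MonoidAlgebra.single m 1) =
      PreLie.comm 𝕜 deg f b * PreLie.comm 𝕜 deg f (MonoidAlgebra.single m 1) -
      PreLie.comm 𝕜 deg f (MonoidAlgebra.single m 1) *
        PreLie.comm 𝕜 deg f (PreLie.twistPow 𝕜 deg (wordDegree deg m) b) := by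
  induction b using PreLie.induction_word with
  | zero => simp
  | add a a' ha ha' => simp only [mul_add, map_add, ha, ha', add_mul]; abel
  | smul c a ha => simp only [mul_smul_comm, smul_mul_assoc, map_smul, ha, smul_sub]
  | word n =>
    rw [PreLie.twistPow_of_mem _ (Submodule.subset_span ⟨n, rfl, rfl⟩), map_smul,
      MonoidAlgebra.single_mul_single, PreLie.comm, PreLie.wordLift_single, PreLie.wordLift_single,
      PreLie.wordLift_single, mul_comm (wordDegree deg m)]
    simp only [mul_one, one_smul, mul_smul_comm]
    rfl

variable {𝕜 deg} in
theorem PreLie.comm_mul_of_mem {p q : ℤ} {a b : PreLie 𝕜 V}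
    (ha : a ∈ PreLie.homogeneous 𝕜 V deg p) (hb : b ∈ PreLie.homogeneous 𝕜 V deg q) :
    PreLie.comm 𝕜 deg f (a * b) = PreLie.comm 𝕜 deg f a * PreLie.comm 𝕜 deg f b -
      koszulSign 𝕜 (p * q) • (PreLie.comm 𝕜 deg f b * PreLie.comm 𝕜 deg f a) := by
  induction ha using Submodule.span_induction with
  | zero => simp
  | add a b _ _ ha hb => simp only [map_add, ha, hb, smul_add, add_mul, mul_add]; abel
  | smul c a _ ha =>
    simp only [map_smul, ha, smul_mul_assoc, mul_smul_comm, smul_sub]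
    rw [smul_comm c]
  | mem a ha =>
    obtain ⟨m, rfl, rfl⟩ := ha
    rw [PreLie.comm_word_mul, PreLie.twistPow_of_mem _ hb, map_smul, smul_mul_assoc]

/-- The twisted statement is carried along to make the induction close: commuting a word past a
possibly inhomogeneous relation replaces that relation by its twist. -/
theorem PreLie.comm_relation {r : PreLie 𝕜 V} (hr : PreLie.IsRelation 𝕜 V deg r) :
    PreLie.comm 𝕜 deg f r = 0 ∧ PreLie.comm 𝕜 deg f (PreLie.twist 𝕜 deg r) = 0 := by
  have key : ∀ {p : ℤ} {r : PreLie 𝕜 V}, r ∈ PreLie.homogeneous 𝕜 V deg p →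
      PreLie.comm 𝕜 deg f r = 0 →
      PreLie.comm 𝕜 deg f r = 0 ∧ PreLie.comm 𝕜 deg f (PreLie.twist 𝕜 deg r) = 0 :=
    fun hr h => ⟨h, by rw [PreLie.twist_of_mem hr, map_smul, h, smul_zero]⟩
  have letter_mem : ∀ i v, PreLie.letter 𝕜 i v ∈ PreLie.homogeneous 𝕜 V deg (deg i) :=
    fun i v => Submodule.subset_span ⟨FreeMagma.of (⟨i, v⟩ : Σ i, V i), rfl, rfl⟩
  induction hr with
  | add i v v' =>
    refine key (sub_mem (sub_mem (letter_mem i _) (letter_mem i _)) (letter_mem i _)) ?_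
    simp only [map_sub, PreLie.comm_letter, map_add]; abel
  | smul i c v =>
    refine key (sub_mem (letter_mem i _) (Submodule.smul_mem _ c (letter_mem i _))) ?_
    simp only [map_sub, PreLie.comm_letter, map_smul]; abel
  | antisymm p q a b ha hb =>
    rw [negOnePow_smul (𝕜 := 𝕜)]
    refine key (add_mem (PreLie.mul_mem_homogeneous 𝕜 deg ha hb)
      (Submodule.smul_mem _ _ (add_comm q p ▸ PreLie.mul_mem_homogeneous 𝕜 deg hb ha))) ?_
    rw [map_add, map_smul, PreLie.comm_mul_of_mem f ha hb, PreLie.comm_mul_of_mem f hb ha,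
      mul_comm q p]
    rcases koszulSign_eq (𝕜 := 𝕜) (p * q) with h | h <;> rw [h] <;> simp
  | jacobi p q r a b c ha hb hc =>
    rw [negOnePow_smul (𝕜 := 𝕜)]
    have hab := PreLie.mul_mem_homogeneous 𝕜 deg ha hb
    have hbc := PreLie.mul_mem_homogeneous 𝕜 deg hb hc
    have hac := PreLie.mul_mem_homogeneous 𝕜 deg ha hc
    have h1 := PreLie.mul_mem_homogeneous 𝕜 deg ha hbc
    have h2 := PreLie.mul_mem_homogeneous 𝕜 deg hab hc
    have h3 := PreLie.mul_mem_homogeneous 𝕜 deg hb hac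
    rw [show p + q + r = p + (q + r) by ring] at h2
    rw [show q + (p + r) = p + (q + r) by ring] at h3
    refine key (sub_mem (sub_mem h1 h2) (Submodule.smul_mem _ _ h3)) ?_
    simp only [map_sub, map_smul, PreLie.comm_mul_of_mem f ha hbc, PreLie.comm_mul_of_mem f hab hc,
      PreLie.comm_mul_of_mem f hb hac, PreLie.comm_mul_of_mem f hb hc,
      PreLie.comm_mul_of_mem f ha hc, PreLie.comm_mul_of_mem f ha hb, mul_add, add_mul,
      koszulSign_add, mul_comm q p]
    -- For each choice of the three signs, the graded Jacobi identity for commutators is an identity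
    -- in the associative ring.
    rcases koszulSign_eq (𝕜 := 𝕜) (p * q) with h | h <;>
    rcases koszulSign_eq (𝕜 := 𝕜) (p * r) with h' | h' <;>
    rcases koszulSign_eq (𝕜 := 𝕜) (q * r) with h'' | h'' <;>
    simp only [h, h', h'', one_smul, neg_smul, mul_one, mul_neg, neg_neg] <;>
    noncomm_ring
  | mul_left a b _ ih =>
    constructor
    · induction a using PreLie.induction_word with
      | zero => simp
      | add a a' ha ha' => rw [add_mul, map_add, ha, ha', add_zero]
      | smul c a ha => rw [smul_mul_assoc, map_smul, ha, smul_zero]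
      | word m =>
        rw [PreLie.comm_word_mul, ih.1, PreLie.twistPow]
        split_ifs <;> simp [ih.1, ih.2]
    · rw [PreLie.twist_mul]
      generalize PreLie.twist 𝕜 deg a = a
      induction a using PreLie.induction_word with
      | zero => simp
      | add a a' ha ha' => rw [add_mul, map_add, ha, ha', add_zero]
      | smul c a ha => rw [smul_mul_assoc, map_smul, ha, smul_zero]
      | word m =>
        rw [PreLie.comm_word_mul, ih.2, PreLie.twistPow]
        split_ifs
        · simp [ih.2]
        · rw [PreLie.twist_twist, ih.1]; simp
  | mul_right b a _ ih =>
    constructor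
    · induction a using PreLie.induction_word with
      | zero => simp
      | add a a' ha ha' => rw [mul_add, map_add, ha, ha', add_zero]
      | smul c a ha => rw [mul_smul_comm, map_smul, ha, smul_zero]
      | word m =>
        rw [PreLie.comm_mul_word, ih.1, PreLie.twistPow]
        split_ifs <;> simp [ih.1, ih.2]
    · rw [PreLie.twist_mul]
      generalize PreLie.twist 𝕜 deg a = a
      induction a using PreLie.induction_word with
      | zero => simp
      | add a a' ha ha' => rw [mul_add, map_add, ha, ha', add_zero]
      | smul c a ha => rw [mul_smul_comm, map_smul, ha, smul_zero]
      | word m =>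
        rw [PreLie.comm_mul_word, ih.2, PreLie.twistPow]
        split_ifs
        · simp [ih.2]
        · rw [PreLie.twist_twist, ih.1]; simp

/-- The extension of linear maps `f i : V i → R` to an associative algebra `R` to a linear map on
the free graded Lie algebra which sends brackets to graded commutators. -/
def FreeGradedLie.lift : FreeGradedLie 𝕜 V deg →ₗ[𝕜] R :=
  (PreLie.ideal 𝕜 V deg).liftQ (PreLie.comm 𝕜 deg f)
    (Submodule.span_le.2 fun _ hr => (PreLie.comm_relation 𝕜 deg f hr).1)

theorem FreeGradedLie.lift_of (i : ι) (v : V i) :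
    FreeGradedLie.lift 𝕜 deg f (FreeGradedLie.of 𝕜 V deg i v) = f i v :=
  PreLie.comm_letter 𝕜 deg f i v

variable {𝕜 deg} in
theorem FreeGradedLie.lift_lie {p q : ℤ} {a b : FreeGradedLie 𝕜 V deg}
    (ha : a ∈ component 𝕜 V deg p) (hb : b ∈ component 𝕜 V deg q) :
    lift 𝕜 deg f ⁅a, b⁆ = lift 𝕜 deg f a * lift 𝕜 deg f b -
      koszulSign 𝕜 (p * q) • (lift 𝕜 deg f b * lift 𝕜 deg f a) := by
  obtain ⟨a, ha, rfl⟩ := ha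
  obtain ⟨b, hb, rfl⟩ := hb
  exact PreLie.comm_mul_of_mem f ha hb

end Lift

end FreeGradedLie

/-! ### Odd derivations of the free graded Lie algebra -/

section OddDerivation

variable {𝕜 : Type u} [Field 𝕜] {ι : Type v} {V : ι → Type w}
  [∀ i, AddCommGroup (V i)] [∀ i, Module 𝕜 (V i)] {deg : ι → ℤ}
  {N : Type*} [AddCommGroup N] [Module 𝕜 N]

namespace FreeGradedLie

/-- `ρ` is a representation of the free graded Lie algebra on the space `N`. -/
def IsRepresentation (ρ : FreeGradedLie 𝕜 V deg →ₗ[𝕜] N →ₗ[𝕜] N) : Prop :=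
  ∀ p, ∀ a ∈ component 𝕜 V deg p, ∀ q, ∀ b ∈ component 𝕜 V deg q, ∀ x,
    ρ ⁅a, b⁆ x = ρ a (ρ b x) - koszulSign 𝕜 (p * q) • ρ b (ρ a x)

variable (deg) in
/-- The operator on `N × 𝕜` given by a generator, built from its action on `N` and its image in `N`
under the derivation. -/
def oddDerivationGen (ρ : FreeGradedLie 𝕜 V deg →ₗ[𝕜] N →ₗ[𝕜] N) (δ : ∀ i, V i →ₗ[𝕜] N) (i : ι) :
    V i →ₗ[𝕜] Module.End 𝕜 (N × 𝕜) where
  toFun v := LinearMap.inl 𝕜 N 𝕜 ∘ₗ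
    (koszulSign 𝕜 (deg i) • (ρ (of 𝕜 V deg i v) ∘ₗ LinearMap.fst 𝕜 N 𝕜) +
      (LinearMap.snd 𝕜 N 𝕜).smulRight (δ i v))
  map_add' v v' := by
    ext x <;> simp
  map_smul' c v := by
    ext x <;> simp [smul_comm c]

/-- The derivation of odd degree from the free graded Lie algebra to a representation which is given
by `δ` on generators. -/
def oddDerivation (ρ : FreeGradedLie 𝕜 V deg →ₗ[𝕜] N →ₗ[𝕜] N) (δ : ∀ i, V i →ₗ[𝕜] N) :
    FreeGradedLie 𝕜 V deg →ₗ[𝕜] N :=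
  LinearMap.fst 𝕜 N 𝕜 ∘ₗ LinearMap.applyₗ ((0 : N), (1 : 𝕜)) ∘ₗ
    lift 𝕜 deg (oddDerivationGen deg ρ δ)

variable {ρ : FreeGradedLie 𝕜 V deg →ₗ[𝕜] N →ₗ[𝕜] N} (δ : ∀ i, V i →ₗ[𝕜] N)

theorem oddDerivation_of (i : ι) (v : V i) : oddDerivation ρ δ (of 𝕜 V deg i v) = δ i v := by
  simp [oddDerivation, lift_of, oddDerivationGen]

/-- The operators are block triangular on N × 𝕜. The diagonal block is `ρ` twisted by the sign of
the degree, and the off-diagonal entry is the derivation. The twist makes the derivation odd. -/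
theorem lift_oddDerivationGen (hρ : IsRepresentation ρ) {p : ℤ} {a : FreeGradedLie 𝕜 V deg}
    (ha : a ∈ component 𝕜 V deg p) (x : N × 𝕜) :
    lift 𝕜 deg (oddDerivationGen deg ρ δ) a x =
      (koszulSign 𝕜 p • ρ a x.1 + x.2 • oddDerivation ρ δ a, 0) := by
  induction ha using component_induction with
  | zero => ext <;> simp
  | add a b _ _ ha hb =>
    simp only [map_add, LinearMap.add_apply, ha, hb, smul_add, Prod.mk_add_mk, add_zero]
    congr 1; abel
  | smul c a _ ha =>
    simp only [map_smul, LinearMap.smul_apply, ha, Prod.smul_mk, smul_add, smul_zero, smul_comm c]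
  | word m hm =>
    subst hm
    induction m using FreeMagma.rec generalizing x with
    | of y => simp [word_of, lift_of, oddDerivation_of, oddDerivationGen, wordDegree]
    | mul m n hm hn =>
      have hmc := word_mem_component (𝕜 := 𝕜) (deg := deg) m
      have hnc := word_mem_component (𝕜 := 𝕜) (deg := deg) n
      rw [oddDerivation]
      simp only [LinearMap.coe_comp, Function.comp_apply, LinearMap.applyₗ_apply_apply,
        LinearMap.fst_apply]
      simp only [word_mul, lift_lie _ hmc hnc, LinearMap.sub_apply, LinearMap.smul_apply,
        Module.End.mul_apply, hm, hn, hρ _ _ hmc _ _ hnc, wordDegree, koszulSign_add]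
      ext
      · simp only [map_add, map_smul, Prod.fst_sub, Prod.smul_fst, map_zero]
        module
      · simp

/-- This is the off-diagonal entry of a graded commutator of block triangular operators. The extra 1
in p + 1 is the sign twist of the diagonal block of b. -/
theorem oddDerivation_lie (hρ : IsRepresentation ρ) {p q : ℤ} {a b : FreeGradedLie 𝕜 V deg}
    (ha : a ∈ component 𝕜 V deg p) (hb : b ∈ component 𝕜 V deg q) :
    oddDerivation ρ δ ⁅a, b⁆ = koszulSign 𝕜 p • ρ a (oddDerivation ρ δ b) -
      koszulSign 𝕜 ((p + 1) * q) • ρ b (oddDerivation ρ δ a) := by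
  conv_lhs => rw [oddDerivation]
  simp only [LinearMap.coe_comp, Function.comp_apply, LinearMap.applyₗ_apply_apply,
    LinearMap.fst_apply, lift_lie _ ha hb, LinearMap.sub_apply, LinearMap.smul_apply,
    Module.End.mul_apply, lift_oddDerivationGen δ hρ ha, lift_oddDerivationGen δ hρ hb]
  simp only [map_add, map_smul, Prod.fst_sub, Prod.smul_fst, map_zero, add_mul, one_mul,
    koszulSign_add]
  module

theorem oddDerivation_mem (hρ : IsRepresentation ρ) (A : ℤ → Submodule 𝕜 N)
    (hA : ∀ p, ∀ a ∈ component 𝕜 V deg p, ∀ q, ∀ x ∈ A q, ρ a x ∈ A (p + q))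
    (hδ : ∀ i v, δ i v ∈ A (deg i + 1)) {p : ℤ} {a : FreeGradedLie 𝕜 V deg}
    (ha : a ∈ component 𝕜 V deg p) : oddDerivation ρ δ a ∈ A (p + 1) := by
  induction ha using component_induction with
  | zero => simp
  | add a b _ _ ha hb => rw [map_add]; exact add_mem ha hb
  | smul c a _ ha => rw [map_smul]; exact Submodule.smul_mem _ c ha
  | word m hm =>
    subst hm
    induction m using FreeMagma.rec with
    | of y => rw [word_of, oddDerivation_of]; exact hδ _ _
    | mul m n hm hn =>
      have hmc := word_mem_component (𝕜 := 𝕜) (deg := deg) m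
      have hnc := word_mem_component (𝕜 := 𝕜) (deg := deg) n
      rw [word_mul, oddDerivation_lie δ hρ hmc hnc, wordDegree]
      have h1 := hA _ _ hmc _ _ hn
      have h2 := hA _ _ hnc _ _ hm
      rw [← add_assoc] at h1
      rw [show wordDegree deg n + (wordDegree deg m + 1) =
        wordDegree deg m + wordDegree deg n + 1 by ring] at h2
      exact sub_mem (Submodule.smul_mem _ _ h1) (Submodule.smul_mem _ _ h2)

theorem isRepresentation_bracket : IsRepresentation (bracket 𝕜 V deg) := by
  intro p a ha q b hb x
  simp only [bracket_apply]
  rw [lie_jacobi ha hb, add_sub_cancel_right]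

/-- An odd derivation of the free graded Lie algebra to itself satisfies the Leibniz rule. -/
theorem oddDerivation_bracket_isDegreeOneDerivation (δ : ∀ i, V i →ₗ[𝕜] FreeGradedLie 𝕜 V deg)
    (hδ : ∀ i v, δ i v ∈ component 𝕜 V deg (deg i + 1)) :
    IsDegreeOneDerivation (component 𝕜 V deg) (oddDerivation (bracket 𝕜 V deg) δ) := by
  have hmem : ∀ n, ∀ a ∈ component 𝕜 V deg n,
      oddDerivation (bracket 𝕜 V deg) δ a ∈ component 𝕜 V deg (n + 1) := fun n a ha =>
    oddDerivation_mem δ isRepresentation_bracket _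
      (fun p a ha q x hx => lie_mem_component ha hx) hδ ha
  refine ⟨hmem, fun n a ha b => ?_⟩
  have hb : b ∈ ⨆ r, component 𝕜 V deg r := by rw [iSup_component]; trivial
  rw [negOnePow_smul (𝕜 := 𝕜)]
  induction hb using Submodule.iSup_induction' with
  | zero => simp
  | add b b' _ _ hb hb' => simp only [lie_add, map_add, hb, hb', smul_add]; abel
  | mem q b hb =>
    rw [oddDerivation_lie δ isRepresentation_bracket ha hb, lie_antisymm (hmem n a ha) hb]
    simp only [bracket_apply]
    abel

/-- The even derivation extending `f` preserves degrees. -/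
theorem derivation_mem_component (f : ∀ i, V i →ₗ[𝕜] V i) {p : ℤ} {a : FreeGradedLie 𝕜 V deg}
    (ha : a ∈ component 𝕜 V deg p) : derivation 𝕜 deg f a ∈ component 𝕜 V deg p := by
  obtain ⟨a, ha, rfl⟩ := ha
  exact ⟨_, PreLie.derivation_mem_homogeneous 𝕜 deg f ha, rfl⟩

variable (𝕜 V deg) in
/-- The derivation which multiplies each generator of `V i` by the scalar `wt i`. -/
def euler (wt : ι → 𝕜) : FreeGradedLie 𝕜 V deg →ₗ[𝕜] FreeGradedLie 𝕜 V deg :=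
  derivation 𝕜 deg fun i => wt i • LinearMap.id

@[simp] theorem euler_of (wt : ι → 𝕜) (i : ι) (v : V i) :
    euler 𝕜 V deg wt (of 𝕜 V deg i v) = wt i • of 𝕜 V deg i v := by
  rw [euler, derivation_of, LinearMap.smul_apply, LinearMap.id_apply, map_smul]

theorem euler_lie (wt : ι → 𝕜) (a b : FreeGradedLie 𝕜 V deg) :
    euler 𝕜 V deg wt ⁅a, b⁆ = ⁅euler 𝕜 V deg wt a, b⁆ + ⁅a, euler 𝕜 V deg wt b⁆ :=
  derivation_lie 𝕜 deg _ a b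

theorem lie_mem_eigenspace_euler (wt : ι → 𝕜) {c e : 𝕜} {a b : FreeGradedLie 𝕜 V deg}
    (ha : a ∈ Module.End.eigenspace (euler 𝕜 V deg wt) c)
    (hb : b ∈ Module.End.eigenspace (euler 𝕜 V deg wt) e) :
    ⁅a, b⁆ ∈ Module.End.eigenspace (euler 𝕜 V deg wt) (c + e) := by
  rw [Module.End.mem_eigenspace_iff] at *
  rw [euler_lie, ha, hb, smul_lie, lie_smul, add_smul]

/-- Degrees add under brackets, as do eigenvalues of a derivation. In characteristic zero this
yields independence of the components without constructing a grading on the quotient. -/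
theorem component_le_eigenspace (p : ℤ) : component 𝕜 V deg p ≤
    Module.End.eigenspace (euler 𝕜 V deg fun i => (deg i : 𝕜)) (p : 𝕜) := by
  intro a ha
  induction ha using component_induction with
  | zero => simp
  | add a b _ _ ha hb => exact add_mem ha hb
  | smul c a _ ha => exact Submodule.smul_mem _ c ha
  | word m hm =>
    subst hm
    induction m using FreeMagma.rec with
    | of x => rw [Module.End.mem_eigenspace_iff, word_of, euler_of]; rfl
    | mul m n hm hn =>
      rw [word_mul, wordDegree, Int.cast_add]
      exact lie_mem_eigenspace_euler _ hm hn

theorem iSupIndep_component [CharZero 𝕜] : iSupIndep (component 𝕜 V deg) :=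
  ((Module.End.eigenspaces_iSupIndep _).comp Int.cast_injective).mono component_le_eigenspace

end FreeGradedLie

end OddDerivation

/-! ### Linear maps between graded spaces -/

section Graded

variable {𝕜 : Type*} [Field 𝕜] {M M' : Type*} [AddCommGroup M] [Module 𝕜 M] [AddCommGroup M']
  [Module 𝕜 M'] {κ : Type*}

/-- If `f` maps the summands `A i` to independent subspaces `B i`, then the summands of an element of
the kernel are in the kernel. -/
theorem mem_iSup_inf_ker {A : κ → Submodule 𝕜 M} {B : κ → Submodule 𝕜 M'} (hB : iSupIndep B)
    (f : M →ₗ[𝕜] M') (hf : ∀ i, ∀ a ∈ A i, f a ∈ B i) {a : M} (ha : a ∈ ⨆ i, A i) (h0 : f a = 0) :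
    a ∈ ⨆ i, A i ⊓ LinearMap.ker f := by
  classical
  obtain ⟨g, rfl⟩ := (Submodule.mem_iSup_iff_exists_dfinsupp' _ _).1 ha
  rw [DFinsupp.sum, map_sum] at h0
  refine Submodule.sum_mem _ fun i hi => Submodule.mem_iSup_of_mem i ⟨(g i).2, ?_⟩
  exact (iSupIndep_iff_finsetSum_eq_zero_imp_eq_zero B).1 hB _ _
    (fun i _ => hf i _ (g i).2) h0 i hi

/-- A component of an element of the image of a graded map is the image of a component. -/
theorem exists_mem_component_eq {A : κ → Submodule 𝕜 M} {B : κ → Submodule 𝕜 M'} (hB : iSupIndep B)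
    (f : M →ₗ[𝕜] M') (hf : ∀ i, ∀ a ∈ A i, f a ∈ B i) (hA : ⨆ i, A i = ⊤) (n : κ) (b : M) (y : M')
    (hy : y ∈ ⨆ (i) (_ : i ≠ n), B i) (h : f b + y ∈ B n) :
    ∃ a ∈ A n, f a = f b + y := by
  classical
  obtain ⟨a, ha, c, hc, rfl⟩ : ∃ a ∈ A n, ∃ c ∈ ⨆ (i) (_ : i ≠ n), A i, a + c = b := by
    rw [← Submodule.mem_sup]
    have : b ∈ ⨆ i, A i := by rw [hA]; trivial
    refine (iSup_le fun i => ?_ : ⨆ i, A i ≤ A n ⊔ ⨆ (i) (_ : i ≠ n), A i) this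
    by_cases hi : i = n
    · exact hi ▸ le_sup_left
    · exact le_sup_of_le_right (le_iSup₂_of_le i hi le_rfl)
  refine ⟨a, ha, ?_⟩
  have h1 : f c + y ∈ ⨆ (i) (_ : i ≠ n), B i := by
    refine add_mem ?_ hy
    have h2 : (⨆ (i) (_ : i ≠ n), A i) ≤ (⨆ (i) (_ : i ≠ n), B i).comap f :=
      iSup₂_le fun i hi x hx => Submodule.mem_iSup_of_mem i (Submodule.mem_iSup_of_mem hi (hf i x hx))
    exact h2 hc
  have h2 : f c + y ∈ B n := by
    have := sub_mem h (hf n a ha)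
    rwa [map_add, add_assoc, add_sub_cancel_left] at this
  have h3 := Submodule.disjoint_def.1 (hB n) _ h2 h1
  rw [map_add, add_assoc, h3, add_zero]

end Graded

/-! ### The cobar complex of the symmetric coalgebra -/

namespace Cobar

variable (𝕜 : Type*) [Field 𝕜] {σ : Type*} [Fintype σ] [DecidableEq σ]

/-- The word with given letters in the free associative algebra. -/
def word (l : List (σ → ℕ)) : FreeAlgebra 𝕜 (σ → ℕ) := (l.map (FreeAlgebra.ι 𝕜)).prod

@[simp] theorem word_nil : word 𝕜 ([] : List (σ → ℕ)) = 1 := rfl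

@[simp] theorem word_cons (α : σ → ℕ) (l : List (σ → ℕ)) :
    word 𝕜 (α :: l) = FreeAlgebra.ι 𝕜 α * word 𝕜 l := by simp [word]

theorem basisFreeMonoid_eq_word (l : FreeMonoid (σ → ℕ)) :
    FreeAlgebra.basisFreeMonoid 𝕜 (σ → ℕ) l = word 𝕜 l.toList := by
  induction l using FreeMonoid.inductionOn' with
  | one => simp [FreeAlgebra.basisFreeMonoid, ← MonoidAlgebra.one_def]
  | of_mul x l ih =>
    rw [FreeMonoid.toList_of_mul, word_cons, ← ih]
    simp [FreeAlgebra.basisFreeMonoid, FreeAlgebra.equivMonoidAlgebraFreeMonoid]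

/-- The linear map on the free algebra with prescribed values on words. -/
def wordLift {N : Type*} [AddCommGroup N] [Module 𝕜 N] (f : List (σ → ℕ) → N) :
    FreeAlgebra 𝕜 (σ → ℕ) →ₗ[𝕜] N :=
  (FreeAlgebra.basisFreeMonoid 𝕜 (σ → ℕ)).constr 𝕜 fun l => f l.toList

theorem wordLift_word {N : Type*} [AddCommGroup N] [Module 𝕜 N] (f : List (σ → ℕ) → N)
    (l : List (σ → ℕ)) : wordLift 𝕜 f (word 𝕜 l) = f l := by
  have := (FreeAlgebra.basisFreeMonoid 𝕜 (σ → ℕ)).constr_basis 𝕜 (fun l => f l.toList)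
    (FreeMonoid.ofList l)
  rwa [basisFreeMonoid_eq_word] at this

theorem span_word : Submodule.span 𝕜 (Set.range (word 𝕜 : List (σ → ℕ) → _)) = ⊤ := by
  rw [← (FreeAlgebra.basisFreeMonoid 𝕜 (σ → ℕ)).span_eq]
  congr 1
  ext a
  constructor
  · rintro ⟨l, rfl⟩; exact ⟨FreeMonoid.ofList l, basisFreeMonoid_eq_word 𝕜 _⟩
  · rintro ⟨l, rfl⟩; exact ⟨l.toList, (basisFreeMonoid_eq_word 𝕜 _).symm⟩

variable {𝕜} in
theorem induction_word {P : FreeAlgebra 𝕜 (σ → ℕ) → Prop} (a : FreeAlgebra 𝕜 (σ → ℕ)) (zero : P 0)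
    (add : ∀ a b, P a → P b → P (a + b)) (smul : ∀ (c : 𝕜) a, P a → P (c • a))
    (word : ∀ l, P (word 𝕜 l)) : P a := by
  have ha : a ∈ Submodule.span 𝕜 (Set.range (Cobar.word 𝕜 : List (σ → ℕ) → _)) := by
    rw [span_word]; trivial
  induction ha using Submodule.span_induction with
  | mem a ha => obtain ⟨l, rfl⟩ := ha; exact word l
  | zero => exact zero
  | add a b _ _ ha hb => exact add a b ha hb
  | smul c a _ ha => exact smul c a ha

variable {𝕜} in
/-- Two linear maps agree if they agree on `1` and on products with a first letter. -/
theorem hom_ext_word {N : Type*} [AddCommGroup N] [Module 𝕜 N]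
    {f g : FreeAlgebra 𝕜 (σ → ℕ) →ₗ[𝕜] N} (h1 : f 1 = g 1)
    (hmul : ∀ α a, f a = g a → f (FreeAlgebra.ι 𝕜 α * a) = g (FreeAlgebra.ι 𝕜 α * a)) : f = g := by
  ext a
  induction a using induction_word with
  | zero => simp
  | add a b ha hb => rw [map_add, map_add, ha, hb]
  | smul c a ha => rw [map_smul, map_smul, ha]
  | word l =>
    induction l with
    | nil => exact h1
    | cons α l ih => rw [word_cons]; exact hmul α _ ih

/-- The reduced coproduct of a letter. -/
def split (α : σ → ℕ) : FreeAlgebra 𝕜 (σ → ℕ) :=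
  ∑ β ∈ Finset.Ioo 0 α, FreeAlgebra.ι 𝕜 β * FreeAlgebra.ι 𝕜 (α - β)

/-- The cobar differential on words. -/
def dWord : List (σ → ℕ) → FreeAlgebra 𝕜 (σ → ℕ)
  | [] => 0
  | α :: l => split 𝕜 α * word 𝕜 l - FreeAlgebra.ι 𝕜 α * dWord l

/-- The cobar differential. -/
def d : FreeAlgebra 𝕜 (σ → ℕ) →ₗ[𝕜] FreeAlgebra 𝕜 (σ → ℕ) := wordLift 𝕜 (dWord 𝕜)

@[simp] theorem d_one : d 𝕜 (1 : FreeAlgebra 𝕜 (σ → ℕ)) = 0 := wordLift_word 𝕜 (dWord 𝕜) []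

theorem d_ι_mul (α : σ → ℕ) (a : FreeAlgebra 𝕜 (σ → ℕ)) :
    d 𝕜 (FreeAlgebra.ι 𝕜 α * a) = split 𝕜 α * a - FreeAlgebra.ι 𝕜 α * d 𝕜 a := by
  induction a using induction_word with
  | zero => simp
  | add a b ha hb => simp only [mul_add, map_add, ha, hb]; abel
  | smul c a ha => simp only [mul_smul_comm, map_smul, ha, smul_sub]
  | word l => rw [← word_cons, d, wordLift_word, wordLift_word]; rfl

@[simp] theorem d_ι (α : σ → ℕ) : d 𝕜 (FreeAlgebra.ι 𝕜 α) = split 𝕜 α := by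
  simpa using d_ι_mul 𝕜 α 1

/-- The sign involution of the free algebra on odd letters. -/
def sgn : FreeAlgebra 𝕜 (σ → ℕ) →ₐ[𝕜] FreeAlgebra 𝕜 (σ → ℕ) :=
  FreeAlgebra.lift 𝕜 fun α => -FreeAlgebra.ι 𝕜 α

@[simp] theorem sgn_ι (α : σ → ℕ) : sgn 𝕜 (FreeAlgebra.ι 𝕜 α) = -FreeAlgebra.ι 𝕜 α := by
  simp [sgn]

theorem d_mul (a b : FreeAlgebra 𝕜 (σ → ℕ)) :
    d 𝕜 (a * b) = d 𝕜 a * b + sgn 𝕜 a * d 𝕜 b := by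
  refine LinearMap.congr_fun (hom_ext_word (f := d 𝕜 ∘ₗ LinearMap.mulRight 𝕜 b)
    (g := LinearMap.mulRight 𝕜 b ∘ₗ d 𝕜 + LinearMap.mulRight 𝕜 (d 𝕜 b) ∘ₗ (sgn 𝕜).toLinearMap)
    ?_ fun α a ha => ?_) a
  · simp
  · simp only [LinearMap.coe_comp, Function.comp_apply, LinearMap.mulRight_apply,
      LinearMap.add_apply, AlgHom.toLinearMap_apply] at ha ⊢
    rw [mul_assoc, d_ι_mul, ha, d_ι_mul, map_mul, sgn_ι]
    noncomm_ring

theorem sgn_split (α : σ → ℕ) : sgn 𝕜 (split 𝕜 α) = split 𝕜 α := by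
  simp [split]

/-- Coassociativity: both double sums run over the decompositions of α into three nonzero
multi-indices and cancel because letters are odd. -/
theorem d_split (α : σ → ℕ) : d 𝕜 (split 𝕜 α) = 0 := by
  simp only [split, map_sum, d_ι_mul, d_ι, Finset.sum_sub_distrib]
  rw [sub_eq_zero]
  simp only [Finset.sum_mul, Finset.mul_sum]
  rw [Finset.sum_sigma', Finset.sum_sigma']
  -- One sum records the first letter together with the sum of the first two, the other records the
  -- first two letters separately.
  refine Finset.sum_bij' (fun x _ => ⟨x.2, x.1 - x.2⟩) (fun x _ => ⟨x.1 + x.2, x.1⟩) ?_ ?_ ?_ ?_ ?_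
  · rintro ⟨β, γ⟩ h
    simp only [Finset.mem_sigma, Finset.mem_Ioo] at h ⊢
    obtain ⟨⟨_, h1⟩, h2, h3⟩ := h
    exact ⟨⟨h2, h3.trans h1⟩, tsub_pos_of_lt h3, tsub_lt_tsub_right_of_le h3.le h1⟩
  · rintro ⟨β, γ⟩ h
    simp only [Finset.mem_sigma, Finset.mem_Ioo] at h ⊢
    obtain ⟨⟨h0, h1⟩, h2, h3⟩ := h
    refine ⟨⟨h0.trans_le le_self_add, ?_⟩, h0, lt_add_of_pos_right β h2⟩
    have := add_lt_add_right h3 β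
    rwa [add_tsub_cancel_of_le h1.le] at this
  · rintro ⟨β, γ⟩ h
    simp only [Finset.mem_sigma, Finset.mem_Ioo] at h
    simp [add_tsub_cancel_of_le h.2.2.le]
  · rintro ⟨β, γ⟩ h
    simp
  · rintro ⟨β, γ⟩ h
    simp only [Finset.mem_sigma, Finset.mem_Ioo] at h
    rw [mul_assoc, tsub_tsub, add_tsub_cancel_of_le h.2.2.le]

theorem d_d (a : FreeAlgebra 𝕜 (σ → ℕ)) : d 𝕜 (d 𝕜 a) = 0 := by
  suffices h : d 𝕜 ∘ₗ d 𝕜 = (0 : FreeAlgebra 𝕜 (σ → ℕ) →ₗ[𝕜] FreeAlgebra 𝕜 (σ → ℕ)) from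
    LinearMap.congr_fun h a
  refine hom_ext_word ?_ fun α a ha => ?_
  · simp
  · simp only [LinearMap.coe_comp, Function.comp_apply, LinearMap.zero_apply] at ha ⊢
    rw [d_ι_mul, map_sub, d_mul, d_ι_mul, d_split, sgn_split, ha]
    simp

/-! ### A homotopy attached to one variable -/

variable (i : σ)

/-- Merge the letter `eᵢ` with the first letter of a word. -/
def mergeWord : List (σ → ℕ) → FreeAlgebra 𝕜 (σ → ℕ)
  | [] => 0
  | γ :: l => word 𝕜 ((Pi.single i 1 + γ) :: l)

/-- Merge the letter `eᵢ` with the first letter. -/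
def merge : FreeAlgebra 𝕜 (σ → ℕ) →ₗ[𝕜] FreeAlgebra 𝕜 (σ → ℕ) := wordLift 𝕜 (mergeWord 𝕜 i)

@[simp] theorem merge_one : merge 𝕜 i 1 = 0 := wordLift_word 𝕜 (mergeWord 𝕜 i) []

theorem merge_ι_mul (γ : σ → ℕ) (a : FreeAlgebra 𝕜 (σ → ℕ)) :
    merge 𝕜 i (FreeAlgebra.ι 𝕜 γ * a) = FreeAlgebra.ι 𝕜 (Pi.single i 1 + γ) * a := by
  induction a using induction_word with
  | zero => simp
  | add a b ha hb => simp only [mul_add, map_add, ha, hb]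
  | smul c a ha => simp only [mul_smul_comm, map_smul, ha]
  | word l => rw [← word_cons, merge, wordLift_word, mergeWord, word_cons]

/-- The homotopy of the cobar complex which merges the first letter containing `i`, if it is `eᵢ`,
with the next one; on words. -/
def hWord : List (σ → ℕ) → FreeAlgebra 𝕜 (σ → ℕ)
  | [] => 0
  | α :: l => if α i = 0 then -(FreeAlgebra.ι 𝕜 α * hWord l) else
      if α = Pi.single i 1 then merge 𝕜 i (word 𝕜 l) else 0

/-- The homotopy of the cobar complex which merges the first letter containing `i`, if it is `eᵢ`,
with the next one. -/
def h : FreeAlgebra 𝕜 (σ → ℕ) →ₗ[𝕜] FreeAlgebra 𝕜 (σ → ℕ) := wordLift 𝕜 (hWord 𝕜 i)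

@[simp] theorem h_one : h 𝕜 i 1 = 0 := wordLift_word 𝕜 (hWord 𝕜 i) []

theorem h_ι_mul (α : σ → ℕ) (a : FreeAlgebra 𝕜 (σ → ℕ)) :
    h 𝕜 i (FreeAlgebra.ι 𝕜 α * a) = if α i = 0 then -(FreeAlgebra.ι 𝕜 α * h 𝕜 i a) else
      if α = Pi.single i 1 then merge 𝕜 i a else 0 := by
  induction a using induction_word with
  | zero => simp
  | add a b ha hb => simp only [mul_add, map_add, ha, hb]; split_ifs <;> simp [add_comm]
  | smul c a ha => simp only [mul_smul_comm, map_smul, ha]; split_ifs <;> simp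
  | word l => rw [← word_cons, h, wordLift_word, wordLift_word]; rfl

variable {i}

theorem h_ι_mul_of_eq_zero {α : σ → ℕ} (hα : α i = 0) (a : FreeAlgebra 𝕜 (σ → ℕ)) :
    h 𝕜 i (FreeAlgebra.ι 𝕜 α * a) = -(FreeAlgebra.ι 𝕜 α * h 𝕜 i a) := by
  rw [h_ι_mul, if_pos hα]

variable (i)

theorem h_single_mul (a : FreeAlgebra 𝕜 (σ → ℕ)) :
    h 𝕜 i (FreeAlgebra.ι 𝕜 (Pi.single i 1) * a) = merge 𝕜 i a := by
  rw [h_ι_mul, if_neg (by simp), if_pos rfl]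

variable {i}

theorem h_ι_mul_of_ne {α : σ → ℕ} (hα : α i ≠ 0) (hα' : α ≠ Pi.single i 1)
    (a : FreeAlgebra 𝕜 (σ → ℕ)) : h 𝕜 i (FreeAlgebra.ι 𝕜 α * a) = 0 := by
  rw [h_ι_mul, if_neg hα, if_neg hα']

theorem Ioo_single : Finset.Ioo 0 (Pi.single i 1 : σ → ℕ) = ∅ := by
  refine Finset.eq_empty_of_forall_notMem fun β hβ => ?_
  obtain ⟨h0, h1⟩ := Finset.mem_Ioo.1 hβ
  have hle : ∀ j, β j ≤ (Pi.single i 1 : σ → ℕ) j := h1.le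
  by_cases hi : β i = 0
  · refine h0.ne' (funext fun j => ?_)
    by_cases hj : j = i
    · rw [hj, hi]; rfl
    · simpa [hj] using hle j
  · refine h1.ne (funext fun j => ?_)
    by_cases hj : j = i
    · subst hj
      have := hle j
      simp only [Pi.single_eq_same] at this ⊢
      omega
    · simpa [hj] using hle j

@[simp] theorem split_single : split 𝕜 (Pi.single i 1 : σ → ℕ) = 0 := by
  simp [split, Ioo_single]

variable (i) in
/-- The defect of the homotopy `h`. -/
def defect : FreeAlgebra 𝕜 (σ → ℕ) →ₗ[𝕜] FreeAlgebra 𝕜 (σ → ℕ) :=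
  LinearMap.id - (d 𝕜 ∘ₗ h 𝕜 i + h 𝕜 i ∘ₗ d 𝕜)

theorem defect_apply (a : FreeAlgebra 𝕜 (σ → ℕ)) :
    defect 𝕜 i a = a - (d 𝕜 (h 𝕜 i a) + h 𝕜 i (d 𝕜 a)) := rfl

variable (i) in
@[simp] theorem defect_one : defect 𝕜 i (1 : FreeAlgebra 𝕜 (σ → ℕ)) = 1 := by simp [defect_apply]

/-- A letter without i splits only into letters without i, and both d and h move past such letters
with a sign. The signs cancel in dh + hd. -/
theorem defect_ι_mul {α : σ → ℕ} (hα : α i = 0) (a : FreeAlgebra 𝕜 (σ → ℕ)) :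
    defect 𝕜 i (FreeAlgebra.ι 𝕜 α * a) = FreeAlgebra.ι 𝕜 α * defect 𝕜 i a := by
  have hsplit : h 𝕜 i (split 𝕜 α * a) = split 𝕜 α * h 𝕜 i a := by
    simp only [split, Finset.sum_mul, map_sum]
    refine Finset.sum_congr rfl fun β hβ => ?_
    have hβi : β i ≤ α i := (Finset.mem_Ioo.1 hβ).2.le i
    rw [mul_assoc, h_ι_mul_of_eq_zero 𝕜 (by omega), h_ι_mul_of_eq_zero 𝕜 (by simp [hα])]
    noncomm_ring
  rw [defect_apply, defect_apply, h_ι_mul_of_eq_zero 𝕜 hα, d_ι_mul, map_neg, map_sub, d_ι_mul,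
    h_ι_mul_of_eq_zero 𝕜 hα, hsplit]
  noncomm_ring

variable (i) in
theorem defect_single : defect 𝕜 i (FreeAlgebra.ι 𝕜 (Pi.single i 1)) =
    FreeAlgebra.ι 𝕜 (Pi.single i 1) := by
  have h1 : h 𝕜 i (FreeAlgebra.ι 𝕜 (Pi.single i 1)) = 0 := by
    simpa using h_single_mul 𝕜 i 1
  rw [defect_apply, h1, d_ι, split_single]; simp

-- Merging gives the letter eᵢ + γ. Its splittings whose left part contains i are the original word
-- and the terms that h produces from the splittings of γ. What remains starts with a letter free of
-- i, which is what makes iteration terminate.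
variable (i) in
theorem defect_single_mul {γ : σ → ℕ} (hγ : γ ≠ 0) (a : FreeAlgebra 𝕜 (σ → ℕ)) :
    defect 𝕜 i (FreeAlgebra.ι 𝕜 (Pi.single i 1) * (FreeAlgebra.ι 𝕜 γ * a)) =
      -∑ δ ∈ (Finset.Ioo 0 (Pi.single i 1 + γ)).filter (fun δ => δ i = 0),
        FreeAlgebra.ι 𝕜 δ * (FreeAlgebra.ι 𝕜 (Pi.single i 1 + γ - δ) * a) := by
  have hγ0 : 0 < γ := pos_iff_ne_zero.2 hγ
  have hsum : split 𝕜 (Pi.single i 1 + γ) =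
      FreeAlgebra.ι 𝕜 (Pi.single i 1) * FreeAlgebra.ι 𝕜 γ +
      ∑ δ ∈ Finset.Ioo 0 γ, FreeAlgebra.ι 𝕜 (Pi.single i 1 + δ) * FreeAlgebra.ι 𝕜 (γ - δ) +
      ∑ δ ∈ (Finset.Ioo 0 (Pi.single i 1 + γ)).filter (fun δ => δ i = 0),
        FreeAlgebra.ι 𝕜 δ * FreeAlgebra.ι 𝕜 (Pi.single i 1 + γ - δ) := by
    rw [split, ← Finset.sum_filter_add_sum_filter_not _ (fun δ => δ i = 0), add_comm]
    congr 1
    -- A left part containing i is at least eᵢ: either it is eᵢ itself, or subtracting eᵢ leaves a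
    -- proper nonzero part of γ.
    have hset : (Finset.Ioo 0 (Pi.single i 1 + γ)).filter (fun δ => ¬δ i = 0) =
        insert (Pi.single i 1) ((Finset.Ioo 0 γ).image (Pi.single i 1 + ·)) := by
      ext δ
      simp only [Finset.mem_filter, Finset.mem_Ioo, Finset.mem_insert, Finset.mem_image]
      constructor
      · rintro ⟨⟨h0, h1⟩, h2⟩
        have hle : Pi.single i 1 ≤ δ := by
          intro j
          by_cases hj : j = i
          · subst hj; simp; omega
          · simp [hj]
        by_cases h3 : δ = Pi.single i 1
        · exact Or.inl h3
        · refine Or.inr ⟨δ - Pi.single i 1, ⟨?_, ?_⟩, add_tsub_cancel_of_le hle⟩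
          · exact tsub_pos_of_lt (lt_of_le_of_ne hle (Ne.symm h3))
          · rw [← add_tsub_cancel_left (Pi.single i 1) γ]
            exact tsub_lt_tsub_right_of_le hle h1
      · rintro (rfl | ⟨δ, ⟨h0, h1⟩, rfl⟩)
        · exact ⟨⟨by simp [pos_iff_ne_zero], lt_add_of_pos_right _ hγ0⟩, by simp⟩
        · exact ⟨⟨h0.trans_le le_add_self, add_lt_add_right h1 _⟩, by simp⟩
    rw [hset, Finset.sum_insert, Finset.sum_image]
    · simp [add_tsub_add_eq_tsub_left]
    · intro x _ y _ hxy; exact add_left_cancel hxy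
    · simp only [Finset.mem_image, not_exists, not_and, Finset.mem_Ioo]
      rintro δ ⟨h0, _⟩ h1
      exact h0.ne' (by simpa using h1)
  have hmerge : merge 𝕜 i (split 𝕜 γ * a) =
      (∑ δ ∈ Finset.Ioo 0 γ, FreeAlgebra.ι 𝕜 (Pi.single i 1 + δ) * FreeAlgebra.ι 𝕜 (γ - δ)) * a := by
    simp only [split, Finset.sum_mul, map_sum, mul_assoc, merge_ι_mul]
  rw [defect_apply, h_single_mul, merge_ι_mul, d_ι_mul, d_ι_mul, split_single, zero_mul, zero_sub,
    map_neg, h_single_mul, d_ι_mul, map_sub, merge_ι_mul, hmerge, hsum]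
  simp only [← mul_assoc, ← Finset.sum_mul]
  noncomm_ring

/-- Here h kills the word, and among the splittings of β only eᵢ · (β - eᵢ) merges back to it. Other
left parts containing i are killed, and those free of i give the right-hand side. -/
theorem defect_ι_mul_of_ne {β : σ → ℕ} (hβ : β i ≠ 0) (hβ' : β ≠ Pi.single i 1)
    (a : FreeAlgebra 𝕜 (σ → ℕ)) :
    defect 𝕜 i (FreeAlgebra.ι 𝕜 β * a) = ∑ δ ∈ (Finset.Ioo 0 β).filter (fun δ => δ i = 0),
      FreeAlgebra.ι 𝕜 δ * h 𝕜 i (FreeAlgebra.ι 𝕜 (β - δ) * a) := by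
  have hle : Pi.single i 1 ≤ β := by
    intro j
    by_cases hj : j = i
    · subst hj; simp; omega
    · simp [hj]
  have hmem : Pi.single i 1 ∈ (Finset.Ioo 0 β).filter (fun δ => ¬δ i = 0) := by
    simp only [Finset.mem_filter, Finset.mem_Ioo]
    exact ⟨⟨by simp [pos_iff_ne_zero], lt_of_le_of_ne hle (Ne.symm hβ')⟩, by simp⟩
  rw [defect_apply, h_ι_mul_of_ne 𝕜 hβ hβ', d_ι_mul, map_sub, h_ι_mul_of_ne 𝕜 hβ hβ', split,
    Finset.sum_mul, map_sum, ← Finset.sum_filter_add_sum_filter_not _ (fun δ => δ i = 0),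
    Finset.sum_eq_single_of_mem _ hmem]
  · rw [mul_assoc, h_single_mul, merge_ι_mul, add_tsub_cancel_of_le hle, map_zero, zero_add,
      sub_zero, sub_add_cancel_right, ← Finset.sum_neg_distrib]
    refine Finset.sum_congr rfl fun δ hδ => ?_
    rw [mul_assoc, h_ι_mul_of_eq_zero 𝕜 (Finset.mem_filter.1 hδ).2, neg_neg]
  · intro δ hδ hδ'
    rw [mul_assoc, h_ι_mul_of_ne 𝕜 (Finset.mem_filter.1 hδ).2 hδ']

end Cobar

/-! ### Reduction of cobar cocycles, one variable at a time -/

namespace Cobar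

variable (𝕜 : Type*) [Field 𝕜] {σ : Type*} [Fintype σ] [DecidableEq σ]

/-- The letters are nonzero multi-indices which are supported on `F`. -/
def IsSupported (F : Finset σ) (l : List (σ → ℕ)) : Prop :=
  ∀ α ∈ l, α ≠ 0 ∧ ∀ j, α j ≠ 0 → j ∈ F

/-- The span of the words whose letters are nonzero and supported on `F`. -/
def supported (F : Finset σ) : Submodule 𝕜 (FreeAlgebra 𝕜 (σ → ℕ)) :=
  Submodule.span 𝕜 {a | ∃ l, IsSupported F l ∧ a = word 𝕜 l}

/-- The span of the words whose letters have weight one. -/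
def linearPart : Submodule 𝕜 (FreeAlgebra 𝕜 (σ → ℕ)) :=
  Submodule.span 𝕜 {a | ∃ l : List (σ → ℕ), (∀ α ∈ l, ∑ j, α j = 1) ∧ a = word 𝕜 l}

theorem IsSupported.cons {F : Finset σ} {l : List (σ → ℕ)} (hl : IsSupported F l) {α : σ → ℕ}
    (h0 : α ≠ 0) (h : ∀ j, α j ≠ 0 → j ∈ F) : IsSupported F (α :: l) := by
  intro β hβ
  rcases List.mem_cons.1 hβ with rfl | hβ
  · exact ⟨h0, h⟩
  · exact hl β hβ

theorem IsSupported.tail {F : Finset σ} {l : List (σ → ℕ)} {α : σ → ℕ}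
    (hl : IsSupported F (α :: l)) : IsSupported F l :=
  fun β hβ => hl β (List.mem_cons_of_mem _ hβ)

theorem word_mem_supported {F : Finset σ} {l : List (σ → ℕ)} (hl : IsSupported F l) :
    word 𝕜 l ∈ supported 𝕜 F := Submodule.subset_span ⟨l, hl, rfl⟩

variable {𝕜} in
theorem ι_mul_mem_supported {F : Finset σ} {α : σ → ℕ} (h0 : α ≠ 0) (h : ∀ j, α j ≠ 0 → j ∈ F)
    {a : FreeAlgebra 𝕜 (σ → ℕ)} (ha : a ∈ supported 𝕜 F) :
    FreeAlgebra.ι 𝕜 α * a ∈ supported 𝕜 F := by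
  induction ha using Submodule.span_induction with
  | mem a ha =>
    obtain ⟨l, hl, rfl⟩ := ha
    rw [← word_cons]
    exact word_mem_supported 𝕜 (hl.cons h0 h)
  | zero => simp
  | add a b _ _ ha hb => rw [mul_add]; exact add_mem ha hb
  | smul c a _ ha => rw [mul_smul_comm]; exact Submodule.smul_mem _ c ha

variable {𝕜} in
theorem d_mem_supported {F : Finset σ} {a : FreeAlgebra 𝕜 (σ → ℕ)} (ha : a ∈ supported 𝕜 F) :
    d 𝕜 a ∈ supported 𝕜 F := by
  induction ha using Submodule.span_induction with
  | mem a ha =>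
    obtain ⟨l, hl, rfl⟩ := ha
    induction l with
    | nil => simp
    | cons α l ih =>
      have hα := hl α List.mem_cons_self
      rw [word_cons, d_ι_mul, split, Finset.sum_mul]
      refine sub_mem (Submodule.sum_mem _ fun β hβ => ?_)
        (ι_mul_mem_supported hα.1 hα.2 (ih hl.tail))
      obtain ⟨h0, h1⟩ := Finset.mem_Ioo.1 hβ
      rw [mul_assoc]
      refine ι_mul_mem_supported h0.ne' (fun j hj => hα.2 j ?_)
        (ι_mul_mem_supported (tsub_pos_of_lt h1).ne' (fun j hj => hα.2 j ?_)
          (word_mem_supported 𝕜 hl.tail))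
      · have : β j ≤ α j := h1.le j
        omega
      · have : (α - β) j = α j - β j := rfl
        omega
  | zero => simp
  | add a b _ _ ha hb => rw [map_add]; exact add_mem ha hb
  | smul c a _ ha => rw [map_smul]; exact Submodule.smul_mem _ c ha

/-- The words without `i`, possibly followed by the letter `eᵢ`. -/
def critical (F : Finset σ) (i : σ) : Submodule 𝕜 (FreeAlgebra 𝕜 (σ → ℕ)) :=
  supported 𝕜 F ⊔
    (supported 𝕜 F).map (LinearMap.mulRight 𝕜 (FreeAlgebra.ι 𝕜 (Pi.single i 1)))

variable {𝕜} {F : Finset σ} {i : σ}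

theorem defect_of_mem_critical (hi : i ∉ F) {a : FreeAlgebra 𝕜 (σ → ℕ)}
    (ha : a ∈ critical 𝕜 F i) : defect 𝕜 i a = a := by
  have key : ∀ b, defect 𝕜 i b = b → ∀ l, IsSupported F l →
      defect 𝕜 i (word 𝕜 l * b) = word 𝕜 l * b := by
    intro b hb l hl
    induction l with
    | nil => simpa using hb
    | cons α l ih =>
      have hα : α i = 0 := by
        by_contra h
        exact hi ((hl α List.mem_cons_self).2 i h)
      rw [word_cons, mul_assoc, defect_ι_mul 𝕜 hα, ih hl.tail]
  have key' : ∀ b, defect 𝕜 i b = b → ∀ a ∈ supported 𝕜 F, defect 𝕜 i (a * b) = a * b := by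
    intro b hb a ha
    induction ha using Submodule.span_induction with
    | mem a ha => obtain ⟨l, hl, rfl⟩ := ha; exact key b hb l hl
    | zero => simp
    | add a b _ _ ha hb => rw [add_mul, map_add, ha, hb]
    | smul c a _ ha => rw [smul_mul_assoc, map_smul, ha]
  obtain ⟨a, ha', _, ⟨b, hb, rfl⟩, rfl⟩ := Submodule.mem_sup.1 ha
  rw [map_add, LinearMap.mulRight_apply, key' _ (defect_single 𝕜 i) b hb]
  congr 1
  simpa using key' 1 (by simp) a ha'

theorem ι_mul_mem_critical {α : σ → ℕ} (h0 : α ≠ 0) (h : ∀ j, α j ≠ 0 → j ∈ F)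
    {a : FreeAlgebra 𝕜 (σ → ℕ)} (ha : a ∈ critical 𝕜 F i) :
    FreeAlgebra.ι 𝕜 α * a ∈ critical 𝕜 F i := by
  obtain ⟨a, ha', _, ⟨b, hb, rfl⟩, rfl⟩ := Submodule.mem_sup.1 ha
  rw [mul_add, LinearMap.mulRight_apply, ← mul_assoc]
  exact Submodule.add_mem_sup (ι_mul_mem_supported h0 h ha') ⟨_, ι_mul_mem_supported h0 h hb, rfl⟩

variable (𝕜) in
/-- The elements which the iterated defect makes critical. -/
def eventuallyCritical (hi : i ∉ F) : Submodule 𝕜 (FreeAlgebra 𝕜 (σ → ℕ)) where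
  carrier := {a | ∃ M : ℕ, (defect 𝕜 i ^ M) a ∈ critical 𝕜 F i}
  zero_mem' := ⟨0, by simp⟩
  smul_mem' := by
    rintro c a ⟨M, hM⟩
    exact ⟨M, by rw [map_smul]; exact Submodule.smul_mem _ c hM⟩
  add_mem' := by
    -- Critical elements are fixed by the defect, so exponents may be increased freely. This allows
    -- a common exponent for two summands.
    have mono : ∀ (a : FreeAlgebra 𝕜 (σ → ℕ)) (M k : ℕ), (defect 𝕜 i ^ M) a ∈ critical 𝕜 F i →
        (defect 𝕜 i ^ (k + M)) a ∈ critical 𝕜 F i := by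
      intro a M k ha
      induction k with
      | zero => simpa using ha
      | succ k ih =>
        rw [add_right_comm, pow_succ', Module.End.mul_apply, defect_of_mem_critical hi ih]
        exact ih
    rintro a b ⟨M, hM⟩ ⟨N, hN⟩
    refine ⟨M + N, ?_⟩
    rw [map_add]
    exact add_mem (add_comm N M ▸ mono a M N hM) (mono b N M hN)

theorem mem_eventuallyCritical_of_defect (hi : i ∉ F) {a : FreeAlgebra 𝕜 (σ → ℕ)}
    (ha : defect 𝕜 i a ∈ eventuallyCritical 𝕜 hi) : a ∈ eventuallyCritical 𝕜 hi := by
  obtain ⟨M, hM⟩ := ha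
  exact ⟨M + 1, by rwa [pow_succ, Module.End.mul_apply]⟩

theorem ι_mul_mem_eventuallyCritical (hi : i ∉ F) {α : σ → ℕ} (h0 : α ≠ 0)
    (h : ∀ j, α j ≠ 0 → j ∈ F) {a : FreeAlgebra 𝕜 (σ → ℕ)}
    (ha : a ∈ eventuallyCritical 𝕜 hi) :
    FreeAlgebra.ι 𝕜 α * a ∈ eventuallyCritical 𝕜 hi := by
  have hα : α i = 0 := by
    by_contra h'
    exact hi (h i h')
  obtain ⟨M, hM⟩ := ha
  refine ⟨M, ?_⟩
  have : (defect 𝕜 i ^ M) (FreeAlgebra.ι 𝕜 α * a) = FreeAlgebra.ι 𝕜 α * (defect 𝕜 i ^ M) a := by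
    clear hM
    induction M with
    | zero => simp
    | succ M ih => rw [pow_succ', Module.End.mul_apply, ih, defect_ι_mul 𝕜 hα, Module.End.mul_apply]
  rw [this]
  exact ι_mul_mem_critical h0 h hM

theorem sum_pos_of_ne_zero {α : σ → ℕ} (h : α ≠ 0) : 0 < ∑ j, α j := by
  obtain ⟨j, hj⟩ := Function.ne_iff.1 h
  exact (Nat.pos_of_ne_zero hj).trans_le
    (Finset.single_le_sum (fun _ _ => Nat.zero_le _) (Finset.mem_univ j))

theorem sum_sub_add {α β : σ → ℕ} (h : β ≤ α) : ∑ j, (α - β) j + ∑ j, β j = ∑ j, α j := by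
  rw [← Finset.sum_add_distrib]
  exact Finset.sum_congr rfl fun j _ => Nat.sub_add_cancel (h j)

/-- Induction on total weight. A leading letter free of i can be split off, and otherwise one
application of the defect yields words with such a leading letter, so that the remaining word is
strictly lighter. -/
theorem word_mem_eventuallyCritical (hi : i ∉ F) (k : ℕ) (l : List (σ → ℕ))
    (hl : IsSupported (insert i F) l) (hk : (l.map fun α => ∑ j, α j).sum = k) :
    word 𝕜 l ∈ eventuallyCritical 𝕜 hi := by
  induction k using Nat.strong_induction_on generalizing l with
  | _ k ih =>
  match l with
  | [] =>
    exact ⟨0, Submodule.mem_sup_left (word_mem_supported 𝕜 (fun α hα => by simp at hα))⟩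
  | β :: l =>
    obtain ⟨hβ0, hβF⟩ := hl β List.mem_cons_self
    have hβpos := sum_pos_of_ne_zero hβ0
    simp only [List.map_cons, List.sum_cons] at hk
    have hsupp : ∀ {δ : σ → ℕ}, δ ≤ β → δ i = 0 → ∀ j, δ j ≠ 0 → j ∈ F := by
      intro δ hδ hδi j hj
      have : β j ≠ 0 := by have : δ j ≤ β j := hδ j; omega
      rcases Finset.mem_insert.1 (hβF j this) with rfl | h
      · exact absurd hδi hj
      · exact h
    by_cases hβi : β i = 0
    · rw [word_cons]
      exact ι_mul_mem_eventuallyCritical hi hβ0 (hsupp le_rfl hβi) (ih _ (by omega) l hl.tail rfl)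
    by_cases hβe : β = Pi.single i 1
    · match l with
      | [] =>
        -- The word is the single letter eᵢ = 1 · eᵢ, which is already critical.
        refine ⟨0, Submodule.mem_sup_right ⟨1, ?_, ?_⟩⟩
        · exact word_mem_supported 𝕜 (l := []) (fun α hα => by simp at hα)
        · simp [hβe]
      | γ :: l =>
        obtain ⟨hγ0, hγF⟩ := hl γ (by simp)
        apply mem_eventuallyCritical_of_defect
        rw [word_cons, word_cons, hβe, defect_single_mul 𝕜 i hγ0, ← hβe]
        refine neg_mem (Submodule.sum_mem _ fun δ hδ => ?_)
        obtain ⟨hδ, hδi⟩ := Finset.mem_filter.1 hδ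
        obtain ⟨hδ0, hδ1⟩ := Finset.mem_Ioo.1 hδ
        have hδF : ∀ j, (β + γ) j ≠ 0 → j ∈ insert i F := by
          intro j hj
          by_cases h : β j = 0
          · exact hγF j (by simpa [h] using hj)
          · exact hβF j h
        refine ι_mul_mem_eventuallyCritical hi hδ0.ne' (fun j hj => ?_) ?_
        · have : (β + γ) j ≠ 0 := by have : δ j ≤ (β + γ) j := hδ1.le j; omega
          rcases Finset.mem_insert.1 (hδF j this) with rfl | h
          · exact absurd hδi hj
          · exact h
        · rw [← word_cons]
          refine ih _ ?_ _ (hl.tail.tail.cons (tsub_pos_of_lt hδ1).ne' fun j hj => hδF j ?_) rfl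
          · have h1 := sum_sub_add hδ1.le
            have h2 := sum_pos_of_ne_zero hδ0.ne'
            have h3 : ∑ j, (β + γ) j = ∑ j, β j + ∑ j, γ j := Finset.sum_add_distrib
            simp only [List.map_cons, List.sum_cons] at hk ⊢
            omega
          · have : (β + γ - δ) j = (β + γ) j - δ j := rfl
            omega
    · apply mem_eventuallyCritical_of_defect
      rw [word_cons, defect_ι_mul_of_ne 𝕜 hβi hβe]
      refine Submodule.sum_mem _ fun δ hδ => ?_
      obtain ⟨hδ, hδi⟩ := Finset.mem_filter.1 hδ
      obtain ⟨hδ0, hδ1⟩ := Finset.mem_Ioo.1 hδ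
      refine ι_mul_mem_eventuallyCritical hi hδ0.ne' (hsupp hδ1.le hδi) ?_
      have hne : (β - δ) i ≠ 0 := by
        have : (β - δ) i = β i - δ i := rfl
        omega
      rw [h_ι_mul, if_neg hne]
      split_ifs with he
      -- When β - δ = eᵢ, the homotopy merges it with the next letter, and gives zero if there is
      -- none. The merged word has lost exactly the weight of δ.
      · match l with
        | [] => simp
        | γ :: l =>
          obtain ⟨hγ0, hγF⟩ := hl γ (by simp)
          rw [word_cons, merge_ι_mul, ← he, ← word_cons]
          refine ih _ ?_ _ (hl.tail.tail.cons ?_ fun j hj => ?_) rfl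
          · have h1 := sum_sub_add hδ1.le
            have h2 := sum_pos_of_ne_zero hδ0.ne'
            have h3 : ∑ j, (β - δ + γ) j = ∑ j, (β - δ) j + ∑ j, γ j := Finset.sum_add_distrib
            simp only [List.map_cons, List.sum_cons] at hk ⊢
            omega
          · exact ((tsub_pos_of_lt hδ1).trans_le le_self_add).ne'
          · by_cases h : γ j = 0
            · refine hβF j fun h' => hj ?_
              have : (β - δ + γ) j = β j - δ j + γ j := rfl
              omega
            · exact hγF j h
      · exact zero_mem _

theorem supported_le_eventuallyCritical (hi : i ∉ F) :
    supported 𝕜 (insert i F) ≤ eventuallyCritical 𝕜 hi :=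
  Submodule.span_le.2 fun _ ⟨l, hl, ha⟩ => ha ▸ word_mem_eventuallyCritical hi _ l hl rfl

/-- On a cocycle the defect is a ↦ a - d(h a), so iterating it stays in the cohomology class. -/
theorem iterate_defect_cocycle (i : σ) {a : FreeAlgebra 𝕜 (σ → ℕ)} (ha : d 𝕜 a = 0) (M : ℕ) :
    d 𝕜 ((defect 𝕜 i ^ M) a) = 0 ∧ a - (defect 𝕜 i ^ M) a ∈ LinearMap.range (d 𝕜) := by
  induction M with
  | zero => simp [ha]
  | succ M ih =>
    obtain ⟨h1, h2⟩ := ih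
    rw [pow_succ', Module.End.mul_apply, defect_apply, h1, map_zero, add_zero, map_sub, h1, d_d,
      sub_zero]
    refine ⟨rfl, ?_⟩
    rw [sub_sub_eq_add_sub, add_sub_right_comm]
    exact add_mem h2 (LinearMap.mem_range_self _ _)

variable (𝕜 i) in
/-- The homomorphism which kills the letters containing `i`. -/
def kill : FreeAlgebra 𝕜 (σ → ℕ) →ₐ[𝕜] FreeAlgebra 𝕜 (σ → ℕ) :=
  FreeAlgebra.lift 𝕜 fun α => if α i = 0 then FreeAlgebra.ι 𝕜 α else 0

theorem kill_of_mem_supported (hi : i ∉ F) {a : FreeAlgebra 𝕜 (σ → ℕ)} (ha : a ∈ supported 𝕜 F) :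
    kill 𝕜 i a = a := by
  induction ha using Submodule.span_induction with
  | mem a ha =>
    obtain ⟨l, hl, rfl⟩ := ha
    induction l with
    | nil => simp
    | cons α l ih =>
      have hα : α i = 0 := by
        by_contra h
        exact hi ((hl α List.mem_cons_self).2 i h)
      rw [word_cons, map_mul, ih hl.tail]
      simp [kill, hα]
  | zero => simp
  | add a b _ _ ha hb => rw [map_add, ha, hb]
  | smul c a _ ha => rw [map_smul, ha]

variable (i) in
theorem d_mul_single (a : FreeAlgebra 𝕜 (σ → ℕ)) :
    d 𝕜 (a * FreeAlgebra.ι 𝕜 (Pi.single i 1)) = d 𝕜 a * FreeAlgebra.ι 𝕜 (Pi.single i 1) := by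
  rw [d_mul, d_ι, split_single, mul_zero, add_zero]

variable (i) in
theorem mul_single_mem_linearPart {a : FreeAlgebra 𝕜 (σ → ℕ)} (ha : a ∈ linearPart 𝕜) :
    a * FreeAlgebra.ι 𝕜 (Pi.single i 1) ∈ linearPart 𝕜 := by
  induction ha using Submodule.span_induction with
  | mem a ha =>
    obtain ⟨l, hl, rfl⟩ := ha
    refine Submodule.subset_span ⟨l ++ [Pi.single i 1], fun α hα => ?_, by simp [word]⟩
    rcases List.mem_append.1 hα with h | h
    · exact hl α h
    · rw [List.mem_singleton.1 h]; simp
  | zero => simp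
  | add a b _ _ ha hb => rw [add_mul]; exact add_mem ha hb
  | smul c a _ ha => rw [smul_mul_assoc]; exact Submodule.smul_mem _ c ha

/-- The cohomology of the cobar complex is represented by words with letters of weight one. -/
theorem mem_of_d_eq_zero (F : Finset σ) {a : FreeAlgebra 𝕜 (σ → ℕ)} (ha : a ∈ supported 𝕜 F)
    (hd : d 𝕜 a = 0) : a ∈ LinearMap.range (d 𝕜) ⊔ linearPart 𝕜 := by
  induction F using Finset.induction_on generalizing a with
  | empty =>
    refine Submodule.mem_sup_right ((Submodule.span_le.2 ?_ : supported 𝕜 ∅ ≤ linearPart 𝕜) ha)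
    rintro _ ⟨l, hl, rfl⟩
    refine Submodule.subset_span ⟨l, fun α hα => ?_, rfl⟩
    obtain ⟨h0, h⟩ := hl α hα
    -- No nonzero letter has empty support, so only the empty word occurs.
    exact absurd (funext fun j => by by_contra hj; simpa using h j hj) h0
  | insert i F hi ih =>
    obtain ⟨M, hM⟩ := supported_le_eventuallyCritical hi ha
    obtain ⟨h1, h2⟩ := iterate_defect_cocycle i hd M
    rw [← sub_add_cancel a ((defect 𝕜 i ^ M) a)]
    refine add_mem (Submodule.mem_sup_left h2) ?_
    obtain ⟨x, hx, _, ⟨y, hy, rfl⟩, hxy⟩ := Submodule.mem_sup.1 hM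
    rw [← hxy] at h1 ⊢
    rw [LinearMap.mulRight_apply] at *
    rw [map_add, d_mul_single] at h1
    -- The cocycle has become x + y eᵢ, with differential dx + dy · eᵢ. Killing the letters
    -- containing i isolates dx.
    have hdx : d 𝕜 x = 0 := by
      have h3 := congrArg (kill 𝕜 i) h1
      rw [map_add, map_mul, kill_of_mem_supported hi (d_mem_supported hx)] at h3
      simpa [kill] using h3
    -- The factor eᵢ can be cancelled because the free algebra has no zero divisors.
    have hdy : d 𝕜 y = 0 := by
      rw [hdx, zero_add] at h1
      exact (mul_eq_zero.1 h1).resolve_right (FreeAlgebra.ι_ne_zero _)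
    refine add_mem (ih hx hdx) ?_
    obtain ⟨_, ⟨b, rfl⟩, t, ht, hbt⟩ := Submodule.mem_sup.1 (ih hy hdy)
    rw [← hbt, add_mul, ← d_mul_single]
    exact Submodule.add_mem_sup (LinearMap.mem_range_self _ _) (mul_single_mem_linearPart i ht)

end Cobar

/-! ### Multi-indices -/

section MultiIndex

variable {σ : Type*} [Fintype σ] [DecidableEq σ]

theorem mem_piAntidiag_univ {α : σ → ℕ} {k : ℕ} :
    α ∈ Finset.piAntidiag Finset.univ k ↔ ∑ j, α j = k := by
  simp [Finset.mem_piAntidiag]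

/-- Decompositions `α = β + γ` into nonzero multi-indices, where `α` has weight `k`, sorted by the
weight of `β`. -/
theorem sum_Ioo_eq_sum_Iio {M : Type*} [AddCommMonoid M] (k : ℕ+) (f : (σ → ℕ) → (σ → ℕ) → M) :
    ∑ α ∈ Finset.piAntidiag Finset.univ (k : ℕ), ∑ β ∈ Finset.Ioo 0 α, f β (α - β) =
      ∑ s ∈ Finset.Iio k, ∑ β ∈ Finset.piAntidiag Finset.univ (s : ℕ),
        ∑ γ ∈ Finset.piAntidiag Finset.univ ((k - s : ℕ+) : ℕ), f β γ := by
  simp_rw [← Finset.sum_product', Finset.sum_sigma']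
  have hle : ∀ {β α : σ → ℕ}, 0 < β → β < α →
      0 < ∑ j, β j ∧ ∑ j, β j < ∑ j, α j ∧ ∑ j, (α - β) j = ∑ j, α j - ∑ j, β j := by
    intro β α h0 h1
    have h2 := Cobar.sum_sub_add h1.le
    have h3 := Cobar.sum_pos_of_ne_zero h0.ne'
    have h4 := Cobar.sum_pos_of_ne_zero (tsub_pos_of_lt h1).ne'
    omega
  -- `toPNat'` sends 0 to 1, but the weight of β is positive here.
  refine Finset.sum_bij' (fun x _ => ⟨(∑ j, x.2 j).toPNat', (x.2, x.1 - x.2)⟩)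
    (fun x _ => ⟨x.2.1 + x.2.2, x.2.1⟩) ?_ ?_ ?_ ?_ (fun _ _ => rfl)
  · rintro ⟨α, β⟩ hx
    simp only [Finset.mem_sigma, Finset.mem_Ioo, mem_piAntidiag_univ] at hx
    obtain ⟨h1, h2, h3⟩ := hle hx.2.1 hx.2.2
    rw [hx.1] at h2 h3
    simp only [Finset.mem_sigma, Finset.mem_Iio, Finset.mem_product, mem_piAntidiag_univ]
    have hlt : (∑ j, β j).toPNat' < k := by
      rw [← PNat.coe_lt_coe, Nat.toPNat'_coe, if_pos h1]
      exact h2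
    rw [PNat.sub_coe, if_pos hlt, Nat.toPNat'_coe, if_pos h1]
    exact ⟨hlt, rfl, h3⟩
  · rintro ⟨s, β, γ⟩ h
    simp only [Finset.mem_sigma, Finset.mem_Iio, Finset.mem_product, mem_piAntidiag_univ] at h
    obtain ⟨h1, h2, h3⟩ := h
    rw [PNat.sub_coe, if_pos h1] at h3
    have h4 : (s : ℕ) < k := h1
    have hβ : β ≠ 0 := by rintro rfl; simp at h2; exact s.ne_zero h2.symm
    have hγ : γ ≠ 0 := by rintro rfl; simp at h3; omega
    simp only [Finset.mem_sigma, Finset.mem_Ioo, mem_piAntidiag_univ]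
    refine ⟨?_, pos_iff_ne_zero.2 hβ, lt_add_of_pos_right _ (pos_iff_ne_zero.2 hγ)⟩
    simp only [Pi.add_apply, Finset.sum_add_distrib]
    omega
  · rintro ⟨α, β⟩ hx
    simp only [Finset.mem_sigma, Finset.mem_Ioo] at hx
    simp [add_tsub_cancel_of_le hx.2.2.le]
  · rintro ⟨s, β, γ⟩ h
    simp only [Finset.mem_sigma, Finset.mem_product, mem_piAntidiag_univ] at h
    have hs : (∑ j, β j).toPNat' = s := by rw [h.2.1]; exact PNat.coe_toPNat' s
    simp [hs]

/-- The monomial with exponent `α`, evaluated at `t`. -/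
def monomialEval {R : Type*} [CommSemiring R] (t : σ → R) (α : σ → ℕ) : R := ∏ i, t i ^ α i

theorem monomialEval_mul {R : Type*} [CommSemiring R] (t : σ → R) {α β : σ → ℕ} (h : β ≤ α) :
    monomialEval t α = monomialEval t β * monomialEval t (α - β) := by
  rw [monomialEval, monomialEval, monomialEval, ← Finset.prod_mul_distrib]
  refine Finset.prod_congr rfl fun i _ => ?_
  rw [← pow_add]
  congr 1
  exact (Nat.add_sub_cancel' (h i)).symm

open Polynomial in
/-- The derivative at `t` in the direction `w` of the monomial with exponent `α`. -/
def monomialDeriv {R : Type*} [CommRing R] (t w : σ → R) (α : σ → ℕ) : R :=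
  (derivative (monomialEval (fun i => C (t i) + X * C (w i)) α)).eval 0

open Polynomial in
theorem monomialDeriv_mul {R : Type*} [CommRing R] (t w : σ → R) {α β : σ → ℕ} (h : β ≤ α) :
    monomialDeriv t w α = monomialDeriv t w β * monomialEval t (α - β) +
      monomialEval t β * monomialDeriv t w (α - β) := by
  have key : ∀ α, (monomialEval (fun i => C (t i) + X * C (w i)) α).eval 0 = monomialEval t α := by
    intro α
    simp [monomialEval, eval_prod]
  rw [monomialDeriv, monomialEval_mul _ h, derivative_mul, eval_add, eval_mul, eval_mul, key, key]
  rfl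

end MultiIndex

/-! ### Symmetric powers in terms of a basis -/

section Sym

variable {𝕜 : Type*} [Field 𝕜] {𝔤 : Type*} [LieRing 𝔤] [LieAlgebra 𝕜 𝔤]
  {σ : Type*} [Fintype σ] [DecidableEq σ] (b : Module.Basis σ 𝕜 𝔤)

/-- The monomial with exponent `α` in the basis `b`, multiplied by the multinomial coefficient. -/
def symMonomial (α : σ → ℕ) : SymmetricAlgebra 𝕜 𝔤 :=
  (Nat.multinomial Finset.univ α : 𝕜) • ∏ i, SymmetricAlgebra.ι 𝕜 𝔤 (b i) ^ α i

theorem ι_eq_sum (x : 𝔤) : SymmetricAlgebra.ι 𝕜 𝔤 x =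
    ∑ i, algebraMap 𝕜 _ (b.repr x i) * SymmetricAlgebra.ι 𝕜 𝔤 (b i) := by
  conv_lhs => rw [← b.sum_repr x, map_sum]
  simp [Algebra.smul_def]

theorem ι_pow_eq_sum (x : 𝔤) (k : ℕ) : SymmetricAlgebra.ι 𝕜 𝔤 x ^ k =
    ∑ α ∈ Finset.piAntidiag Finset.univ k, monomialEval (b.repr x) α • symMonomial b α := by
  rw [ι_eq_sum b, Finset.sum_pow_eq_sum_piAntidiag]
  refine Finset.sum_congr rfl fun α _ => ?_
  simp only [mul_pow, Finset.prod_mul_distrib, symMonomial, monomialEval, Algebra.smul_def, map_prod,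
    map_pow, map_natCast]
  ring

-- Both sides are the derivative at X = 0 of (x + X y)ᵏ: the left by the power rule, the right by
-- the multinomial expansion in the basis.
open Polynomial in
theorem ι_pow_mul_eq_sum (x y : 𝔤) (k : ℕ) :
    (k : 𝕜) • (SymmetricAlgebra.ι 𝕜 𝔤 x ^ (k - 1) * SymmetricAlgebra.ι 𝕜 𝔤 y) =
    ∑ α ∈ Finset.piAntidiag Finset.univ k,
      monomialDeriv (b.repr x) (b.repr y) α • symMonomial b α := by
  have h1 : (C (SymmetricAlgebra.ι 𝕜 𝔤 x) + X * C (SymmetricAlgebra.ι 𝕜 𝔤 y)) =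
      ∑ i, mapRingHom (algebraMap 𝕜 (SymmetricAlgebra 𝕜 𝔤)) (C (b.repr x i) + X * C (b.repr y i)) *
        C (SymmetricAlgebra.ι 𝕜 𝔤 (b i)) := by
    rw [ι_eq_sum b x, ι_eq_sum b y]
    simp only [map_sum, map_mul, Finset.mul_sum, ← Finset.sum_add_distrib]
    refine Finset.sum_congr rfl fun i _ => ?_
    simp
    ring
  have h2 := congrArg (fun p => (derivative (p ^ k)).eval 0) h1
  simp only [Finset.sum_pow_eq_sum_piAntidiag, derivative_pow] at h2
  simp only [derivative_add, derivative_mul, derivative_C, derivative_X, eval_mul, eval_pow,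
    eval_add, eval_C, eval_X] at h2
  simp only [zero_mul, add_zero, one_mul, zero_add, mul_zero, eval_zero, eval_one] at h2
  rw [Algebra.smul_def, map_natCast, ← mul_assoc, h2, derivative_sum, eval_finsetSum]
  refine Finset.sum_congr rfl fun α _ => ?_
  rw [symMonomial, monomialDeriv, monomialEval, smul_smul]
  simp only [mul_pow, Finset.prod_mul_distrib, ← map_pow, ← map_prod]
  rw [← C_eq_natCast, derivative_C_mul, derivative_mul, derivative_C, mul_zero, add_zero,
    coe_mapRingHom, derivative_map]
  simp only [eval_mul, eval_C, Algebra.smul_def, map_mul, map_natCast, eval_map_algebraMap]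
  rw [← map_zero (algebraMap 𝕜 (SymmetricAlgebra 𝕜 𝔤)), Polynomial.aeval_algebraMap_apply]
  simp
  ring

/-- The power rule for a derivation. For k = 0 the truncated exponent k - 1 is harmless, since the
factor k vanishes. -/
theorem symAd_pow (x y : 𝔤) (k : ℕ) : symAd 𝕜 x (SymmetricAlgebra.ι 𝕜 𝔤 y ^ k) =
    (k : 𝕜) • (SymmetricAlgebra.ι 𝕜 𝔤 y ^ (k - 1) * SymmetricAlgebra.ι 𝕜 𝔤 ⁅x, y⁆) := by
  induction k with
  | zero => simp [symAd]
  | succ k ih =>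
    rw [pow_succ, symAd_mul, ih, symAd_ι]
    rcases k with _ | k
    · simp
    · simp only [Nat.add_sub_cancel, Algebra.smul_def, map_natCast]
      push_cast
      ring

theorem symMonomial_mem (α : σ → ℕ) : symMonomial b α ∈ symPow 𝕜 𝔤 (∑ j, α j) := by
  refine Submodule.smul_mem _ _ ?_
  have : ∀ s : Finset σ, ∏ i ∈ s, SymmetricAlgebra.ι 𝕜 𝔤 (b i) ^ α i ∈ symPow 𝕜 𝔤 (∑ j ∈ s, α j) := by
    intro s
    induction s using Finset.induction_on with
    | empty => simp [symPow]
    | insert i s hi ih =>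
      rw [Finset.prod_insert hi, Finset.sum_insert hi, symPow, pow_add]
      exact Submodule.mul_mem_mul (Submodule.pow_mem_pow _ (LinearMap.mem_range_self _ _) _) ih
  exact this _

variable [CharZero 𝕜]

theorem multinomial_ne_zero (α : σ → ℕ) : (Nat.multinomial Finset.univ α : 𝕜) ≠ 0 :=
  Nat.cast_ne_zero.2 (Nat.multinomial_pos _ _).ne'

/-- The linear map on the symmetric algebra with prescribed values on the normalized monomials. -/
def symLift {M : Type*} [AddCommGroup M] [Module 𝕜 M] (g : (σ → ℕ) → M) :
    SymmetricAlgebra 𝕜 𝔤 →ₗ[𝕜] M :=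
  b.symmetricAlgebra.constr 𝕜 fun α => (Nat.multinomial Finset.univ ⇑α : 𝕜)⁻¹ • g α

theorem symLift_symMonomial {M : Type*} [AddCommGroup M] [Module 𝕜 M] (g : (σ → ℕ) → M)
    (α : σ → ℕ) : symLift b g (symMonomial b α) = g α := by
  have h : ∏ i, SymmetricAlgebra.ι 𝕜 𝔤 (b i) ^ α i =
      b.symmetricAlgebra (Finsupp.equivFunOnFinite.symm α) := by
    simp [Module.Basis.symmetricAlgebra, MvPolynomial.monomial_eq, Finsupp.prod_fintype]
  rw [symMonomial, h, map_smul, symLift, Module.Basis.constr_basis, smul_smul]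
  rw [Finsupp.coe_equivFunOnFinite_symm, mul_inv_cancel₀ (multinomial_ne_zero α), one_smul]

theorem symPow_le_span (k : ℕ) : symPow 𝕜 𝔤 k ≤
    Submodule.span 𝕜 (symMonomial b '' {α | ∑ j, α j = k}) := by
  intro a ha
  have key : ∀ α : σ → ℕ, ∏ i, SymmetricAlgebra.ι 𝕜 𝔤 (b i) ^ α i ∈
      Submodule.span 𝕜 (symMonomial b '' {β | ∑ j, β j = ∑ j, α j}) := by
    intro α
    have := Submodule.smul_mem _ (Nat.multinomial Finset.univ α : 𝕜)⁻¹
      (Submodule.subset_span (R := 𝕜) (s := symMonomial b '' {β | ∑ j, β j = ∑ j, α j})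
        ⟨α, rfl, rfl⟩)
    rwa [symMonomial, smul_smul, inv_mul_cancel₀ (multinomial_ne_zero α), one_smul] at this
  refine Submodule.pow_induction_on_left' (LinearMap.range (SymmetricAlgebra.ι 𝕜 𝔤))
    (C := fun n a _ => a ∈ Submodule.span 𝕜 (symMonomial b '' {α | ∑ j, α j = n}))
    (fun r => ?_) (fun x y i _ _ hx hy => add_mem hx hy) ?_ ha
  · have := Submodule.smul_mem _ r (key 0)
    simpa [Algebra.smul_def] using this
  · rintro _ ⟨x, rfl⟩ n a h ha
    clear h
    induction ha using Submodule.span_induction with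
    | zero => simp
    | add a b _ _ ha hb => rw [mul_add]; exact add_mem ha hb
    | smul c a _ ha => rw [mul_smul_comm]; exact Submodule.smul_mem _ c ha
    | mem a ha =>
      obtain ⟨α, rfl, rfl⟩ := ha
      rw [ι_eq_sum b, Finset.sum_mul]
      refine Submodule.sum_mem _ fun i _ => ?_
      rw [symMonomial, ← Algebra.smul_def, smul_mul_smul_comm]
      refine Submodule.smul_mem _ _ ?_
      have h := key (α + Pi.single i 1)
      have h1 : ∏ j, SymmetricAlgebra.ι 𝕜 𝔤 (b j) ^ (α + Pi.single i 1 : σ → ℕ) j =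
          SymmetricAlgebra.ι 𝕜 𝔤 (b i) * ∏ j, SymmetricAlgebra.ι 𝕜 𝔤 (b j) ^ α j := by
        simp only [Pi.add_apply, pow_add, Finset.prod_mul_distrib]
        rw [mul_comm, Finset.prod_eq_single_of_mem i (Finset.mem_univ i)
          (fun j _ hj => by simp [hj])]
        simp
      have h2 : ∑ j, (α + Pi.single i 1 : σ → ℕ) j = ∑ j, α j + 1 := by
        simp [Finset.sum_add_distrib]
      rwa [h1, h2] at h

include b in
/-- Polarization: the symmetric power `Sᵏ𝔤` is spanned by the powers `xᵏ`. -/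
theorem symPow_le_span_pow (k : ℕ) : symPow 𝕜 𝔤 k ≤
    Submodule.span 𝕜 (Set.range fun x : 𝔤 => SymmetricAlgebra.ι 𝕜 𝔤 x ^ k) := by
  refine (symPow_le_span b k).trans (Submodule.span_le.2 ?_)
  rintro _ ⟨α, hα, rfl⟩
  by_contra hmem
  obtain ⟨f, hf, hker⟩ := Submodule.exists_le_ker_of_notMem hmem
  -- A functional f that kills all powers makes ∑ f(m_β) t^β vanish at every point t. The field is
  -- infinite, so this polynomial is zero, and its coefficient at α contradicts f(m_α) ≠ 0.
  have hp : ∑ β ∈ Finset.piAntidiag Finset.univ k,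
      MvPolynomial.monomial (Finsupp.equivFunOnFinite.symm β) (f (symMonomial b β)) = 0 := by
    refine MvPolynomial.funext fun t => ?_
    have h1 : f (SymmetricAlgebra.ι 𝕜 𝔤 (∑ i, t i • b i) ^ k) = 0 :=
      hker (Submodule.subset_span ⟨_, rfl⟩)
    rw [ι_pow_eq_sum b, map_sum] at h1
    have h2 : ⇑(b.repr (∑ i, t i • b i)) = t := by
      ext i; simp [Finsupp.single_apply]
    rw [map_zero, ← h1, map_sum, h2]
    refine Finset.sum_congr rfl fun β _ => ?_
    rw [MvPolynomial.eval_monomial, Finsupp.prod_fintype _ _ (by simp), map_smul, smul_eq_mul,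
      mul_comm]
    rfl
  have hc := congrArg (MvPolynomial.coeff (Finsupp.equivFunOnFinite.symm α)) hp
  rw [MvPolynomial.coeff_sum, Finset.sum_eq_single_of_mem α (mem_piAntidiag_univ.2 hα)] at hc
  · exact hf (by simpa using hc)
  · intro β _ hβ
    simp [hβ]

variable [Module.Finite 𝕜 𝔤]

/-- Linear maps on a symmetric power which agree on all powers are equal. -/
theorem symPow_hom_ext {M : Type*} [AddCommGroup M] [Module 𝕜 M] {k : ℕ}
    {f g : symPow 𝕜 𝔤 k →ₗ[𝕜] M} (h : ∀ x : 𝔤, f (symPow.pow 𝕜 𝔤 x k) = g (symPow.pow 𝕜 𝔤 x k)) :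
    f = g := by
  have hle : symPow 𝕜 𝔤 k ≤ (LinearMap.eqLocus f g).map (symPow 𝕜 𝔤 k).subtype := by
    refine (symPow_le_span_pow (Module.finBasis 𝕜 𝔤) k).trans (Submodule.span_le.2 ?_)
    rintro _ ⟨x, rfl⟩
    exact ⟨symPow.pow 𝕜 𝔤 x k, h x, rfl⟩
  ext u
  obtain ⟨v, hv, hvu⟩ := hle u.2
  rwa [← Subtype.ext hvu]

end Sym

/-! ### Monomial generators of `𝓛(S⁺𝔤)` -/

open FreeGradedLie

namespace LSPlus

variable {𝕜 : Type*} [Field 𝕜] {𝔤 : Type*} [LieRing 𝔤] [LieAlgebra 𝕜 𝔤]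
  {σ : Type*} [Fintype σ] [DecidableEq σ] (b : Module.Basis σ 𝕜 𝔤)

/-- The generator given by a normalized monomial of positive weight (and zero in weight zero). -/
def monomial (α : σ → ℕ) : LSPlus 𝕜 𝔤 :=
  if h : 0 < ∑ j, α j then
    of 𝕜 (SPlus 𝕜 𝔤) SPlusDeg ⟨∑ j, α j, h⟩ ⟨symMonomial b α, symMonomial_mem b α⟩
  else 0

@[simp] theorem monomial_zero : monomial b 0 = 0 := by simp [monomial]

theorem of_eq_monomial {k : ℕ+} {α : σ → ℕ} (hα : ∑ j, α j = k) (u : symPow 𝕜 𝔤 k)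
    (hu : (u : SymmetricAlgebra 𝕜 𝔤) = symMonomial b α) :
    of 𝕜 (SPlus 𝕜 𝔤) SPlusDeg k u = monomial b α := by
  obtain ⟨k, hk⟩ := k
  obtain rfl : ∑ j, α j = k := hα
  rw [monomial, dif_pos hk]
  congr 1
  exact Subtype.ext hu

theorem of_eq_sum {k : ℕ+} (c : (σ → ℕ) → 𝕜) (u : symPow 𝕜 𝔤 k)
    (hu : (u : SymmetricAlgebra 𝕜 𝔤) =
      ∑ α ∈ Finset.piAntidiag Finset.univ (k : ℕ), c α • symMonomial b α) :
    of 𝕜 (SPlus 𝕜 𝔤) SPlusDeg k u =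
      ∑ α ∈ Finset.piAntidiag Finset.univ (k : ℕ), c α • monomial b α := by
  have hmem : ∀ α : Finset.piAntidiag (Finset.univ : Finset σ) (k : ℕ),
      symMonomial b α.1 ∈ symPow 𝕜 𝔤 k := fun α => by
    have h := symMonomial_mem b α.1
    rwa [mem_piAntidiag_univ.1 α.2] at h
  have hu' : u = ∑ α : Finset.piAntidiag (Finset.univ : Finset σ) (k : ℕ),
      c α.1 • (⟨symMonomial b α.1, hmem α⟩ : symPow 𝕜 𝔤 k) := by
    apply Subtype.ext
    rw [hu]
    exact (Finset.sum_coe_sort _ fun α => c α • symMonomial b α).symm.trans (by simp)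
  rw [hu', map_sum]
  refine Eq.trans ?_ (Finset.sum_coe_sort _ fun α => c α • monomial b α)
  refine Finset.sum_congr rfl fun α _ => ?_
  rw [map_smul, of_eq_monomial b (mem_piAntidiag_univ.1 α.2) _ rfl]

theorem I_eq_sum (x : 𝔤) (k : ℕ+) : I 𝕜 x k =
    ∑ α ∈ Finset.piAntidiag Finset.univ (k : ℕ), monomialEval (b.repr x) α • monomial b α :=
  of_eq_sum b _ _ (ι_pow_eq_sum b x k)

theorem act_I_eq_sum (x y : 𝔤) (k : ℕ+) : act 𝕜 x (I 𝕜 y k) =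
    ∑ α ∈ Finset.piAntidiag Finset.univ (k : ℕ),
      monomialDeriv (b.repr y) (b.repr ⁅x, y⁆) α • monomial b α := by
  rw [act, I, derivation_of]
  refine of_eq_sum b _ _ ?_
  rw [← ι_pow_mul_eq_sum, ← symAd_pow]
  rfl

theorem odd_deg (k : ℕ+) : Odd (SPlusDeg k) := ⟨-k, by simp [SPlusDeg]; ring⟩

theorem I_mem_component (x : 𝔤) (k : ℕ+) : I 𝕜 x k ∈ component 𝕜 𝔤 (SPlusDeg k) :=
  of_mem_component k _

theorem monomial_mem_component (α : σ → ℕ) :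
    monomial b α ∈ component 𝕜 𝔤 (1 - 2 * (∑ j, α j : ℕ)) := by
  rw [monomial]
  split_ifs with h
  · exact of_mem_component (deg := SPlusDeg) (⟨_, h⟩ : ℕ+) _
  · exact zero_mem _

theorem act_mem_component (x : 𝔤) {p : ℤ} {a : LSPlus 𝕜 𝔤} (ha : a ∈ component 𝕜 𝔤 p) :
    act 𝕜 x a ∈ component 𝕜 𝔤 p := derivation_mem_component _ ha

theorem act_lie (x : 𝔤) (a c : LSPlus 𝕜 𝔤) : act 𝕜 x ⁅a, c⁆ = ⁅act 𝕜 x a, c⁆ + ⁅a, act 𝕜 x c⁆ :=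
  derivation_lie 𝕜 _ _ a c

variable [CharZero 𝕜]

/-- The linear map on `Sᵏ𝔤` with prescribed values on the normalized monomials. -/
def symPowLift {M : Type*} [AddCommGroup M] [Module 𝕜 M] (g : (σ → ℕ) → M) (k : ℕ) :
    symPow 𝕜 𝔤 k →ₗ[𝕜] M := symLift b g ∘ₗ (symPow 𝕜 𝔤 k).subtype

section

variable {M : Type*} [AddCommGroup M] [Module 𝕜 M] (g : (σ → ℕ) → M)

theorem symPowLift_pow (x : 𝔤) (k : ℕ) : symPowLift b g k (symPow.pow 𝕜 𝔤 x k) =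
    ∑ α ∈ Finset.piAntidiag Finset.univ k, monomialEval (b.repr x) α • g α := by
  change symLift b g (SymmetricAlgebra.ι 𝕜 𝔤 x ^ k) = _
  rw [ι_pow_eq_sum b, map_sum]
  simp only [map_smul, symLift_symMonomial]

theorem symPowLift_ad_pow (x y : 𝔤) (k : ℕ) :
    symPowLift b g k (symPowAd 𝕜 x k (symPow.pow 𝕜 𝔤 y k)) =
    ∑ α ∈ Finset.piAntidiag Finset.univ k,
      monomialDeriv (b.repr y) (b.repr ⁅x, y⁆) α • g α := by
  change symLift b g (symAd 𝕜 x (SymmetricAlgebra.ι 𝕜 𝔤 y ^ k)) = _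
  rw [symAd_pow, ι_pow_mul_eq_sum b, map_sum]
  simp only [map_smul, symLift_symMonomial]

theorem symPowLift_symMonomial {k : ℕ} {α : σ → ℕ} (u : symPow 𝕜 𝔤 k)
    (hu : (u : SymmetricAlgebra 𝕜 𝔤) = symMonomial b α) : symPowLift b g k u = g α := by
  change symLift b g (u : SymmetricAlgebra 𝕜 𝔤) = _
  rw [hu, symLift_symMonomial]

end

variable [Module.Finite 𝕜 𝔤]

/-- A subspace which contains the elements `𝓘(xᵏ)` and is closed under the bracket is everything. -/
theorem mem_of_I_mem (N : Submodule 𝕜 (LSPlus 𝕜 𝔤)) (hI : ∀ x k, I 𝕜 x k ∈ N)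
    (hlie : ∀ p, ∀ a ∈ component 𝕜 𝔤 p, ∀ q, ∀ c ∈ component 𝕜 𝔤 q,
      a ∈ N → c ∈ N → ⁅a, c⁆ ∈ N) (a : LSPlus 𝕜 𝔤) : a ∈ N := by
  refine mem_of_lie_closed N (fun k u => ?_) hlie a
  have h : N.mkQ ∘ₗ of 𝕜 (SPlus 𝕜 𝔤) SPlusDeg k = 0 :=
    symPow_hom_ext fun x => (Submodule.Quotient.mk_eq_zero _).2 (hI x k)
  exact (Submodule.Quotient.mk_eq_zero _).1 (LinearMap.congr_fun h u)

/-- Linear maps agree if they agree on the elements `𝓘(xᵏ)` and their agreement passes to brackets. -/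
theorem hom_ext {M : Type*} [AddCommGroup M] [Module 𝕜 M] {f g : LSPlus 𝕜 𝔤 →ₗ[𝕜] M}
    (hI : ∀ x k, f (I 𝕜 x k) = g (I 𝕜 x k))
    (hlie : ∀ p, ∀ a ∈ component 𝕜 𝔤 p, ∀ q, ∀ c ∈ component 𝕜 𝔤 q,
      f a = g a → f c = g c → f ⁅a, c⁆ = g ⁅a, c⁆) : f = g := by
  ext a
  exact mem_of_I_mem (LinearMap.eqLocus f g) hI hlie a

/-! ### The differential -/

/-- The differential on generators. -/
def diffGen (k : ℕ+) : SPlus 𝕜 𝔤 k →ₗ[𝕜] LSPlus 𝕜 𝔤 :=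
  symPowLift b (fun α => (1 / 2 : 𝕜) • ∑ β ∈ Finset.Ioo 0 α, ⁅monomial b β, monomial b (α - β)⁆) k

/-- The multinomial normalization pays off: t^α = t^β t^(α-β) distributes over the splittings of α
with no binomial coefficients. The formula obtained no longer involves the basis. -/
theorem diffGen_pow (x : 𝔤) (k : ℕ+) : diffGen b k (symPow.pow 𝕜 𝔤 x k) =
    (1 / 2 : 𝕜) • ∑ s ∈ Finset.Iio k, ⁅I 𝕜 x s, I 𝕜 x (k - s)⁆ := by
  rw [diffGen, symPowLift_pow]
  simp only [smul_comm _ (1 / 2 : 𝕜), ← Finset.smul_sum]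
  congr 1
  trans ∑ α ∈ Finset.piAntidiag Finset.univ (k : ℕ), ∑ β ∈ Finset.Ioo 0 α,
    (monomialEval (b.repr x) β * monomialEval (b.repr x) (α - β)) •
      ⁅monomial b β, monomial b (α - β)⁆
  · refine Finset.sum_congr rfl fun α _ => ?_
    rw [Finset.smul_sum]
    refine Finset.sum_congr rfl fun β hβ => ?_
    rw [← monomialEval_mul _ (Finset.mem_Ioo.1 hβ).2.le]
  · rw [sum_Ioo_eq_sum_Iio k fun β γ => (monomialEval (b.repr x) β * monomialEval (b.repr x) γ) •
      ⁅monomial b β, monomial b γ⁆]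
    refine Finset.sum_congr rfl fun s _ => ?_
    rw [I_eq_sum b, I_eq_sum b, FreeGradedLie.sum_lie]
    refine Finset.sum_congr rfl fun β _ => ?_
    rw [FreeGradedLie.lie_sum]
    refine Finset.sum_congr rfl fun γ _ => ?_
    rw [FreeGradedLie.smul_lie, FreeGradedLie.lie_smul, smul_smul]

/-- By polarization it suffices to treat yᵏ. There ad x differentiates the coordinates of y in the
direction [x, y], and the product rule for t^β t^(α-β) matches the Leibniz rule for the action on
brackets. -/
theorem diffGen_ad (x : 𝔤) (k : ℕ+) (u : SPlus 𝕜 𝔤 k) :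
    diffGen b k (symPowAd 𝕜 x k u) = act 𝕜 x (diffGen b k u) := by
  refine LinearMap.congr_fun (symPow_hom_ext (f := diffGen b k ∘ₗ symPowAd 𝕜 x k)
    (g := act 𝕜 x ∘ₗ diffGen b k) fun y => ?_) u
  simp only [LinearMap.coe_comp, Function.comp_apply]
  rw [diffGen_pow, diffGen, symPowLift_ad_pow, map_smul, map_sum]
  simp only [smul_comm _ (1 / 2 : 𝕜), ← Finset.smul_sum]
  congr 1
  set t : σ → 𝕜 := ⇑(b.repr y)
  set w : σ → 𝕜 := ⇑(b.repr ⁅x, y⁆)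
  trans ∑ α ∈ Finset.piAntidiag Finset.univ (k : ℕ), ∑ β ∈ Finset.Ioo 0 α,
    (monomialDeriv t w β * monomialEval t (α - β) + monomialEval t β * monomialDeriv t w (α - β)) •
      ⁅monomial b β, monomial b (α - β)⁆
  · refine Finset.sum_congr rfl fun α _ => ?_
    rw [Finset.smul_sum]
    refine Finset.sum_congr rfl fun β hβ => ?_
    rw [← monomialDeriv_mul _ _ (Finset.mem_Ioo.1 hβ).2.le]
  · rw [sum_Ioo_eq_sum_Iio k fun β γ =>
      (monomialDeriv t w β * monomialEval t γ + monomialEval t β * monomialDeriv t w γ) •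
      ⁅monomial b β, monomial b γ⁆]
    refine Finset.sum_congr rfl fun s _ => ?_
    rw [act_lie, act_I_eq_sum b, act_I_eq_sum b, I_eq_sum b, I_eq_sum b, FreeGradedLie.sum_lie, FreeGradedLie.sum_lie,
      ← Finset.sum_add_distrib]
    refine Finset.sum_congr rfl fun β _ => ?_
    rw [FreeGradedLie.lie_sum, FreeGradedLie.lie_sum, ← Finset.sum_add_distrib]
    refine Finset.sum_congr rfl fun γ _ => ?_
    simp only [FreeGradedLie.smul_lie, FreeGradedLie.lie_smul, smul_smul, add_smul]
    rw [mul_comm (monomialDeriv t w β), mul_comm (monomialEval t β)]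

theorem diffGen_mem (k : ℕ+) (u : SPlus 𝕜 𝔤 k) :
    diffGen b k u ∈ component 𝕜 𝔤 (SPlusDeg k + 1) := by
  -- Membership becomes the vanishing of a linear map into the quotient, so it need only be tested
  -- on powers.
  have h : (component 𝕜 𝔤 (SPlusDeg k + 1)).mkQ ∘ₗ diffGen b k = 0 := by
    refine symPow_hom_ext fun x => (Submodule.Quotient.mk_eq_zero _).2 ?_
    rw [diffGen_pow]
    refine Submodule.smul_mem _ _ (Submodule.sum_mem _ fun s hs => ?_)
    have hmem := lie_mem_component (I_mem_component (𝕜 := 𝕜) x s)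
      (I_mem_component (𝕜 := 𝕜) x (k - s))
    have hk : ((k - s : ℕ+) : ℤ) = k - s := by
      have := PNat.sub_coe k s
      rw [if_pos (Finset.mem_Iio.1 hs)] at this
      have hlt : (s : ℕ) < k := PNat.coe_lt_coe _ _ |>.2 (Finset.mem_Iio.1 hs)
      omega
    have hdeg : SPlusDeg s + SPlusDeg (k - s) = SPlusDeg k + 1 := by
      rw [SPlusDeg, SPlusDeg, SPlusDeg, hk]; ring
    rwa [hdeg] at hmem
  exact (Submodule.Quotient.mk_eq_zero _).1 (LinearMap.congr_fun h u)

/-- The differential of `𝓛(S⁺𝔤)`. -/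
def diff : LSPlus 𝕜 𝔤 →ₗ[𝕜] LSPlus 𝕜 𝔤 :=
  oddDerivation (bracket 𝕜 (SPlus 𝕜 𝔤) SPlusDeg) (diffGen b)

theorem diff_isDegreeOneDerivation : IsDegreeOneDerivation (component 𝕜 𝔤) (diff b) :=
  oddDerivation_bracket_isDegreeOneDerivation _ (diffGen_mem b)

theorem diff_mem {p : ℤ} {a : LSPlus 𝕜 𝔤} (ha : a ∈ component 𝕜 𝔤 p) :
    diff b a ∈ component 𝕜 𝔤 (p + 1) := (diff_isDegreeOneDerivation b).map_mem p a ha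

theorem diff_lie {p : ℤ} {a : LSPlus 𝕜 𝔤} (ha : a ∈ component 𝕜 𝔤 p) (c : LSPlus 𝕜 𝔤) :
    diff b ⁅a, c⁆ = ⁅diff b a, c⁆ + koszulSign 𝕜 p • ⁅a, diff b c⁆ := by
  rw [(diff_isDegreeOneDerivation b).leibniz p a ha, negOnePow_smul (𝕜 := 𝕜)]

theorem diff_I (x : 𝔤) (k : ℕ+) : diff b (I 𝕜 x k) =
    (1 / 2 : 𝕜) • ∑ s ∈ Finset.Iio k, ⁅I 𝕜 x s, I 𝕜 x (k - s)⁆ := by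
  rw [← diffGen_pow b]
  exact oddDerivation_of _ _ _

theorem diff_isLSPlusDifferential : IsLSPlusDifferential 𝕜 𝔤 (diff b) :=
  ⟨diff_isDegreeOneDerivation b, diff_I b⟩

theorem isLSPlusDifferential_unique {d d' : LSPlus 𝕜 𝔤 →ₗ[𝕜] LSPlus 𝕜 𝔤}
    (h : IsLSPlusDifferential 𝕜 𝔤 d) (h' : IsLSPlusDifferential 𝕜 𝔤 d') : d = d' := by
  refine hom_ext (fun x k => by rw [h.map_I, h'.map_I]) fun p a ha q c hc h1 h2 => ?_
  rw [h.derivation.leibniz p a ha, h'.derivation.leibniz p a ha, h1, h2]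

/-! ### Weights -/

variable (𝕜 𝔤) in
/-- The derivation which multiplies `𝓘(xᵏ)` by `k`. -/
def weight : LSPlus 𝕜 𝔤 →ₗ[𝕜] LSPlus 𝕜 𝔤 := euler 𝕜 (SPlus 𝕜 𝔤) SPlusDeg fun k => ((k : ℕ) : 𝕜)

theorem weight_of (k : ℕ+) (u : SPlus 𝕜 𝔤 k) : weight 𝕜 𝔤 (of 𝕜 (SPlus 𝕜 𝔤) SPlusDeg k u) =
    ((k : ℕ) : 𝕜) • of 𝕜 (SPlus 𝕜 𝔤) SPlusDeg k u := euler_of _ _ _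

theorem weight_I (x : 𝔤) (k : ℕ+) : weight 𝕜 𝔤 (I 𝕜 x k) = ((k : ℕ) : 𝕜) • I 𝕜 x k := weight_of _ _

theorem weight_lie (a c : LSPlus 𝕜 𝔤) :
    weight 𝕜 𝔤 ⁅a, c⁆ = ⁅weight 𝕜 𝔤 a, c⁆ + ⁅a, weight 𝕜 𝔤 c⁆ := euler_lie _ _ _

theorem weight_monomial (α : σ → ℕ) :
    weight 𝕜 𝔤 (monomial b α) = ((∑ j, α j : ℕ) : 𝕜) • monomial b α := by
  rw [monomial]
  split_ifs with h
  · exact weight_of ⟨_, h⟩ _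
  · simp

theorem weight_mem_component {p : ℤ} {a : LSPlus 𝕜 𝔤} (ha : a ∈ component 𝕜 𝔤 p) :
    weight 𝕜 𝔤 a ∈ component 𝕜 𝔤 p := derivation_mem_component _ ha

variable (𝕜 𝔤) in
/-- The part of weight `k` of `𝓛(S⁺𝔤)`. -/
def weightSpace (k : ℕ) : Submodule 𝕜 (LSPlus 𝕜 𝔤) :=
  Module.End.eigenspace (weight 𝕜 𝔤) (k : 𝕜)

theorem mem_weightSpace {k : ℕ} {a : LSPlus 𝕜 𝔤} :
    a ∈ weightSpace 𝕜 𝔤 k ↔ weight 𝕜 𝔤 a = (k : 𝕜) • a := Module.End.mem_eigenspace_iff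

theorem iSupIndep_weightSpace : iSupIndep (weightSpace 𝕜 𝔤) :=
  (Module.End.eigenspaces_iSupIndep (weight 𝕜 𝔤)).comp Nat.cast_injective

theorem iSup_pos_weightSpace : ⨆ (k : ℕ) (_ : k ≠ 0), weightSpace 𝕜 𝔤 k = ⊤ := by
  refine eq_top_iff.2 fun a _ => mem_of_I_mem _ (fun x k => ?_) (fun p a _ q c _ ha hc => ?_) a
  · exact Submodule.mem_iSup_of_mem (k : ℕ)
      (Submodule.mem_iSup_of_mem k.ne_zero (mem_weightSpace.2 (weight_I x k)))
  · set N := ⨆ (k : ℕ) (_ : k ≠ 0), weightSpace 𝕜 𝔤 k with hN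
    have h : ∀ k : ℕ, k ≠ 0 → ∀ a ∈ weightSpace 𝕜 𝔤 k,
        N ≤ N.comap (bracket 𝕜 (SPlus 𝕜 𝔤) SPlusDeg a) := fun k hk a ha =>
      iSup₂_le fun l hl c hc => Submodule.mem_iSup_of_mem (k + l) (Submodule.mem_iSup_of_mem (by omega) (by
        have := lie_mem_eigenspace_euler _ ha hc
        rwa [← Nat.cast_add] at this))
    have h' : N ≤ N.comap ((bracket 𝕜 (SPlus 𝕜 𝔤) SPlusDeg).flip c) :=
      iSup₂_le fun k hk a ha => h k hk a ha hc
    exact h' ha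

theorem iSup_weightSpace : ⨆ k, weightSpace 𝕜 𝔤 k = ⊤ :=
  eq_top_iff.2 (iSup_pos_weightSpace.symm.le.trans (iSup_mono fun _ => iSup_le fun _ => le_rfl))

/-- Generators have positive weight, so the positive weight spaces already span, and weight zero is
independent of them. Hence the weight derivation is injective. -/
theorem weightSpace_zero : weightSpace 𝕜 𝔤 0 = ⊥ := by
  have h := iSupIndep_weightSpace (𝕜 := 𝕜) (𝔤 := 𝔤) 0
  rwa [iSup_pos_weightSpace, disjoint_top] at h

theorem weight_injective : Function.Injective (weight 𝕜 𝔤) := by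
  rw [← LinearMap.ker_eq_bot, ← Module.End.eigenspace_zero, ← weightSpace_zero, weightSpace,
    Nat.cast_zero]

theorem weight_diff (a : LSPlus 𝕜 𝔤) : weight 𝕜 𝔤 (diff b a) = diff b (weight 𝕜 𝔤 a) := by
  refine LinearMap.congr_fun (hom_ext (f := weight 𝕜 𝔤 ∘ₗ diff b) (g := diff b ∘ₗ weight 𝕜 𝔤)
    (fun y k => ?_) fun p a ha q c hc h1 h2 => ?_) a
  · simp only [LinearMap.coe_comp, Function.comp_apply]
    rw [weight_I, map_smul, diff_I, map_smul, smul_comm ((k : ℕ) : 𝕜), map_sum]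
    congr 1
    rw [Finset.smul_sum]
    refine Finset.sum_congr rfl fun s hs => ?_
    have hk : ((k - s : ℕ+) : ℕ) + s = k := by
      have := PNat.sub_coe k s
      rw [if_pos (Finset.mem_Iio.1 hs)] at this
      have hlt : (s : ℕ) < k := PNat.coe_lt_coe _ _ |>.2 (Finset.mem_Iio.1 hs)
      omega
    rw [weight_lie, weight_I, weight_I, FreeGradedLie.smul_lie, FreeGradedLie.lie_smul, ← add_smul, ← hk, Nat.cast_add, add_comm]
  · simp only [LinearMap.coe_comp, Function.comp_apply] at *
    rw [weight_lie, map_add, diff_lie b (weight_mem_component ha), diff_lie b ha, diff_lie b ha,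
      ← h1, ← h2, map_add, map_smul, weight_lie, weight_lie, smul_add]
    abel

theorem diff_mem_weightSpace {k : ℕ} {a : LSPlus 𝕜 𝔤} (ha : a ∈ weightSpace 𝕜 𝔤 k) :
    diff b a ∈ weightSpace 𝕜 𝔤 k := by
  rw [mem_weightSpace] at *
  rw [weight_diff, ha, map_smul]

end LSPlus

theorem Cobar.mul_mem_supported {𝕜 : Type*} [Field 𝕜] {σ : Type*} [Fintype σ] [DecidableEq σ]
    {F : Finset σ} {x y : FreeAlgebra 𝕜 (σ → ℕ)}
    (hx : x ∈ Cobar.supported 𝕜 F) (hy : y ∈ Cobar.supported 𝕜 F) :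
    x * y ∈ Cobar.supported 𝕜 F := by
  induction hx using Submodule.span_induction with
  | zero => simp
  | add a b _ _ ha hb => rw [add_mul]; exact add_mem ha hb
  | smul c a _ ha => rw [smul_mul_assoc]; exact Submodule.smul_mem _ c ha
  | mem a ha =>
    obtain ⟨l, hl, rfl⟩ := ha
    induction l with
    | nil => simpa using hy
    | cons α l ih =>
      have hα := hl α List.mem_cons_self
      rw [Cobar.word_cons, mul_assoc]
      exact Cobar.ι_mul_mem_supported hα.1 hα.2 (ih hl.tail)

/-! ### Comparison of `𝓛(S⁺𝔤)` with the cobar complex -/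

namespace LSPlus

variable {𝕜 : Type*} [Field 𝕜] {𝔤 : Type*} [LieRing 𝔤] [LieAlgebra 𝕜 𝔤]
  {σ : Type*} [Fintype σ] [DecidableEq σ] (b : Module.Basis σ 𝕜 𝔤) [CharZero 𝕜]

/-- The homomorphism from `𝓛(S⁺𝔤)` to its enveloping algebra, the cobar complex. -/
def toCobar : LSPlus 𝕜 𝔤 →ₗ[𝕜] FreeAlgebra 𝕜 (σ → ℕ) :=
  lift 𝕜 SPlusDeg fun k => symPowLift b (FreeAlgebra.ι 𝕜) k

theorem toCobar_I (x : 𝔤) (k : ℕ+) : toCobar b (I 𝕜 x k) =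
    ∑ α ∈ Finset.piAntidiag Finset.univ (k : ℕ),
      monomialEval (b.repr x) α • FreeAlgebra.ι 𝕜 α := by
  rw [toCobar, I, lift_of, symPowLift_pow]

theorem toCobar_monomial {α : σ → ℕ} (hα : α ≠ 0) :
    toCobar b (monomial b α) = FreeAlgebra.ι 𝕜 α := by
  rw [monomial, dif_pos (Cobar.sum_pos_of_ne_zero hα)]
  exact (lift_of 𝕜 SPlusDeg (fun k => symPowLift b (FreeAlgebra.ι 𝕜) k)
    (⟨_, Cobar.sum_pos_of_ne_zero hα⟩ : ℕ+) _).trans (symPowLift_symMonomial b _ _ rfl)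

theorem toCobar_lie {p q : ℤ} {a c : LSPlus 𝕜 𝔤} (ha : a ∈ component 𝕜 𝔤 p)
    (hc : c ∈ component 𝕜 𝔤 q) : toCobar b ⁅a, c⁆ =
      toCobar b a * toCobar b c - koszulSign 𝕜 (p * q) • (toCobar b c * toCobar b a) :=
  lift_lie _ ha hc

/-- The augmentation of the cobar complex. -/
def aug : FreeAlgebra 𝕜 (σ → ℕ) →ₐ[𝕜] 𝕜 := FreeAlgebra.algebraMapInv

theorem aug_ι (α : σ → ℕ) : aug (FreeAlgebra.ι 𝕜 α) = 0 := by
  simp [aug, FreeAlgebra.algebraMapInv]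

theorem aug_d (a : FreeAlgebra 𝕜 (σ → ℕ)) : aug (Cobar.d 𝕜 a) = 0 := by
  have h : aug.toLinearMap ∘ₗ Cobar.d 𝕜 = (0 : FreeAlgebra 𝕜 (σ → ℕ) →ₗ[𝕜] 𝕜) := by
    refine Cobar.hom_ext_word ?_ fun α a _ => ?_
    · simp
    · simp [Cobar.d_ι_mul, Cobar.split, aug_ι]
  exact LinearMap.congr_fun h a

/-- The action of the cobar complex on `𝓛(S⁺𝔤)` by iterated brackets. -/
def cobarAct : FreeAlgebra 𝕜 (σ → ℕ) →ₐ[𝕜] Module.End 𝕜 (LSPlus 𝕜 𝔤) :=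
  FreeAlgebra.lift 𝕜 fun α => bracket 𝕜 (SPlus 𝕜 𝔤) SPlusDeg (monomial b α)

theorem cobarAct_ι (α : σ → ℕ) (y : LSPlus 𝕜 𝔤) :
    cobarAct b (FreeAlgebra.ι 𝕜 α) y = ⁅monomial b α, y⁆ := by
  simp [cobarAct]

/-- The weighted Dynkin map, on words. -/
def dynkinWord : List (σ → ℕ) → LSPlus 𝕜 𝔤
  | [] => 0
  | α :: l => ⁅monomial b α, dynkinWord l⁆ +
      aug (Cobar.word 𝕜 l) • ((∑ j, α j : ℕ) : 𝕜) • monomial b α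

/-- The weighted Dynkin map from the cobar complex to `𝓛(S⁺𝔤)`. -/
def dynkin : FreeAlgebra 𝕜 (σ → ℕ) →ₗ[𝕜] LSPlus 𝕜 𝔤 := Cobar.wordLift 𝕜 (dynkinWord b)

@[simp] theorem dynkin_one : dynkin b 1 = 0 := Cobar.wordLift_word 𝕜 (dynkinWord b) []

theorem dynkin_ι_mul (α : σ → ℕ) (a : FreeAlgebra 𝕜 (σ → ℕ)) :
    dynkin b (FreeAlgebra.ι 𝕜 α * a) =
      ⁅monomial b α, dynkin b a⁆ + aug a • ((∑ j, α j : ℕ) : 𝕜) • monomial b α := by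
  induction a using Cobar.induction_word with
  | zero => simp
  | add a c ha hc =>
    simp only [mul_add, map_add, ha, hc, FreeGradedLie.lie_add, add_smul]; abel
  | smul c a ha =>
    simp only [mul_smul_comm, map_smul, ha, FreeGradedLie.lie_smul, smul_add, smul_assoc]
  | word l => rw [← Cobar.word_cons, dynkin, Cobar.wordLift_word, Cobar.wordLift_word]; rfl

/-- The Dynkin map brackets to the right, so a left factor acts by iterated brackets, except when
the right factor contributes a constant term. -/
theorem dynkin_mul (a c : FreeAlgebra 𝕜 (σ → ℕ)) :
    dynkin b (a * c) = cobarAct b a (dynkin b c) + aug c • dynkin b a := by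
  refine LinearMap.congr_fun (Cobar.hom_ext_word (f := dynkin b ∘ₗ LinearMap.mulRight 𝕜 c)
    (g := LinearMap.applyₗ (dynkin b c) ∘ₗ (cobarAct b).toLinearMap + aug c • dynkin b)
    ?_ fun α a ha => ?_) a
  · simp
  · simp only [LinearMap.coe_comp, Function.comp_apply, LinearMap.mulRight_apply,
      LinearMap.add_apply, AlgHom.toLinearMap_apply, LinearMap.applyₗ_apply_apply,
      LinearMap.smul_apply] at ha ⊢
    rw [mul_assoc, dynkin_ι_mul, ha, dynkin_ι_mul, map_mul, map_mul, Module.End.mul_apply,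
      cobarAct_ι, FreeGradedLie.lie_add, FreeGradedLie.lie_smul, smul_add, smul_smul (aug c),
      mul_comm (aug c)]
    abel

variable [Module.Finite 𝕜 𝔤]

theorem toCobar_mem_supported (a : LSPlus 𝕜 𝔤) :
    toCobar b a ∈ Cobar.supported 𝕜 Finset.univ := by
  refine mem_of_I_mem ((Cobar.supported 𝕜 Finset.univ).comap (toCobar b)) (fun x k => ?_)
    (fun p a ha q c hc h1 h2 => ?_) a
  · rw [Submodule.mem_comap, toCobar_I]
    refine Submodule.sum_mem _ fun α hα => Submodule.smul_mem _ _ ?_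
    have h0 : α ≠ 0 := by
      rintro rfl
      have := mem_piAntidiag_univ.1 hα
      simp at this
      exact k.ne_zero this.symm
    refine Submodule.subset_span ⟨[α], fun β hβ => ?_, by simp⟩
    rw [List.mem_singleton.1 hβ]
    exact ⟨h0, fun j _ => Finset.mem_univ j⟩
  · rw [Submodule.mem_comap] at *
    rw [toCobar_lie b ha hc]
    exact sub_mem (Cobar.mul_mem_supported h1 h2)
      (Submodule.smul_mem _ _ (Cobar.mul_mem_supported h2 h1))

theorem aug_toCobar (a : LSPlus 𝕜 𝔤) : aug (toCobar b a) = 0 := by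
  refine LinearMap.congr_fun (hom_ext (f := aug.toLinearMap ∘ₗ toCobar b) (g := 0)
    (fun x k => ?_) fun p a ha q c hc h1 h2 => ?_) a
  · simp [toCobar_I, aug_ι]
  · simp only [LinearMap.coe_comp, Function.comp_apply, AlgHom.toLinearMap_apply,
      LinearMap.zero_apply] at *
    simp [toCobar_lie b ha hc, h1, h2]

theorem sgn_toCobar {p : ℤ} {a : LSPlus 𝕜 𝔤} (ha : a ∈ component 𝕜 𝔤 p) :
    Cobar.sgn 𝕜 (toCobar b a) = koszulSign 𝕜 p • toCobar b a := by
  have key : ∀ k (u : SPlus 𝕜 𝔤 k),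
      Cobar.sgn 𝕜 (symPowLift b (FreeAlgebra.ι 𝕜) k u) = -symPowLift b (FreeAlgebra.ι 𝕜) k u := by
    intro k u
    refine LinearMap.congr_fun (symPow_hom_ext
      (f := (Cobar.sgn 𝕜).toLinearMap ∘ₗ symPowLift b (FreeAlgebra.ι 𝕜) k)
      (g := -symPowLift b (FreeAlgebra.ι 𝕜) k) fun x => ?_) u
    simp [symPowLift_pow]
  induction ha using component_induction with
  | zero => simp
  | add a b _ _ ha hb => rw [map_add, map_add, ha, hb, smul_add]
  | smul c a _ ha => rw [map_smul, map_smul, ha, smul_comm]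
  | word m hm =>
    subst hm
    induction m using FreeMagma.rec with
    | of x =>
      rw [word_of, wordDegree, koszulSign_odd (odd_deg _), toCobar, lift_of, key, neg_smul, one_smul]
    | mul m n hm hn =>
      rw [word_mul, toCobar_lie b (word_mem_component m) (word_mem_component n), map_sub, map_smul,
        map_mul, map_mul, hm, hn, wordDegree, koszulSign_add]
      simp only [smul_mul_assoc, mul_smul_comm, smul_sub, smul_smul]
      congr 2 <;> ring

/-- The Jacobi identity says that the adjoint action turns brackets into graded commutators, so
agreement on generators suffices. -/
theorem cobarAct_toCobar (a y : LSPlus 𝕜 𝔤) : cobarAct b (toCobar b a) y = ⁅a, y⁆ := by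
  have h : (cobarAct b).toLinearMap ∘ₗ toCobar b = bracket 𝕜 (SPlus 𝕜 𝔤) SPlusDeg := by
    refine hom_ext (fun x k => ?_) fun p a ha q c hc h1 h2 => ?_
    · ext y
      simp only [LinearMap.coe_comp, Function.comp_apply, AlgHom.toLinearMap_apply, bracket_apply]
      rw [toCobar_I, map_sum, LinearMap.sum_apply, I_eq_sum b, FreeGradedLie.sum_lie]
      simp only [map_smul, LinearMap.smul_apply, cobarAct_ι, FreeGradedLie.smul_lie]
    · ext y
      simp only [LinearMap.coe_comp, Function.comp_apply, AlgHom.toLinearMap_apply,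
        bracket_apply] at *
      rw [toCobar_lie b ha hc, map_sub, map_smul, map_mul, map_mul, h1, h2, lie_jacobi ha hc y |>
        eq_sub_of_add_eq ∘ Eq.symm]
      rfl
  exact LinearMap.congr_fun (LinearMap.congr_fun h a) y

/-- A weighted Dynkin–Specht–Wever theorem. On a bracket the two orderings give [a, w c] ∓ [c, w a],
which is [a, w c] + [w a, c] by antisymmetry. -/
theorem dynkin_toCobar (a : LSPlus 𝕜 𝔤) : dynkin b (toCobar b a) = weight 𝕜 𝔤 a := by
  refine LinearMap.congr_fun (hom_ext (f := dynkin b ∘ₗ toCobar b) (g := weight 𝕜 𝔤)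
    (fun x k => ?_) fun p a ha q c hc h1 h2 => ?_) a
  · simp only [LinearMap.coe_comp, Function.comp_apply]
    rw [toCobar_I, map_sum, weight_I, I_eq_sum b, Finset.smul_sum]
    refine Finset.sum_congr rfl fun α hα => ?_
    have h := dynkin_ι_mul b α 1
    rw [mul_one, dynkin_one, FreeGradedLie.lie_zero, map_one, one_smul, zero_add,
      mem_piAntidiag_univ.1 hα] at h
    rw [map_smul, h, smul_comm]
  · simp only [LinearMap.coe_comp, Function.comp_apply] at *
    rw [toCobar_lie b ha hc, map_sub, map_smul, dynkin_mul, dynkin_mul, cobarAct_toCobar,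
      cobarAct_toCobar, aug_toCobar, aug_toCobar, h1, h2, weight_lie,
      lie_antisymm (weight_mem_component ha) hc]
    simp only [zero_smul, add_zero]
    abel

theorem toCobar_injective : Function.Injective (toCobar b) := fun x y h =>
  weight_injective (by rw [← dynkin_toCobar b, h, dynkin_toCobar])

theorem sum_Iio_reflect {M : Type*} [AddCommMonoid M] (k : ℕ+) (f : ℕ+ → ℕ+ → M) :
    ∑ s ∈ Finset.Iio k, f s (k - s) = ∑ s ∈ Finset.Iio k, f (k - s) s := by
  have hk : ∀ {s}, s ∈ Finset.Iio k → k - s ∈ Finset.Iio k ∧ k - (k - s) = s := by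
    intro s hs
    have hlt := Finset.mem_Iio.1 hs
    have h1 : ((k - s : ℕ+) : ℕ) = k - s := by rw [PNat.sub_coe, if_pos hlt]
    have h2 : (s : ℕ) < k := hlt
    have h0 := s.pos
    have h3 : k - s < k := by rw [← PNat.coe_lt_coe, h1]; omega
    refine ⟨Finset.mem_Iio.2 h3, PNat.eq ?_⟩
    rw [PNat.sub_coe, if_pos h3, h1]
    omega
  refine Finset.sum_bij' (fun s _ => k - s) (fun s _ => k - s) (fun s hs => (hk hs).1)
    (fun s hs => (hk hs).1) (fun s hs => (hk hs).2) (fun s hs => (hk hs).2) fun s hs => ?_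
  rw [(hk hs).2]

/-- Both composites obey the same Leibniz rule, so only 𝓘(xᵏ) needs checking. There the two terms of
each anticommutator have the same sum after s ↦ k - s, which cancels the factor ½. -/
theorem toCobar_diff (a : LSPlus 𝕜 𝔤) : toCobar b (diff b a) = Cobar.d 𝕜 (toCobar b a) := by
  refine LinearMap.congr_fun (hom_ext (f := toCobar b ∘ₗ diff b) (g := Cobar.d 𝕜 ∘ₗ toCobar b)
    (fun x k => ?_) fun p a ha q c hc h1 h2 => ?_) a
  · simp only [LinearMap.coe_comp, Function.comp_apply]
    -- All generators are odd, so their graded commutators are anticommutators.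
    have h1 : ∀ s t : ℕ+, toCobar b ⁅I 𝕜 x s, I 𝕜 x t⁆ =
        toCobar b (I 𝕜 x s) * toCobar b (I 𝕜 x t) + toCobar b (I 𝕜 x t) * toCobar b (I 𝕜 x s) := by
      intro s t
      rw [toCobar_lie b (I_mem_component x s) (I_mem_component x t),
        koszulSign_odd ((odd_deg s).mul (odd_deg t)), neg_smul, one_smul, sub_neg_eq_add]
    rw [diff_I, map_smul, map_sum]
    simp only [h1, Finset.sum_add_distrib]
    rw [sum_Iio_reflect k fun s t => toCobar b (I 𝕜 x t) * toCobar b (I 𝕜 x s), ← two_smul 𝕜,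
      smul_smul, one_div, inv_mul_cancel₀ two_ne_zero, one_smul, toCobar_I, map_sum]
    simp only [map_smul, Cobar.d_ι, Cobar.split]
    trans ∑ α ∈ Finset.piAntidiag Finset.univ (k : ℕ), ∑ β ∈ Finset.Ioo 0 α,
      (monomialEval (b.repr x) β * monomialEval (b.repr x) (α - β)) •
        (FreeAlgebra.ι 𝕜 β * FreeAlgebra.ι 𝕜 (α - β))
    · rw [sum_Ioo_eq_sum_Iio k fun β γ =>
        (monomialEval (b.repr x) β * monomialEval (b.repr x) γ) •
        (FreeAlgebra.ι 𝕜 β * FreeAlgebra.ι 𝕜 γ)]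
      refine Finset.sum_congr rfl fun s _ => ?_
      rw [toCobar_I, toCobar_I, Finset.sum_mul_sum]
      simp only [smul_mul_smul_comm]
    · refine Finset.sum_congr rfl fun α _ => ?_
      rw [Finset.smul_sum]
      refine Finset.sum_congr rfl fun β hβ => ?_
      rw [← monomialEval_mul _ (Finset.mem_Ioo.1 hβ).2.le]
  · simp only [LinearMap.coe_comp, Function.comp_apply] at *
    rw [diff_lie b ha, map_add, map_smul, toCobar_lie b (diff_mem b ha) hc,
      toCobar_lie b ha (diff_mem b hc), toCobar_lie b ha hc, map_sub, map_smul, Cobar.d_mul,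
      Cobar.d_mul, h1, h2, sgn_toCobar b ha, sgn_toCobar b hc]
    simp only [add_mul, mul_add, one_mul, mul_one, koszulSign_add, smul_mul_assoc, smul_sub, smul_add,
      smul_smul]
    rcases koszulSign_eq (𝕜 := 𝕜) p with hp | hp <;>
    rcases koszulSign_eq (𝕜 := 𝕜) q with hq | hq <;>
    rcases koszulSign_eq (𝕜 := 𝕜) (p * q) with hpq | hpq <;>
    simp only [hp, hq, hpq, one_smul, neg_smul, mul_one, mul_neg, neg_neg] <;>
    abel

theorem diff_diff (a : LSPlus 𝕜 𝔤) : diff b (diff b a) = 0 :=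
  toCobar_injective b (by rw [toCobar_diff, toCobar_diff, Cobar.d_d, map_zero])

theorem split_eq (α : σ → ℕ) : Cobar.split 𝕜 α = toCobar b (diff b (monomial b α)) := by
  by_cases hα : α = 0
  · subst hα; simp [Cobar.split]
  · rw [toCobar_diff, toCobar_monomial b hα, Cobar.d_ι]

/-- The splitting of a letter is the image of a Lie element, so it acts as the bracket with that
element, and its Dynkin image is the weight times it. The constant terms match because the
differential preserves weight. -/
theorem dynkin_d (a : FreeAlgebra 𝕜 (σ → ℕ)) : dynkin b (Cobar.d 𝕜 a) = diff b (dynkin b a) := by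
  refine LinearMap.congr_fun (Cobar.hom_ext_word (f := dynkin b ∘ₗ Cobar.d 𝕜)
    (g := diff b ∘ₗ dynkin b) ?_ fun α a ha => ?_) a
  · simp
  · simp only [LinearMap.coe_comp, Function.comp_apply] at ha ⊢
    have hodd : Odd (1 - 2 * (∑ j, α j : ℕ) : ℤ) := ⟨-(∑ j, α j : ℕ), by ring⟩
    rw [Cobar.d_ι_mul, map_sub, dynkin_ι_mul, dynkin_ι_mul, split_eq b, dynkin_mul,
      cobarAct_toCobar, dynkin_toCobar, weight_diff, weight_monomial, aug_d, ha, map_add,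
      diff_lie b (monomial_mem_component b α), koszulSign_odd hodd]
    simp only [zero_smul, add_zero, map_smul, neg_smul, one_smul]
    abel

/-! ### The cohomology of `𝓛(S⁺𝔤)` -/

variable (𝕜) in
/-- The inclusion `x ↦ 𝓘(x)` of `𝔤`, as a linear map. -/
def gen : 𝔤 →ₗ[𝕜] LSPlus 𝕜 𝔤 where
  toFun x := I 𝕜 x 1
  map_add' x y := by
    rw [I, I, I, ← map_add]
    congr 1
    apply Subtype.ext
    change SymmetricAlgebra.ι 𝕜 𝔤 (x + y) ^ 1 =
      SymmetricAlgebra.ι 𝕜 𝔤 x ^ 1 + SymmetricAlgebra.ι 𝕜 𝔤 y ^ 1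
    simp only [pow_one, map_add]
  map_smul' c x := by
    rw [I, I, RingHom.id_apply, ← map_smul]
    congr 1
    apply Subtype.ext
    change SymmetricAlgebra.ι 𝕜 𝔤 (c • x) ^ 1 = c • SymmetricAlgebra.ι 𝕜 𝔤 x ^ 1
    simp only [pow_one, map_smul]

theorem gen_apply (x : 𝔤) : gen 𝕜 x = I 𝕜 x 1 := rfl

theorem diff_gen (x : 𝔤) : diff b (gen 𝕜 x) = 0 := by
  rw [gen_apply, diff_I]
  simp

theorem gen_mem_component (x : 𝔤) : gen 𝕜 x ∈ component 𝕜 𝔤 (-1) := I_mem_component x 1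

theorem monomial_mem_range_gen {α : σ → ℕ} (hα : ∑ j, α j = 1) :
    monomial b α ∈ LinearMap.range (gen 𝕜 : 𝔤 →ₗ[𝕜] LSPlus 𝕜 𝔤) := by
  have hmem := symMonomial_mem b α
  rw [hα] at hmem
  obtain ⟨x, hx⟩ : symMonomial b α ∈ LinearMap.range (SymmetricAlgebra.ι 𝕜 𝔤) := by
    rwa [symPow, pow_one] at hmem
  exact ⟨x, of_eq_monomial b hα _ ((pow_one _).trans hx)⟩

theorem gen_lie_gen_mem (x y : 𝔤) : ⁅gen 𝕜 x, gen 𝕜 y⁆ ∈ LinearMap.range (diff b) := by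
  have h2 : ∀ z : 𝔤, diff b (I 𝕜 z 2) = (1 / 2 : 𝕜) • ⁅gen 𝕜 z, gen 𝕜 z⁆ := by
    intro z
    have : Finset.Iio (2 : ℕ+) = {1} := by
      ext s
      rw [Finset.mem_Iio, Finset.mem_singleton, ← PNat.coe_lt_coe, ← PNat.coe_inj]
      have := s.pos
      change (s : ℕ) < 2 ↔ (s : ℕ) = 1
      omega
    rw [diff_I, this, Finset.sum_singleton]
    rfl
  -- The polarization of the quadratic map z ↦ 𝓘(z²), whose differential is ½[𝓘(z), 𝓘(z)].
  refine ⟨I 𝕜 (x + y) 2 - I 𝕜 x 2 - I 𝕜 y 2, ?_⟩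
  have hcomm : ⁅gen 𝕜 y, gen 𝕜 x⁆ = ⁅gen 𝕜 x, gen 𝕜 y⁆ := by
    rw [lie_antisymm (gen_mem_component y) (gen_mem_component x),
      koszulSign_odd (by decide), neg_smul, one_smul, neg_neg]
  rw [map_sub, map_sub, h2, h2, h2, map_add, FreeGradedLie.add_lie, FreeGradedLie.lie_add,
    FreeGradedLie.lie_add, hcomm]
  module

theorem gen_lie_diff (x : 𝔤) (a : LSPlus 𝕜 𝔤) : ⁅gen 𝕜 x, diff b a⁆ = diff b (-⁅gen 𝕜 x, a⁆) := by
  rw [map_neg, diff_lie b (gen_mem_component x), diff_gen, koszulSign_odd (by decide)]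
  simp

/-- Letters of weight one are cocycles 𝓘(x). Bracketing with one of them turns generators into
coboundaries and keeps coboundaries exact, so only words of length one can leave a generator. -/
theorem dynkin_linearPart {t : FreeAlgebra 𝕜 (σ → ℕ)} (ht : t ∈ Cobar.linearPart 𝕜) :
    dynkin b t ∈ LinearMap.range (gen 𝕜 : 𝔤 →ₗ[𝕜] LSPlus 𝕜 𝔤) ⊔ LinearMap.range (diff b) := by
  induction ht using Submodule.span_induction with
  | zero => simp
  | add a b _ _ ha hb => rw [map_add]; exact add_mem ha hb
  | smul c a _ ha => rw [map_smul]; exact Submodule.smul_mem _ c ha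
  | mem a ha =>
    obtain ⟨l, hl, rfl⟩ := ha
    induction l with
    | nil => simp
    | cons α l ih =>
      obtain ⟨x, hx⟩ := monomial_mem_range_gen b (hl α List.mem_cons_self)
      obtain ⟨_, ⟨y, rfl⟩, _, ⟨z, rfl⟩, hyz⟩ := Submodule.mem_sup.1
        (ih fun β hβ => hl β (List.mem_cons_of_mem _ hβ))
      rw [Cobar.word_cons, dynkin_ι_mul, ← hyz, ← hx, FreeGradedLie.lie_add, gen_lie_diff]
      refine add_mem (Submodule.mem_sup_right (add_mem (gen_lie_gen_mem b x y)
        (LinearMap.mem_range_self _ _))) (Submodule.mem_sup_left ?_)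
      exact Submodule.smul_mem _ _ (Submodule.smul_mem _ _ (LinearMap.mem_range_self _ _))

/-- The weight derivation maps cocycles to sums of generators and coboundaries. -/
theorem weight_mem_of_diff_eq_zero {a : LSPlus 𝕜 𝔤} (ha : diff b a = 0) :
    weight 𝕜 𝔤 a ∈
      LinearMap.range (gen 𝕜 : 𝔤 →ₗ[𝕜] LSPlus 𝕜 𝔤) ⊔ LinearMap.range (diff b) := by
  have hd : Cobar.d 𝕜 (toCobar b a) = 0 := by rw [← toCobar_diff, ha, map_zero]
  obtain ⟨_, ⟨c, rfl⟩, t, ht, hct⟩ := Submodule.mem_sup.1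
    (Cobar.mem_of_d_eq_zero Finset.univ (toCobar_mem_supported b a) hd)
  rw [← dynkin_toCobar b, ← hct, map_add, dynkin_d]
  exact add_mem (Submodule.mem_sup_right (LinearMap.mem_range_self _ _)) (dynkin_linearPart b ht)

/-- Cocycles of positive weight are sums of generators and coboundaries. -/
theorem mem_of_mem_weightSpace {k : ℕ} (hk : k ≠ 0) {a : LSPlus 𝕜 𝔤} (hak : a ∈ weightSpace 𝕜 𝔤 k)
    (ha : diff b a = 0) :
    a ∈ LinearMap.range (gen 𝕜 : 𝔤 →ₗ[𝕜] LSPlus 𝕜 𝔤) ⊔ LinearMap.range (diff b) := by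
  have h := weight_mem_of_diff_eq_zero b ha
  rw [mem_weightSpace.1 hak] at h
  have h' := Submodule.smul_mem _ (k : 𝕜)⁻¹ h
  rwa [smul_smul, inv_mul_cancel₀ (Nat.cast_ne_zero.2 hk), one_smul] at h'

/-- Every cocycle is a sum of a generator and a coboundary. -/
theorem mem_of_diff_eq_zero {a : LSPlus 𝕜 𝔤} (ha : diff b a = 0) :
    a ∈ LinearMap.range (gen 𝕜 : 𝔤 →ₗ[𝕜] LSPlus 𝕜 𝔤) ⊔ LinearMap.range (diff b) := by
  have h := mem_iSup_inf_ker iSupIndep_weightSpace (diff b)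
    (fun k a ha => diff_mem_weightSpace b ha) (iSup_weightSpace (𝕜 := 𝕜) (𝔤 := 𝔤) ▸ trivial) ha
  refine (iSup_le fun k => ?_ : _ ≤ LinearMap.range (gen 𝕜 : 𝔤 →ₗ[𝕜] LSPlus 𝕜 𝔤) ⊔
    LinearMap.range (diff b)) h
  rintro c ⟨hck, hc⟩
  by_cases hk : k = 0
  · subst hk
    have hck' : c ∈ weightSpace 𝕜 𝔤 0 := hck
    rw [weightSpace_zero, Submodule.mem_bot] at hck'
    rw [hck']
    exact zero_mem _
  · exact mem_of_mem_weightSpace b hk hck hc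

end LSPlus

/-! ### A criterion for vanishing cohomology -/

section Cohomology

variable {𝕜 : Type*} [Field 𝕜] {M : Type*} [AddCommGroup M] [Module 𝕜 M]

theorem subsingleton_cohomology (A : ℤ → Submodule 𝕜 M) (d : M →ₗ[𝕜] M) (n : ℤ)
    (h : ∀ a ∈ A n, d a = 0 → ∃ c ∈ A (n - 1), d c = a) : Subsingleton (Cohomology A d n) := by
  rw [Submodule.Quotient.subsingleton_iff, Submodule.submoduleOf_eq_top]
  rintro a ⟨ha, hd⟩
  exact h a ha hd

end Cohomology

namespace LSPlus

variable {𝕜 : Type*} [Field 𝕜] {𝔤 : Type*} [LieRing 𝔤] [LieAlgebra 𝕜 𝔤]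
  {σ : Type*} [Fintype σ] [DecidableEq σ] (b : Module.Basis σ 𝕜 𝔤) [CharZero 𝕜]

/-! ### The projection of `𝓛(S⁺𝔤)` to the generators in `𝔤` -/

/-- The projection of `S⁺𝔤` to `𝔤`. -/
def projGen (k : ℕ+) : SPlus 𝕜 𝔤 k →ₗ[𝕜] 𝔤 :=
  symPowLift b (fun α => ∑ i, if α = Pi.single i 1 then b i else 0) k

theorem projGen_pow (x : 𝔤) (k : ℕ+) :
    projGen b k (symPow.pow 𝕜 𝔤 x k) = if k = 1 then x else 0 := by
  rw [projGen, symPowLift_pow]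
  simp only [Finset.smul_sum, smul_ite, smul_zero]
  rw [Finset.sum_comm]
  simp only [Finset.sum_ite_eq', mem_piAntidiag_univ]
  have h1 : ∀ i : σ, ∑ j, (Pi.single i 1 : σ → ℕ) j = 1 := fun i => by simp
  have h2 : ∀ i : σ, monomialEval (b.repr x) (Pi.single i 1) = b.repr x i := by
    intro i
    rw [monomialEval, Finset.prod_eq_single_of_mem i (Finset.mem_univ i)
      (fun j _ hj => by simp [hj])]
    simp
  simp only [h1, h2]
  by_cases hk : k = 1
  · subst hk
    simp
  · have : ¬ 1 = (k : ℕ) := fun h => hk (PNat.eq h.symm)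
    simp [hk, this]

variable [Module.Finite 𝕜 𝔤]

theorem projGen_of_ne {k : ℕ+} (hk : k ≠ 1) : projGen b k = 0 :=
  symPow_hom_ext fun x => by rw [projGen_pow, if_neg hk]; rfl

theorem projGen_ad (x : 𝔤) (k : ℕ+) (u : SPlus 𝕜 𝔤 k) :
    projGen b k (symPowAd 𝕜 x k u) = ⁅x, projGen b k u⁆ := by
  by_cases hk : k = 1
  · subst hk
    refine LinearMap.congr_fun (symPow_hom_ext (f := projGen b 1 ∘ₗ symPowAd 𝕜 x (1 : ℕ+))
      (g := (LieAlgebra.ad 𝕜 𝔤 x : 𝔤 →ₗ[𝕜] 𝔤) ∘ₗ projGen b 1) fun y => ?_) u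
    have h : symPowAd 𝕜 x (1 : ℕ+) (symPow.pow 𝕜 𝔤 y (1 : ℕ+)) =
        symPow.pow 𝕜 𝔤 ⁅x, y⁆ (1 : ℕ+) := by
      apply Subtype.ext
      change symAd 𝕜 x (SymmetricAlgebra.ι 𝕜 𝔤 y ^ 1) = SymmetricAlgebra.ι 𝕜 𝔤 ⁅x, y⁆ ^ 1
      rw [pow_one, pow_one, symAd_ι]
    simp only [LinearMap.coe_comp, Function.comp_apply]
    rw [h, projGen_pow, projGen_pow, if_pos rfl, if_pos rfl]
    rfl
  · rw [projGen_of_ne b hk]; simp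

/-- The projection of `𝓛(S⁺𝔤)` to `𝔤`, which vanishes on brackets. -/
def proj : LSPlus 𝕜 𝔤 →ₗ[𝕜] 𝔤 := oddDerivation 0 (projGen b)

theorem proj_I (x : 𝔤) (k : ℕ+) : proj b (I 𝕜 x k) = if k = 1 then x else 0 := by
  rw [← projGen_pow b]
  exact oddDerivation_of _ _ _

theorem proj_gen (x : 𝔤) : proj b (gen 𝕜 x) = x := by
  rw [gen_apply, proj_I, if_pos rfl]

theorem proj_lie {p q : ℤ} {a c : LSPlus 𝕜 𝔤} (ha : a ∈ component 𝕜 𝔤 p)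
    (hc : c ∈ component 𝕜 𝔤 q) : proj b ⁅a, c⁆ = 0 := by
  have h0 : IsRepresentation (0 : LSPlus 𝕜 𝔤 →ₗ[𝕜] 𝔤 →ₗ[𝕜] 𝔤) := by
    intro p a _ q c _ x
    simp
  rw [proj, oddDerivation_lie _ h0 ha hc]
  simp

/-- The projection vanishes on brackets whose left factor is homogeneous. -/
theorem proj_lie_left {p : ℤ} {a : LSPlus 𝕜 𝔤} (ha : a ∈ component 𝕜 𝔤 p) (c : LSPlus 𝕜 𝔤) :
    proj b ⁅a, c⁆ = 0 := by
  have hc : c ∈ ⨆ q, component 𝕜 𝔤 q := iSup_component (𝕜 := 𝕜) (V := SPlus 𝕜 𝔤) ▸ trivial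
  induction hc using Submodule.iSup_induction' with
  | zero => simp
  | add c e _ _ hc he => rw [FreeGradedLie.lie_add, map_add, hc, he, add_zero]
  | mem q c hc => exact proj_lie b ha hc

/-- The differential takes values in brackets, which the projection ignores. Hence no nonzero 𝓘(x)
is a coboundary. -/
theorem proj_diff (a : LSPlus 𝕜 𝔤) : proj b (diff b a) = 0 := by
  refine LinearMap.congr_fun (hom_ext (f := proj b ∘ₗ diff b) (g := 0)
    (fun x k => ?_) fun p a ha q c hc _ _ => ?_) a
  · simp only [LinearMap.coe_comp, Function.comp_apply]
    rw [diff_I, map_smul, map_sum, Finset.sum_eq_zero, smul_zero]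
    · rfl
    · exact fun s _ => proj_lie b (I_mem_component x s) (I_mem_component x _)
  · simp only [LinearMap.coe_comp, Function.comp_apply]
    rw [diff_lie b ha, map_add, map_smul, proj_lie b (diff_mem b ha) hc,
      proj_lie b ha (diff_mem b hc)]
    simp

theorem proj_weight (a : LSPlus 𝕜 𝔤) : proj b (weight 𝕜 𝔤 a) = proj b a := by
  refine LinearMap.congr_fun (hom_ext (f := proj b ∘ₗ weight 𝕜 𝔤) (g := proj b)
    (fun x k => ?_) fun p a ha q c hc _ _ => ?_) a
  · simp only [LinearMap.coe_comp, Function.comp_apply]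
    rw [weight_I, map_smul, proj_I]
    split_ifs with hk
    · rw [hk]; simp
    · simp
  · simp only [LinearMap.coe_comp, Function.comp_apply]
    rw [weight_lie, map_add, proj_lie b (weight_mem_component ha) hc,
      proj_lie b ha (weight_mem_component hc), proj_lie b ha hc, add_zero]

/-! ### Cohomology of `𝓛(S⁺𝔤)` in each degree -/

/-- Replaces a preimage by its component of degree n - 1. The term y accommodates a generator part
that lies outside degree n and so must cancel. -/
theorem exists_diff_eq {n : ℤ} (c : LSPlus 𝕜 𝔤) {y : LSPlus 𝕜 𝔤}
    (hy : y ∈ ⨆ (i) (_ : i ≠ n), component 𝕜 𝔤 i) (h : diff b c + y ∈ component 𝕜 𝔤 n) :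
    ∃ a ∈ component 𝕜 𝔤 (n - 1), diff b a = diff b c + y := by
  -- The source grading is shifted by one so that the differential preserves the index.
  refine exists_mem_component_eq (A := fun i => component 𝕜 𝔤 (i - 1)) iSupIndep_component (diff b)
    (fun i a ha => ?_) ?_ n c y hy h
  · have := diff_mem b ha
    rwa [sub_add_cancel] at this
  · rw [← iSup_component]
    exact (Equiv.subRight (1 : ℤ)).iSup_comp (g := component 𝕜 𝔤)

theorem subsingleton_cohomology_diff {n : ℤ} (hn : n ≠ -1) :
    Subsingleton (Cohomology (component 𝕜 𝔤) (diff b) n) := by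
  refine subsingleton_cohomology _ _ _ fun a ha hd => ?_
  obtain ⟨_, ⟨x, rfl⟩, _, ⟨c, rfl⟩, rfl⟩ := Submodule.mem_sup.1 (mem_of_diff_eq_zero b hd)
  rw [add_comm] at ha ⊢
  exact exists_diff_eq b c (Submodule.mem_iSup_of_mem (-1)
    (Submodule.mem_iSup_of_mem hn.symm (gen_mem_component x))) ha

theorem gen_mem_cocycles (x : 𝔤) : gen 𝕜 x ∈ cocycles (component 𝕜 𝔤) (diff b) (-1) :=
  ⟨gen_mem_component x, diff_gen b x⟩

/-- The map from `𝔤` to the cohomology of `𝓛(S⁺𝔤)` in degree `-1`. -/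
def genClass : 𝔤 →ₗ[𝕜] Cohomology (component 𝕜 𝔤) (diff b) (-1) :=
  Submodule.mkQ _ ∘ₗ (gen 𝕜).codRestrict _ (gen_mem_cocycles b)

theorem genClass_bijective : Function.Bijective (genClass b) := by
  constructor
  · rw [injective_iff_map_eq_zero]
    intro x hx
    obtain ⟨c, -, hc⟩ := (Submodule.Quotient.mk_eq_zero _).1 hx
    have hc' : diff b c = gen 𝕜 x := hc
    rw [← proj_gen b x, ← hc', proj_diff]
  · intro z
    obtain ⟨⟨a, ha, hd⟩, rfl⟩ := Submodule.Quotient.mk_surjective _ z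
    obtain ⟨_, ⟨x, rfl⟩, _, ⟨c, rfl⟩, rfl⟩ := Submodule.mem_sup.1 (mem_of_diff_eq_zero b hd)
    refine ⟨x, (Submodule.Quotient.eq _).2 ?_⟩
    have hc : diff b (-c) + 0 ∈ component 𝕜 𝔤 (-1) := by
      have := sub_mem (gen_mem_component x) ha
      rwa [sub_add_cancel_left, ← map_neg, ← add_zero (diff b _)] at this
    obtain ⟨e, he, hec⟩ := exists_diff_eq b (-c) (zero_mem _) hc
    refine ⟨e, he, ?_⟩
    rw [hec, add_zero, map_neg]
    exact (sub_add_cancel_left _ _).symm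

end LSPlus

/-! ### The adjoint action on `𝓛(S⁺𝔤)` -/

/-- A commutator of derivations is a derivation, so the claim reduces to the Jacobi identity in `𝔤`.
-/
theorem symAd_lie {𝕜 : Type*} [Field 𝕜] {𝔤 : Type*} [LieRing 𝔤] [LieAlgebra 𝕜 𝔤] (x y : 𝔤)
    (a : SymmetricAlgebra 𝕜 𝔤) :
    symAd 𝕜 ⁅x, y⁆ a = symAd 𝕜 x (symAd 𝕜 y a) - symAd 𝕜 y (symAd 𝕜 x a) := by
  have h0 : ∀ z : 𝔤, ∀ r : 𝕜, symAd 𝕜 z (algebraMap 𝕜 _ r) = 0 := fun z r => by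
    change (adHom 𝕜 z (algebraMap 𝕜 _ r)).snd = 0
    rw [AlgHom.commutes]; rfl
  induction a using SymmetricAlgebra.induction with
  | algebraMap r => simp only [h0, map_zero, sub_zero]
  | ι z => simp only [symAd_ι, leibniz_lie x y z, map_add, add_sub_cancel_right]
  | mul a c ha hc =>
    simp only [symAd_mul, map_add, ha, hc]
    ring
  | add a c ha hc =>
    simp only [map_add, ha, hc]
    abel

namespace LSPlus

variable {𝕜 : Type*} [Field 𝕜] {𝔤 : Type*} [LieRing 𝔤] [LieAlgebra 𝕜 𝔤]

theorem act_of (x : 𝔤) (k : ℕ+) (u : SPlus 𝕜 𝔤 k) :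
    act 𝕜 x (of 𝕜 (SPlus 𝕜 𝔤) SPlusDeg k u) =
      of 𝕜 (SPlus 𝕜 𝔤) SPlusDeg k (symPowAd 𝕜 x k u) := derivation_of _ _ _ _ _

theorem act_lie_left (x y : 𝔤) (a : LSPlus 𝕜 𝔤) :
    act 𝕜 ⁅x, y⁆ a = act 𝕜 x (act 𝕜 y a) - act 𝕜 y (act 𝕜 x a) := by
  refine mem_of_lie_closed (LinearMap.eqLocus (act 𝕜 ⁅x, y⁆)
    (act 𝕜 x ∘ₗ act 𝕜 y - act 𝕜 y ∘ₗ act 𝕜 x)) (fun k u => ?_) (fun p a _ q c _ ha hc => ?_) a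
  · simp only [LinearMap.mem_eqLocus, LinearMap.sub_apply, LinearMap.coe_comp, Function.comp_apply,
      act_of, ← map_sub]
    congr 1
    exact Subtype.ext (symAd_lie x y _)
  · simp only [LinearMap.mem_eqLocus, LinearMap.sub_apply, LinearMap.coe_comp,
      Function.comp_apply] at *
    simp only [act_lie, map_add, ha, hc, FreeGradedLie.sub_lie, FreeGradedLie.lie_sub]
    abel

theorem act_I_self (x : 𝔤) (k : ℕ+) : act 𝕜 x (I 𝕜 x k) = 0 := by
  have h : symPowAd 𝕜 x k (symPow.pow 𝕜 𝔤 x k) = 0 := by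
    apply Subtype.ext
    change symAd 𝕜 x (SymmetricAlgebra.ι 𝕜 𝔤 x ^ (k : ℕ)) = 0
    rw [symAd_pow, _root_.lie_self, map_zero, mul_zero, smul_zero]
  rw [I, act_of, h, map_zero]

variable [CharZero 𝕜] [Module.Finite 𝕜 𝔤]

theorem weight_act (x : 𝔤) (a : LSPlus 𝕜 𝔤) :
    weight 𝕜 𝔤 (act 𝕜 x a) = act 𝕜 x (weight 𝕜 𝔤 a) := by
  refine mem_of_lie_closed (LinearMap.eqLocus (weight 𝕜 𝔤 ∘ₗ act 𝕜 x) (act 𝕜 x ∘ₗ weight 𝕜 𝔤))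
    (fun k u => ?_) (fun p a _ q c _ ha hc => ?_) a
  · simp only [LinearMap.mem_eqLocus, LinearMap.coe_comp, Function.comp_apply, act_of, weight_of,
      map_smul]
  · simp only [LinearMap.mem_eqLocus, LinearMap.coe_comp, Function.comp_apply] at *
    simp only [act_lie, weight_lie, map_add, ha, hc]
    abel

variable (𝕜 𝔤) in
/-- The action of `𝔤` on `𝓛(S⁺𝔤)`, as a bilinear map. -/
def actHom : 𝔤 →ₗ[𝕜] LSPlus 𝕜 𝔤 →ₗ[𝕜] LSPlus 𝕜 𝔤 where
  toFun x := act 𝕜 x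
  map_add' x y := by
    refine hom_ext (fun z k => ?_) fun p a ha q c hc h1 h2 => ?_
    · rw [LinearMap.add_apply, I, act_of, act_of, act_of, ← map_add]
      congr 1
      apply Subtype.ext
      change symAd 𝕜 (x + y) (SymmetricAlgebra.ι 𝕜 𝔤 z ^ (k : ℕ)) =
        symAd 𝕜 x (SymmetricAlgebra.ι 𝕜 𝔤 z ^ (k : ℕ)) +
          symAd 𝕜 y (SymmetricAlgebra.ι 𝕜 𝔤 z ^ (k : ℕ))
      rw [symAd_pow, symAd_pow, symAd_pow, _root_.add_lie, map_add, mul_add, smul_add]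
    · rw [LinearMap.add_apply] at *
      rw [act_lie, act_lie, act_lie, h1, h2, FreeGradedLie.add_lie, FreeGradedLie.lie_add]
      abel
  map_smul' r x := by
    refine hom_ext (fun z k => ?_) fun p a ha q c hc h1 h2 => ?_
    · rw [RingHom.id_apply, LinearMap.smul_apply, I, act_of, act_of, ← map_smul]
      congr 1
      apply Subtype.ext
      change symAd 𝕜 (r • x) (SymmetricAlgebra.ι 𝕜 𝔤 z ^ (k : ℕ)) =
        r • symAd 𝕜 x (SymmetricAlgebra.ι 𝕜 𝔤 z ^ (k : ℕ))
      rw [symAd_pow, symAd_pow, _root_.smul_lie, map_smul, mul_smul_comm, smul_comm]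
    · rw [RingHom.id_apply, LinearMap.smul_apply] at *
      rw [act_lie, act_lie, h1, h2, FreeGradedLie.smul_lie, FreeGradedLie.lie_smul, smul_add]

theorem actHom_apply (x : 𝔤) (a : LSPlus 𝕜 𝔤) : actHom 𝕜 𝔤 x a = act 𝕜 x a := rfl

theorem act_zero (a : LSPlus 𝕜 𝔤) : act 𝕜 (0 : 𝔤) a = 0 := by
  rw [← actHom_apply, map_zero, LinearMap.zero_apply]

theorem act_neg (x : 𝔤) (a : LSPlus 𝕜 𝔤) : act 𝕜 (-x) a = -act 𝕜 x a := by
  rw [← actHom_apply, map_neg, LinearMap.neg_apply, actHom_apply]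

theorem act_smul (r : 𝕜) (x : 𝔤) (a : LSPlus 𝕜 𝔤) : act 𝕜 (r • x) a = r • act 𝕜 x a := by
  rw [← actHom_apply, map_smul, LinearMap.smul_apply, actHom_apply]

variable (𝕜 𝔤) in
/-- The action of `𝓛(S⁺𝔤)` on the semi-direct sum `𝔤 ⋉ 𝓛(S⁺𝔤)`. -/
def semidirectAct : LSPlus 𝕜 𝔤 →ₗ[𝕜] 𝔤 × LSPlus 𝕜 𝔤 →ₗ[𝕜] 𝔤 × LSPlus 𝕜 𝔤 :=
  LinearMap.mk₂ 𝕜 (fun a n => (0, ⁅a, n.2⁆ - actHom 𝕜 𝔤 n.1 a))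
    (fun a c n => by ext <;> simp [add_sub_add_comm])
    (fun r a n => by ext <;> simp [smul_sub])
    (fun a n m => by ext <;> simp [add_sub_add_comm])
    (fun r a n => by ext <;> simp [smul_sub])

theorem semidirectAct_apply (a : LSPlus 𝕜 𝔤) (n : 𝔤 × LSPlus 𝕜 𝔤) :
    semidirectAct 𝕜 𝔤 a n = (0, ⁅a, n.2⁆ - act 𝕜 n.1 a) := rfl

/-- This is the adjoint representation of `D𝔤` restricted to the ideal `𝓛(S⁺𝔤)`. It makes
`oddDerivation` applicable to maps with values in all of `D𝔤`. -/
theorem isRepresentation_semidirectAct : IsRepresentation (semidirectAct 𝕜 𝔤) := by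
  intro p a ha q c hc n
  simp only [semidirectAct_apply, act_zero, sub_zero, act_lie, FreeGradedLie.lie_sub,
    Prod.smul_mk, smul_zero, Prod.mk_sub_mk, smul_sub]
  rw [lie_jacobi ha hc, FreeGradedLie.lie_antisymm (act_mem_component n.1 ha) hc]
  congr 1
  abel

/-! ### The differential of the semi-direct sum -/

section

variable {σ : Type*} [Fintype σ] [DecidableEq σ] (b : Module.Basis σ 𝕜 𝔤)

/-- The restriction to `𝓛(S⁺𝔤)` of the differential of `𝔤 ⋉ 𝓛(S⁺𝔤)`. -/
def semidirectDiff : LSPlus 𝕜 𝔤 →ₗ[𝕜] 𝔤 × LSPlus 𝕜 𝔤 :=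
  oddDerivation (semidirectAct 𝕜 𝔤) fun k => (projGen b k).prod (diffGen b k)

theorem semidirectDiff_of (k : ℕ+) (u : SPlus 𝕜 𝔤 k) :
    semidirectDiff b (of 𝕜 (SPlus 𝕜 𝔤) SPlusDeg k u) = (projGen b k u, diffGen b k u) :=
  oddDerivation_of _ _ _

theorem fst_semidirectDiff (a : LSPlus 𝕜 𝔤) : (semidirectDiff b a).1 = proj b a := by
  refine LinearMap.congr_fun (hom_ext (f := LinearMap.fst 𝕜 𝔤 (LSPlus 𝕜 𝔤) ∘ₗ semidirectDiff b) (g := proj b)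
    (fun x k => ?_) fun p a ha q c hc _ _ => ?_) a
  · simp only [LinearMap.coe_comp, Function.comp_apply]
    rw [I, semidirectDiff_of, proj, oddDerivation_of]
    rfl
  · simp only [LinearMap.coe_comp, Function.comp_apply]
    rw [proj_lie b ha hc, semidirectDiff, oddDerivation_lie _ isRepresentation_semidirectAct ha hc]
    simp [semidirectAct_apply]

/-- In the target `𝔤` occupies degree 0 only, so a map of degree one can have a `𝔤`-component only
on degree -1. The sign simplifications involving `proj` rest on this. -/
theorem semidirectDiff_mem {p : ℤ} {a : LSPlus 𝕜 𝔤} (ha : a ∈ component 𝕜 𝔤 p) :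
    (p ≠ -1 → proj b a = 0) ∧ (semidirectDiff b a).2 ∈ component 𝕜 𝔤 (p + 1) := by
  let A : ℤ → Submodule 𝕜 (𝔤 × LSPlus 𝕜 𝔤) := fun q =>
    (if q = 0 then ⊤ else ⊥ : Submodule 𝕜 𝔤).prod (component 𝕜 𝔤 q)
  have h : semidirectDiff b a ∈ A (p + 1) := by
    refine oddDerivation_mem _ isRepresentation_semidirectAct A (fun p a ha q n hn => ?_)
      (fun k u => ?_) ha
    · refine ⟨zero_mem _, sub_mem (lie_mem_component ha hn.2) ?_⟩
      by_cases hq : q = 0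
      · rw [hq, add_zero]
        exact act_mem_component _ ha
      · have h1 : n.1 ∈ (if q = 0 then ⊤ else ⊥ : Submodule 𝕜 𝔤) := hn.1
        rw [if_neg hq, Submodule.mem_bot] at h1
        rw [h1, map_zero, LinearMap.zero_apply]
        exact zero_mem _
    · refine ⟨?_, diffGen_mem b k u⟩
      by_cases hk : k = 1
      · subst hk
        exact trivial
      · simp [projGen_of_ne b hk]
  refine ⟨fun hp => ?_, h.2⟩
  have h1 : (semidirectDiff b a).1 ∈ (if p + 1 = 0 then ⊤ else ⊥ : Submodule 𝕜 𝔤) := h.1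
  rwa [if_neg (by omega), Submodule.mem_bot, fst_semidirectDiff] at h1

theorem koszulSign_smul_proj {p : ℤ} {a : LSPlus 𝕜 𝔤} (ha : a ∈ component 𝕜 𝔤 p) :
    koszulSign 𝕜 p • proj b a = -proj b a := by
  by_cases hp : p = -1
  · rw [hp, koszulSign_odd (by decide), neg_smul, one_smul]
  · rw [(semidirectDiff_mem b ha).1 hp, smul_zero, neg_zero]

theorem proj_act (x : 𝔤) (a : LSPlus 𝕜 𝔤) : proj b (act 𝕜 x a) = ⁅x, proj b a⁆ := by
  refine LinearMap.congr_fun (hom_ext (f := proj b ∘ₗ act 𝕜 x)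
    (g := (LieAlgebra.ad 𝕜 𝔤 x : 𝔤 →ₗ[𝕜] 𝔤) ∘ₗ proj b) (fun y k => ?_)
    fun p a ha q c hc _ _ => ?_) a
  · simp only [LinearMap.coe_comp, Function.comp_apply, LieAlgebra.ad_apply]
    rw [I, act_of, proj, oddDerivation_of, oddDerivation_of, projGen_ad]
  · simp only [LinearMap.coe_comp, Function.comp_apply, LieAlgebra.ad_apply]
    rw [act_lie, map_add, proj_lie b (act_mem_component x ha) hc,
      proj_lie b ha (act_mem_component x hc), proj_lie b ha hc, _root_.lie_zero, add_zero]

/-- The `𝓛(S⁺𝔤)`-part of the differential of `𝔤 ⋉ 𝓛(S⁺𝔤)`. -/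
def twistedDiff : LSPlus 𝕜 𝔤 →ₗ[𝕜] LSPlus 𝕜 𝔤 := LinearMap.snd 𝕜 _ _ ∘ₗ semidirectDiff b

theorem twistedDiff_of (k : ℕ+) (u : SPlus 𝕜 𝔤 k) :
    twistedDiff b (of 𝕜 (SPlus 𝕜 𝔤) SPlusDeg k u) = diffGen b k u :=
  congrArg Prod.snd (semidirectDiff_of b k u)

theorem twistedDiff_I (x : 𝔤) (k : ℕ+) : twistedDiff b (I 𝕜 x k) =
    (1 / 2 : 𝕜) • ∑ s ∈ Finset.Iio k, ⁅I 𝕜 x s, I 𝕜 x (k - s)⁆ := by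
  rw [← diffGen_pow b]
  exact twistedDiff_of _ _ _

theorem twistedDiff_mem {p : ℤ} {a : LSPlus 𝕜 𝔤} (ha : a ∈ component 𝕜 𝔤 p) :
    twistedDiff b a ∈ component 𝕜 𝔤 (p + 1) := (semidirectDiff_mem b ha).2

theorem twistedDiff_lie {p : ℤ} {a : LSPlus 𝕜 𝔤} (ha : a ∈ component 𝕜 𝔤 p) (c : LSPlus 𝕜 𝔤) :
    twistedDiff b ⁅a, c⁆ = ⁅twistedDiff b a, c⁆ + act 𝕜 (proj b a) c +
      koszulSign 𝕜 p • (⁅a, twistedDiff b c⁆ - act 𝕜 (proj b c) a) := by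
  have hc : c ∈ ⨆ q, component 𝕜 𝔤 q := iSup_component (𝕜 := 𝕜) (V := SPlus 𝕜 𝔤) ▸ trivial
  induction hc using Submodule.iSup_induction' with
  | zero => simp [act_zero]
  | add c e _ _ hc he =>
    simp only [FreeGradedLie.lie_add, map_add, hc, he, ← actHom_apply, LinearMap.add_apply,
      smul_add, smul_sub]
    abel
  | mem q c hc =>
    -- The action term is nonzero only for p = -1, where the exponent of the sign is 0.
    have h : koszulSign 𝕜 ((p + 1) * q) • act 𝕜 (proj b a) c = act 𝕜 (proj b a) c := by
      by_cases hp : p = -1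
      · rw [hp, neg_add_cancel, zero_mul, koszulSign_zero, one_smul]
      · rw [(semidirectDiff_mem b ha).1 hp, act_zero, smul_zero]
    rw [FreeGradedLie.lie_antisymm (twistedDiff_mem b ha) hc]
    change (semidirectDiff b ⁅a, c⁆).2 = _
    rw [semidirectDiff, oddDerivation_lie _ isRepresentation_semidirectAct ha hc, ← semidirectDiff]
    simp only [semidirectAct_apply, Prod.snd_sub, Prod.smul_snd, fst_semidirectDiff]
    rw [smul_sub (koszulSign 𝕜 ((p + 1) * q)), h]
    change _ - (koszulSign 𝕜 ((p + 1) * q) • ⁅c, twistedDiff b a⁆ - _) = _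
    change koszulSign 𝕜 p • (⁅a, twistedDiff b c⁆ - _) - _ = _
    abel

theorem twistedDiff_act (x : 𝔤) (a : LSPlus 𝕜 𝔤) :
    twistedDiff b (act 𝕜 x a) = act 𝕜 x (twistedDiff b a) := by
  refine LinearMap.congr_fun (hom_ext (f := twistedDiff b ∘ₗ act 𝕜 x)
    (g := act 𝕜 x ∘ₗ twistedDiff b) (fun y k => ?_) fun p a ha q c hc h1 h2 => ?_) a
  · simp only [LinearMap.coe_comp, Function.comp_apply]
    rw [I, act_of, twistedDiff_of, twistedDiff_of, diffGen_ad]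
  · simp only [LinearMap.coe_comp, Function.comp_apply] at *
    rw [act_lie, map_add, twistedDiff_lie b (act_mem_component x ha), twistedDiff_lie b ha,
      twistedDiff_lie b ha, h1, h2, proj_act, proj_act]
    simp only [map_add, map_sub, map_smul, act_lie, act_lie_left, smul_sub, smul_add]
    abel

/-- The `𝔤`-part of d² = 0. On a bracket the two action terms project to [x, y] and [y, x], with x
and y the projections of its factors, and these cancel. -/
theorem proj_twistedDiff (a : LSPlus 𝕜 𝔤) : proj b (twistedDiff b a) = 0 := by
  refine LinearMap.congr_fun (hom_ext (f := proj b ∘ₗ twistedDiff b) (g := 0)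
    (fun x k => ?_) fun p a ha q c hc h1 h2 => ?_) a
  · simp only [LinearMap.coe_comp, Function.comp_apply]
    rw [twistedDiff_I, ← diff_I b, proj_diff]
    rfl
  · simp only [LinearMap.coe_comp, Function.comp_apply, LinearMap.zero_apply]
    rw [twistedDiff_lie b ha, map_add, map_add, map_smul, map_sub,
      proj_lie b (twistedDiff_mem b ha) hc, proj_lie b ha (twistedDiff_mem b hc), proj_act,
      proj_act, zero_add, zero_sub, smul_neg, ← _root_.lie_smul, koszulSign_smul_proj b ha,
      _root_.lie_neg, neg_neg, ← _root_.lie_skew, neg_add_cancel]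

/-- On 𝓘(xᵏ) only brackets of powers of one element x occur, and ad x kills those powers. The
twisting therefore has no effect there, and the claim reduces to `diff_diff`. -/
theorem twistedDiff_twistedDiff (a : LSPlus 𝕜 𝔤) : twistedDiff b (twistedDiff b a) = 0 := by
  refine LinearMap.congr_fun (hom_ext (f := twistedDiff b ∘ₗ twistedDiff b) (g := 0)
    (fun x k => ?_) fun p a ha q c hc h1 h2 => ?_) a
  · have hact : ∀ s t : ℕ+, act 𝕜 (proj b (I 𝕜 x s)) (I 𝕜 x t) = 0 := by
      intro s t
      rw [proj_I]
      split_ifs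
      · exact act_I_self x t
      · exact act_zero _
    have h : ∀ s t : ℕ+, twistedDiff b ⁅I 𝕜 x s, I 𝕜 x t⁆ = diff b ⁅I 𝕜 x s, I 𝕜 x t⁆ := by
      intro s t
      rw [twistedDiff_lie b (I_mem_component x s), diff_lie b (I_mem_component x s), hact, hact,
        add_zero, sub_zero, twistedDiff_I, twistedDiff_I, ← diff_I b, ← diff_I b]
    simp only [LinearMap.coe_comp, Function.comp_apply, LinearMap.zero_apply]
    rw [twistedDiff_I, map_smul, map_sum, ← diff_diff b (I 𝕜 x k), diff_I b, map_smul, map_sum]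
    simp only [h]
  · simp only [LinearMap.coe_comp, Function.comp_apply, LinearMap.zero_apply] at *
    rw [twistedDiff_lie b ha, map_add, map_add, map_smul, map_sub,
      twistedDiff_lie b (twistedDiff_mem b ha), twistedDiff_lie b ha, twistedDiff_act,
      twistedDiff_act, h1, h2, proj_twistedDiff, proj_twistedDiff, act_zero, act_zero,
      koszulSign_add, koszulSign_one]
    simp only [FreeGradedLie.lie_zero, FreeGradedLie.zero_lie, mul_neg, mul_one, neg_smul,
      smul_sub, smul_add, sub_zero, smul_zero, add_zero, zero_add]
    -- The remaining action terms cancel once the sign (-1)ᵖ is evaluated as -1 wherever the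
    -- projection of a is nonzero.
    rw [← act_smul _ (proj b a), koszulSign_smul_proj b ha, act_neg]
    abel

/-- The part of `twistedDiff b` which lowers the weight by one. -/
def contraction : LSPlus 𝕜 𝔤 →ₗ[𝕜] LSPlus 𝕜 𝔤 := twistedDiff b - diff b

theorem twistedDiff_eq (a : LSPlus 𝕜 𝔤) : twistedDiff b a = diff b a + contraction b a := by
  rw [contraction, LinearMap.sub_apply, add_sub_cancel]

theorem contraction_I (x : 𝔤) (k : ℕ+) : contraction b (I 𝕜 x k) = 0 := by
  rw [contraction, LinearMap.sub_apply, twistedDiff_I, diff_I, sub_self]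

theorem contraction_lie {p : ℤ} {a : LSPlus 𝕜 𝔤} (ha : a ∈ component 𝕜 𝔤 p) (c : LSPlus 𝕜 𝔤) :
    contraction b ⁅a, c⁆ = ⁅contraction b a, c⁆ + act 𝕜 (proj b a) c +
      koszulSign 𝕜 p • (⁅a, contraction b c⁆ - act 𝕜 (proj b c) a) := by
  simp only [contraction, LinearMap.sub_apply, twistedDiff_lie b ha, diff_lie b ha,
    FreeGradedLie.sub_lie, FreeGradedLie.lie_sub, smul_sub]
  abel

/-- The contraction trades a bracket with 𝓘(x) for the action of x. The action preserves weight, so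
exactly the weight 1 of 𝓘(x) is lost. -/
theorem weight_contraction (a : LSPlus 𝕜 𝔤) :
    weight 𝕜 𝔤 (contraction b a) = contraction b (weight 𝕜 𝔤 a) - contraction b a := by
  refine LinearMap.congr_fun (hom_ext (f := weight 𝕜 𝔤 ∘ₗ contraction b)
    (g := contraction b ∘ₗ weight 𝕜 𝔤 - contraction b) (fun x k => ?_)
    fun p a ha q c hc h1 h2 => ?_) a
  · simp only [LinearMap.coe_comp, Function.comp_apply, LinearMap.sub_apply]
    rw [weight_I, map_smul, contraction_I, map_zero, smul_zero, sub_zero]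
  · simp only [LinearMap.coe_comp, Function.comp_apply, LinearMap.sub_apply] at *
    rw [weight_lie, map_add, contraction_lie b ha, contraction_lie b ha,
      contraction_lie b (weight_mem_component ha)]
    simp only [map_add, map_smul, map_sub, weight_lie, weight_act, h1, h2, proj_weight,
      FreeGradedLie.sub_lie, FreeGradedLie.lie_sub, smul_sub, smul_add]
    abel

theorem contraction_mem_weightSpace {k : ℕ} {a : LSPlus 𝕜 𝔤} (ha : a ∈ weightSpace 𝕜 𝔤 (k + 1)) :
    contraction b a ∈ weightSpace 𝕜 𝔤 k := by
  rw [mem_weightSpace] at *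
  rw [weight_contraction, ha, map_smul, Nat.cast_add, Nat.cast_one, add_smul, one_smul,
    add_sub_cancel_right]

end

end LSPlus

namespace LSPlus

variable {𝕜 : Type*} [Field 𝕜] {𝔤 : Type*} [LieRing 𝔤] [LieAlgebra 𝕜 𝔤] [CharZero 𝕜]
  [Module.Finite 𝕜 𝔤] {σ : Type*} [Fintype σ] [DecidableEq σ] (b : Module.Basis σ 𝕜 𝔤)

/-! ### Acyclicity of the semi-direct sum -/

theorem twistedDiff_gen (x : 𝔤) : twistedDiff b (gen 𝕜 x) = 0 := by
  rw [twistedDiff_eq, diff_gen, gen_apply, contraction_I, add_zero]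

theorem gen_mem_weightSpace (x : 𝔤) : gen 𝕜 x ∈ weightSpace 𝕜 𝔤 1 :=
  mem_weightSpace.2 (weight_I x 1)

theorem contraction_mem_iSup_weightSpace {K : ℕ} {a : LSPlus 𝕜 𝔤}
    (ha : a ∈ ⨆ (k) (_ : k < K + 1), weightSpace 𝕜 𝔤 k) :
    contraction b a ∈ ⨆ (k) (_ : k < K), weightSpace 𝕜 𝔤 k := by
  refine (iSup₂_le fun k hk a ha => ?_ : _ ≤ (⨆ (k) (_ : k < K), weightSpace 𝕜 𝔤 k).comap
    (contraction b)) ha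
  rw [Submodule.mem_comap]
  rcases k with _ | k
  · rw [weightSpace_zero, Submodule.mem_bot] at ha
    rw [ha, map_zero]
    exact zero_mem _
  · exact Submodule.mem_iSup_of_mem k (Submodule.mem_iSup_of_mem (by omega)
      (contraction_mem_weightSpace b ha))

theorem diff_mem_iSup_weightSpace {K : ℕ} {a : LSPlus 𝕜 𝔤}
    (ha : a ∈ ⨆ (k) (_ : k < K), weightSpace 𝕜 𝔤 k) :
    diff b a ∈ ⨆ (k) (_ : k < K), weightSpace 𝕜 𝔤 k := by
  refine (iSup₂_le fun k hk a ha => ?_ : _ ≤ (⨆ (k) (_ : k < K), weightSpace 𝕜 𝔤 k).comap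
    (diff b)) ha
  exact Submodule.mem_iSup_of_mem k (Submodule.mem_iSup_of_mem hk (diff_mem_weightSpace b ha))

/-- The untwisted cohomology consists of the 𝓘(x), which have weight 1. Only in that weight is a
condition on the projection needed. -/
theorem exists_diff_eq_of_mem_weightSpace {K : ℕ} {a : LSPlus 𝕜 𝔤} (ha : a ∈ weightSpace 𝕜 𝔤 K)
    (hp : K = 1 → proj b a = 0) (hd : diff b a = 0) : ∃ c ∈ weightSpace 𝕜 𝔤 K, diff b c = a := by
  by_cases hK : K = 0
  · subst hK
    rw [weightSpace_zero, Submodule.mem_bot] at ha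
    exact ⟨0, zero_mem _, by rw [ha, map_zero]⟩
  obtain ⟨_, ⟨y, rfl⟩, _, ⟨c, rfl⟩, rfl⟩ := Submodule.mem_sup.1 (mem_of_mem_weightSpace b hK ha hd)
  rw [add_comm] at ha ⊢
  refine exists_mem_component_eq iSupIndep_weightSpace (diff b)
    (fun k a ha => diff_mem_weightSpace b ha) iSup_weightSpace K c _ ?_ ha
  by_cases hK1 : K = 1
  · have := hp hK1
    rw [map_add, proj_gen, proj_diff, add_zero] at this
    rw [this, map_zero]
    exact zero_mem _
  · exact Submodule.mem_iSup_of_mem 1 (Submodule.mem_iSup_of_mem (Ne.symm hK1)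
      (gen_mem_weightSpace y))

/-- Descent on the top weight. The leading part of a twisted cocycle is exact for `diff`, and
correcting by the twisted differential of a primitive lowers the weight bound. -/
theorem exists_twistedDiff_eq_of_mem (K : ℕ) : ∀ (x : 𝔤) (a : LSPlus 𝕜 𝔤),
    a ∈ ⨆ (k) (_ : k < K), weightSpace 𝕜 𝔤 k → proj b a = 0 → twistedDiff b a = 0 →
    ∃ c, proj b c = x ∧ twistedDiff b c = a := by
  induction K with
  | zero =>
    intro x a ha _ _
    have h0 : a = 0 := by simpa using ha
    -- Once a has been exhausted, 𝓘(x) supplies the prescribed element of `𝔤`, as its twisted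
    -- differential is zero.
    exact ⟨gen 𝕜 x, proj_gen b x, by rw [h0, twistedDiff_gen]⟩
  | succ K ih =>
    intro x a ha hp hd
    have hθ := contraction_mem_iSup_weightSpace b ha
    rw [Nat.iSup_lt_succ] at ha
    obtain ⟨a', ha', e, he, rfl⟩ := Submodule.mem_sup.1 ha
    -- In the cocycle equation, `diff b e` is the only contribution of weight K. All others have
    -- smaller weight.
    have hde : diff b e = 0 := by
      refine (Submodule.disjoint_def.1 (iSupIndep_weightSpace (𝕜 := 𝕜) (𝔤 := 𝔤) K)) _
        (diff_mem_weightSpace b he) ?_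
      have hle : ⨆ (k) (_ : k < K), weightSpace 𝕜 𝔤 k ≤ ⨆ (k) (_ : k ≠ K), weightSpace 𝕜 𝔤 k :=
        iSup_mono fun k => iSup_mono' fun hk => ⟨hk.ne, le_rfl⟩
      have h : diff b e = -(diff b a' + contraction b (a' + e)) := by
        rw [twistedDiff_eq, map_add (diff b)] at hd
        rw [eq_neg_iff_add_eq_zero, ← hd]
        abel
      rw [h]
      exact hle (neg_mem (add_mem (diff_mem_iSup_weightSpace b ha') hθ))
    -- For K = 1 the lower part has weight 0 and vanishes, so e is the whole element.
    have hpe : K = 1 → proj b e = 0 := by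
      rintro rfl
      have h0 : a' = 0 := by simpa [weightSpace_zero] using ha'
      rwa [h0, zero_add] at hp
    obtain ⟨c, hc, rfl⟩ := exists_diff_eq_of_mem_weightSpace b he hpe hde
    have hmem : a' + diff b c - twistedDiff b c ∈ ⨆ (k) (_ : k < K), weightSpace 𝕜 𝔤 k := by
      rw [twistedDiff_eq, show a' + diff b c - (diff b c + contraction b c) = a' - contraction b c by
        abel]
      refine sub_mem ha' (contraction_mem_iSup_weightSpace b ?_)
      exact Submodule.mem_iSup_of_mem K (Submodule.mem_iSup_of_mem K.lt_succ_self hc)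
    -- The primitive c may itself have a projection, so the target in `𝔤` is corrected as well.
    obtain ⟨f, hf, hfd⟩ := ih (x - proj b c) _ hmem
      (by rw [map_sub, hp, proj_twistedDiff, sub_zero])
      (by rw [map_sub, hd, twistedDiff_twistedDiff, sub_zero])
    exact ⟨f + c, by rw [map_add, hf, sub_add_cancel], by rw [map_add, hfd, sub_add_cancel]⟩

theorem exists_twistedDiff_eq (x : 𝔤) {a : LSPlus 𝕜 𝔤} (hp : proj b a = 0)
    (hd : twistedDiff b a = 0) : ∃ c, proj b c = x ∧ twistedDiff b c = a := by
  have ha : a ∈ ⨆ K, ⨆ (k) (_ : k < K), weightSpace 𝕜 𝔤 k := by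
    refine (?_ : (⊤ : Submodule 𝕜 (LSPlus 𝕜 𝔤)) ≤ _) trivial
    rw [← iSup_weightSpace]
    exact iSup_le fun k => le_iSup_of_le (k + 1) (le_iSup₂_of_le k k.lt_succ_self le_rfl)
  obtain ⟨K, hK⟩ := (Submodule.mem_iSup_of_directed _ (Monotone.directed_le fun K L hKL =>
    iSup_mono fun k => iSup_mono' fun hk => ⟨hk.trans_le hKL, le_rfl⟩)).1 ha
  exact exists_twistedDiff_eq_of_mem b K x a hK hp hd

end LSPlus

/-! ### Bracket and grading of `D𝔤` -/

namespace Dg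

variable {𝕜 : Type*} [Field 𝕜] {𝔤 : Type*} [LieRing 𝔤] [LieAlgebra 𝕜 𝔤]

theorem ext' {a c : Dg 𝕜 𝔤} (h1 : a.1 = c.1) (h2 : a.2 = c.2) : a = c := Prod.ext h1 h2

theorem eq_l_add_incl (a : Dg 𝕜 𝔤) : a = l 𝕜 𝔤 a.1 + incl 𝕜 𝔤 a.2 :=
  ext' (add_zero _).symm (zero_add _).symm

theorem fst_add (a c : Dg 𝕜 𝔤) : (a + c).1 = a.1 + c.1 := rfl

theorem snd_add (a c : Dg 𝕜 𝔤) : (a + c).2 = a.2 + c.2 := rfl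

theorem fst_smul (r : 𝕜) (a : Dg 𝕜 𝔤) : (r • a).1 = r • a.1 := rfl

theorem snd_smul (r : 𝕜) (a : Dg 𝕜 𝔤) : (r • a).2 = r • a.2 := rfl

theorem fst_lie (a c : Dg 𝕜 𝔤) : ⁅a, c⁆.1 = ⁅a.1, c.1⁆ := rfl

theorem snd_lie (a c : Dg 𝕜 𝔤) :
    ⁅a, c⁆.2 = ⁅a.2, c.2⁆ + LSPlus.act 𝕜 a.1 c.2 - LSPlus.act 𝕜 c.1 a.2 := rfl

theorem mem_component {n : ℤ} {a : Dg 𝕜 𝔤} :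
    a ∈ component 𝕜 𝔤 n ↔ (n ≠ 0 → a.1 = 0) ∧ a.2 ∈ LSPlus.component 𝕜 𝔤 n := by
  rw [component, Submodule.mem_sup]
  constructor
  · rintro ⟨y, hy, _, ⟨c, hc, rfl⟩, rfl⟩
    split_ifs at hy with h
    · obtain ⟨x, rfl⟩ := hy
      refine ⟨fun h' => absurd h h', ?_⟩
      have : (l 𝕜 𝔤 x + incl 𝕜 𝔤 c).2 = c := zero_add c
      rwa [this]
    · obtain rfl := (Submodule.mem_bot 𝕜).1 hy
      rw [zero_add]
      exact ⟨fun _ => rfl, hc⟩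
  · rintro ⟨h1, h2⟩
    refine ⟨l 𝕜 𝔤 a.1, ?_, _, ⟨a.2, h2, rfl⟩, (eq_l_add_incl a).symm⟩
    split_ifs with h
    · exact ⟨_, rfl⟩
    · rw [h1 h, map_zero]
      exact zero_mem _

variable [CharZero 𝕜] [Module.Finite 𝕜 𝔤]

theorem incl_lie_incl (a c : LSPlus 𝕜 𝔤) : ⁅incl 𝕜 𝔤 a, incl 𝕜 𝔤 c⁆ = incl 𝕜 𝔤 ⁅a, c⁆ := by
  refine ext' (_root_.lie_zero (0 : 𝔤)) ?_
  change ⁅a, c⁆ + LSPlus.act 𝕜 (0 : 𝔤) c - LSPlus.act 𝕜 (0 : 𝔤) a = ⁅a, c⁆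
  rw [LSPlus.act_zero, LSPlus.act_zero, add_zero, sub_zero]

variable (𝕜 𝔤) in
theorem iSupIndep_component : iSupIndep (component 𝕜 𝔤) := by
  -- The degree operator: zero on `𝔤`, which lies in degree 0, and the Euler derivation on `𝓛(S⁺𝔤)`.
  let E : Dg 𝕜 𝔤 →ₗ[𝕜] Dg 𝕜 𝔤 := LinearMap.inr 𝕜 𝔤 (LSPlus 𝕜 𝔤) ∘ₗ
    euler 𝕜 (SPlus 𝕜 𝔤) SPlusDeg (fun k => (SPlusDeg k : 𝕜)) ∘ₗ LinearMap.snd 𝕜 𝔤 (LSPlus 𝕜 𝔤)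
  refine ((Module.End.eigenspaces_iSupIndep E).comp (Int.cast_injective (α := 𝕜))).mono
    fun n a ha => Module.End.mem_eigenspace_iff.2 ?_
  obtain ⟨h1, h2⟩ := mem_component.1 ha
  refine ext' ?_ (Module.End.mem_eigenspace_iff.1 (component_le_eigenspace n h2))
  change (0 : 𝔤) = (n : 𝕜) • a.1
  by_cases hn : n = 0
  · rw [hn, Int.cast_zero, zero_smul]
  · rw [h1 hn, smul_zero]

variable (𝕜 𝔤) in
theorem iSup_component : ⨆ n, component 𝕜 𝔤 n = ⊤ := by
  refine eq_top_iff.2 fun a _ => ?_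
  rw [eq_l_add_incl a]
  refine add_mem (Submodule.mem_iSup_of_mem 0 (mem_component.2 ⟨fun h => absurd rfl h, zero_mem _⟩))
    ?_
  have h : (⊤ : Submodule 𝕜 (LSPlus 𝕜 𝔤)) ≤ (⨆ n, component 𝕜 𝔤 n).comap (incl 𝕜 𝔤) := by
    rw [← FreeGradedLie.iSup_component]
    exact iSup_le fun n c hc => Submodule.mem_iSup_of_mem n (mem_component.2 ⟨fun _ => rfl, hc⟩)
  exact h trivial

section

variable {σ : Type*} [Fintype σ] [DecidableEq σ] (b : Module.Basis σ 𝕜 𝔤)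

/-! ### The differential of `D𝔤` -/

/-- The differential of `D𝔤`: its components are `proj b` and `twistedDiff b`. -/
def diff : Dg 𝕜 𝔤 →ₗ[𝕜] Dg 𝕜 𝔤 :=
  ((LSPlus.proj b).prod (LSPlus.twistedDiff b)) ∘ₗ LinearMap.snd 𝕜 𝔤 (LSPlus 𝕜 𝔤)

theorem fst_diff (a : Dg 𝕜 𝔤) : (diff b a).1 = LSPlus.proj b a.2 := rfl

theorem snd_diff (a : Dg 𝕜 𝔤) : (diff b a).2 = LSPlus.twistedDiff b a.2 := rfl

theorem diff_mem {n : ℤ} {a : Dg 𝕜 𝔤} (ha : a ∈ component 𝕜 𝔤 n) :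
    diff b a ∈ component 𝕜 𝔤 (n + 1) := by
  obtain ⟨-, h2⟩ := mem_component.1 ha
  exact mem_component.2 ⟨fun hn => (LSPlus.semidirectDiff_mem b h2).1 (by omega),
    LSPlus.twistedDiff_mem b h2⟩

/-- Equivariance of `proj` and `twistedDiff` handles the `𝔤`-parts, and `twistedDiff_lie` the rest.
The sign acts trivially on the `𝔤`-part of a, which is nonzero only for n = 0. -/
theorem diff_lie {n : ℤ} {a : Dg 𝕜 𝔤} (ha : a ∈ component 𝕜 𝔤 n) (c : Dg 𝕜 𝔤) :
    diff b ⁅a, c⁆ = ⁅diff b a, c⁆ + koszulSign 𝕜 n • ⁅a, diff b c⁆ := by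
  obtain ⟨h1, h2⟩ := mem_component.1 ha
  have hs : koszulSign 𝕜 n • a.1 = a.1 := by
    by_cases hn : n = 0
    · rw [hn, koszulSign_zero, one_smul]
    · rw [h1 hn, smul_zero]
  have hact : ∀ e, koszulSign 𝕜 n • LSPlus.act 𝕜 a.1 e = LSPlus.act 𝕜 a.1 e := fun e => by
    rw [← LSPlus.act_smul, hs]
  apply ext'
  · rw [fst_diff, fst_add, fst_smul, fst_lie, fst_lie, fst_diff, fst_diff, snd_lie, map_sub, map_add,
      LSPlus.proj_lie_left b h2, LSPlus.proj_act, LSPlus.proj_act, ← _root_.smul_lie, hs, zero_add,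
      ← _root_.lie_skew c.1, sub_neg_eq_add, add_comm]
  · rw [snd_diff, snd_add, snd_smul, snd_lie, snd_lie, snd_lie, fst_diff, fst_diff, snd_diff,
      snd_diff, map_sub, map_add, LSPlus.twistedDiff_lie b h2, LSPlus.twistedDiff_act,
      LSPlus.twistedDiff_act]
    simp only [smul_sub, smul_add, hact]
    abel

theorem diff_isDgDifferential : IsDgDifferential 𝕜 𝔤 (diff b) where
  derivation := ⟨fun n a ha => diff_mem b ha, fun n a ha c => by
    rw [diff_lie b ha, negOnePow_smul (𝕜 := 𝕜)]⟩
  map_l x := ext' (map_zero _) (map_zero _)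
  map_I x k := by
    simp only [I, incl_lie_incl, ← map_sum, ← map_smul]
    apply ext'
    · rw [fst_diff, fst_add]
      change LSPlus.proj b (LSPlus.I 𝕜 x k) = 0 + _
      rw [LSPlus.proj_I, zero_add]
      split_ifs <;> rfl
    · rw [snd_diff, snd_add]
      change LSPlus.twistedDiff b (LSPlus.I 𝕜 x k) = _ + _
      rw [LSPlus.twistedDiff_I]
      split_ifs <;> exact (add_zero _).symm

theorem diff_diff (a : Dg 𝕜 𝔤) : diff b (diff b a) = 0 :=
  ext' (LSPlus.proj_twistedDiff b _) (LSPlus.twistedDiff_twistedDiff b _)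

theorem subsingleton_cohomology_diff (n : ℤ) :
    Subsingleton (Cohomology (component 𝕜 𝔤) (diff b) n) := by
  refine subsingleton_cohomology _ _ _ fun a ha hd => ?_
  obtain ⟨c, hc1, hc2⟩ := LSPlus.exists_twistedDiff_eq b a.1 (congrArg Prod.fst hd)
    (congrArg Prod.snd hd)
  -- The summand 0 is the off-degree term required by `exists_mem_component_eq`, which then moves
  -- the primitive into degree n - 1.
  have hc : diff b (incl 𝕜 𝔤 c) + 0 = a := by
    rw [add_zero]
    exact ext' hc1 hc2
  rw [← hc] at ha ⊢
  refine exists_mem_component_eq (A := fun i => component 𝕜 𝔤 (i - 1)) (iSupIndep_component 𝕜 𝔤)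
    (diff b) (fun i a ha => ?_) ?_ n _ 0 (zero_mem _) ha
  · have := diff_mem b ha
    rwa [sub_add_cancel] at this
  · rw [← iSup_component]
    exact (Equiv.subRight (1 : ℤ)).iSup_comp (g := component 𝕜 𝔤)

end

theorem isDgDifferential_unique {d d' : Dg 𝕜 𝔤 →ₗ[𝕜] Dg 𝕜 𝔤}
    (h : IsDgDifferential 𝕜 𝔤 d) (h' : IsDgDifferential 𝕜 𝔤 d') : d = d' := by
  have hincl : d ∘ₗ incl 𝕜 𝔤 = d' ∘ₗ incl 𝕜 𝔤 := by
    refine LSPlus.hom_ext (fun x k => ?_) fun p a ha q c hc h1 h2 => ?_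
    · exact (h.map_I x k).trans (h'.map_I x k).symm
    · simp only [LinearMap.coe_comp, Function.comp_apply] at *
      have ha' : incl 𝕜 𝔤 a ∈ component 𝕜 𝔤 p := mem_component.2 ⟨fun _ => rfl, ha⟩
      rw [← incl_lie_incl, h.derivation.leibniz p _ ha', h'.derivation.leibniz p _ ha', h1, h2]
  refine LinearMap.ext fun a => ?_
  rw [eq_l_add_incl a, map_add, map_add, h.map_l, h'.map_l]
  exact congrArg (0 + ·) (LinearMap.congr_fun hincl a.2)

end Dg

end CartanDGLA

end

/-! ### The main theorem -/

theorem theorem3p7 (𝕜 : Type*) [Field 𝕜] [CharZero 𝕜] (𝔤 : Type*) [LieRing 𝔤] [LieAlgebra 𝕜 𝔤]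
    [Module.Finite 𝕜 𝔤] :
    (∃ d : CartanDGLA.Dg 𝕜 𝔤 →ₗ[𝕜] CartanDGLA.Dg 𝕜 𝔤,
      CartanDGLA.IsDgDifferential 𝕜 𝔤 d ∧
      (∀ d', CartanDGLA.IsDgDifferential 𝕜 𝔤 d' → d' = d) ∧
      (∀ a, d (d a) = 0) ∧
      ∀ n : ℤ, Subsingleton (CartanDGLA.Cohomology (CartanDGLA.Dg.component 𝕜 𝔤) d n)) ∧
    (∃ d : CartanDGLA.LSPlus 𝕜 𝔤 →ₗ[𝕜] CartanDGLA.LSPlus 𝕜 𝔤,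
      CartanDGLA.IsLSPlusDifferential 𝕜 𝔤 d ∧
      (∀ d', CartanDGLA.IsLSPlusDifferential 𝕜 𝔤 d' → d' = d) ∧
      (∀ a, d (d a) = 0) ∧
      (∀ n : ℤ, n ≠ -1 →
        Subsingleton (CartanDGLA.Cohomology (CartanDGLA.LSPlus.component 𝕜 𝔤) d n)) ∧
      ∃ h : ∀ x : 𝔤, CartanDGLA.LSPlus.I 𝕜 x 1 ∈
          CartanDGLA.cocycles (CartanDGLA.LSPlus.component 𝕜 𝔤) d (-1),
        ∃ φ : 𝔤 ≃ₗ[𝕜] CartanDGLA.Cohomology (CartanDGLA.LSPlus.component 𝕜 𝔤) d (-1),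
          ∀ x : 𝔤, φ x = Submodule.Quotient.mk ⟨CartanDGLA.LSPlus.I 𝕜 x 1, h x⟩) := by
  -- The basis serves only to construct the differentials. By uniqueness they do not depend on it.
  let b := Module.finBasis 𝕜 𝔤
  refine ⟨⟨CartanDGLA.Dg.diff b, CartanDGLA.Dg.diff_isDgDifferential b,
      fun d' h => CartanDGLA.Dg.isDgDifferential_unique h (CartanDGLA.Dg.diff_isDgDifferential b),
      CartanDGLA.Dg.diff_diff b, CartanDGLA.Dg.subsingleton_cohomology_diff b⟩,
    ⟨CartanDGLA.LSPlus.diff b, CartanDGLA.LSPlus.diff_isLSPlusDifferential b,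
      fun d' h => CartanDGLA.LSPlus.isLSPlusDifferential_unique h
        (CartanDGLA.LSPlus.diff_isLSPlusDifferential b),
      CartanDGLA.LSPlus.diff_diff b, fun n hn => CartanDGLA.LSPlus.subsingleton_cohomology_diff b hn,
      CartanDGLA.LSPlus.gen_mem_cocycles b,
      LinearEquiv.ofBijective _ (CartanDGLA.LSPlus.genClass_bijective b), fun x => rfl⟩⟩
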